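/- Let a tetrahedron in $\mathbb{R}^3$ be nondegenerate with vertices $V_1,V_2,V_3,V_4$, let $d_{ij}=|V_iV_j|$, and let $\theta_{ij}$ be its interior dihedral angle at the edge $V_iV_j$. A tetrahedron is called a face-to-face tile if $\mathbb{R}^3$ is the union of tetrahedra congruent to it (mirror images allowed), with pairwise disjoint interiors, any two of which are disjoint or meet in a common vertex, a common edge or a common face. A tetrahedron whose six dihedral angles are all of the form $2\pi/n$ with $n$ a positive integer is a face-to-face tile if and only if, up to a permutation of its vertices, $\theta_{ij}=2\pi/n_{ij}$ with $(n_{12},n_{13},n_{14},n_{23},n_{24},n_{34})$ one of the five sextuples - $(3,6,6,8,8,4)$: Sommerville No. 3, the tetrahedra with $(d_{12},d_{13},d_{14},d_{23},d_{24},d_{34})$ proportional to $(\sqrt3,\sqrt3,\sqrt3,2,2,2\sqrt2)$ up to a permutation of the vertices; - $(4,4,4,6,6,8)$: Sommerville No. 2, the tetrahedra with $(d_{12},\dots,d_{34})$ proportional to $(1,\sqrt2,\sqrt2,\sqrt3,\sqrt3,2)$ up to a permutation of the vertices; - $(4,4,8,8,4,6)$: first Goldberg family with $\alpha=2\pi/8$;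 - $(4,5,6,10,5,4)$: first Goldberg family with $\alpha=2\pi/5$; - $(4,6,6,6,6,4)$: Sommerville No. 1, the tetrahedra with $(d_{12},\dots,d_{34})$ proportional to $(2,\sqrt3,\sqrt3,\sqrt3,\sqrt3,2)$ up to a permutation of the vertices. Here the first Goldberg family with parameter $\alpha$ consists of the tetrahedra with $(d_{12},d_{13},d_{14},d_{23},d_{24},d_{34})=(b,c,a,b,c,b)$ up to a permutation of the vertices, where $a,b,c>0$, $a^2/3+b^2=c^2$ and $\sin\alpha=b/c$. Each of the five sextuples is realized by a tetrahedron, and a tetrahedron has the listed dihedral angles, up to a permutation of its vertices, if and only if it is one of the tetrahedra named. The other tetrahedra with all dihedral angles of the form $2\pi/n$ are, up to a permutation of the vertices, exactly those with $(n_{12},n_{13},n_{14},n_{23},n_{24},n_{34})$ equal to $(3,4,5,10,6,6)$ [NT(A)], $(3,5,5,10,10,4)$ [NT(B)], $(3,5,10,10,6,4)$ [NT(C)], $(3,6,10,10,10,3)$ [NT(D)], $(4,4,4,5,6,10)$ [NT(E)], $(4,5,6,5,6,5)$ [NT(F)]. Each of these six sextuples is realized by a tetrahedron, and none of these tetrahedra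 is a face-to-face tile. -/

import Mathlib

open scoped RealInnerProductSpace

/-- Euclidean space of dimension three. -/
abbrev E3 : Type := EuclideanSpace ℝ (Fin 3)

/-- A (nondegenerate) tetrahedron `V₁V₂V₃V₄` in `ℝ³`; the vertices are indexed by `0, 1, 2, 3`. -/
abbrev Tetrahedron : Type := Affine.Simplex ℝ E3 3

noncomputable section

/-- The interior dihedral angle, at the edge `ab`, of a tetrahedron with vertices `a, b, c, d`:
the angle between the components of `c - a` and `d - a` orthogonal to the line of that edge. -/
def dihedralAngle (a b c d : E3) : ℝ :=
  InnerProductGeometry.angle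
    ((Submodule.span ℝ {b - a})ᗮ.starProjection (c - a))
    ((Submodule.span ℝ {b - a})ᗮ.starProjection (d - a))

/-- The dihedral angle of `T` at the edge joining vertices `i` and `j`, where `k` and `l` are the
two other vertices. -/
def Tetrahedron.angle (T : Tetrahedron) (i j k l : Fin 4) : ℝ :=
  dihedralAngle (T.points i) (T.points j) (T.points k) (T.points l)

/-- Every dihedral angle of `T` equals `2π/n` for some positive integer `n` (which may depend on
the edge). -/
def Tetrahedron.AllAnglesTwoPiDiv (T : Tetrahedron) : Prop :=
  ∀ σ : Equiv.Perm (Fin 4), ∃ n : ℕ, 0 < n ∧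
    T.angle (σ 0) (σ 1) (σ 2) (σ 3) = 2 * Real.pi / n

/-- Up to a permutation of the vertices, the dihedral angles of `T` are `θᵢⱼ = 2π/nᵢⱼ`, where `n`
lists `n₁₂, n₁₃, n₁₄, n₂₃, n₂₄, n₃₄`. -/
def Tetrahedron.HasAngles (T : Tetrahedron) (n : Fin 6 → ℕ) : Prop :=
  ∃ σ : Equiv.Perm (Fin 4),
    T.angle (σ 0) (σ 1) (σ 2) (σ 3) = 2 * Real.pi / n 0 ∧
    T.angle (σ 0) (σ 2) (σ 1) (σ 3) = 2 * Real.pi / n 1 ∧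
    T.angle (σ 0) (σ 3) (σ 1) (σ 2) = 2 * Real.pi / n 2 ∧
    T.angle (σ 1) (σ 2) (σ 0) (σ 3) = 2 * Real.pi / n 3 ∧
    T.angle (σ 1) (σ 3) (σ 0) (σ 2) = 2 * Real.pi / n 4 ∧
    T.angle (σ 2) (σ 3) (σ 0) (σ 1) = 2 * Real.pi / n 5

/-- Up to a permutation of the vertices, the edge lengths of `T` are `dᵢⱼ`, where `d` lists
`d₁₂, d₁₃, d₁₄, d₂₃, d₂₄, d₃₄`. -/
def Tetrahedron.HasEdgeLengths (T : Tetrahedron) (d : Fin 6 → ℝ) : Prop :=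
  ∃ σ : Equiv.Perm (Fin 4),
    dist (T.points (σ 0)) (T.points (σ 1)) = d 0 ∧
    dist (T.points (σ 0)) (T.points (σ 2)) = d 1 ∧
    dist (T.points (σ 0)) (T.points (σ 3)) = d 2 ∧
    dist (T.points (σ 1)) (T.points (σ 2)) = d 3 ∧
    dist (T.points (σ 1)) (T.points (σ 3)) = d 4 ∧
    dist (T.points (σ 2)) (T.points (σ 3)) = d 5

/-- The set of vertices of `T`. -/
def Tetrahedron.verts (T : Tetrahedron) : Set E3 := Set.range T.points

/-- The solid closed tetrahedron. -/
def Tetrahedron.body (T : Tetrahedron) : Set E3 := convexHull ℝ T.verts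

/-- The copies `g(T)`, for `g` in a set `G` of isometries of `ℝ³` (orientation-reversing ones are
allowed), form a face-to-face tiling of `ℝ³`: they cover `ℝ³`, distinct copies have disjoint
interiors, and any two copies meet exactly in the face (possibly empty) of both that is spanned by
their common vertices. -/
structure Tetrahedron.IsFaceToFaceTiling (T : Tetrahedron) (G : Set (E3 ≃ᵃⁱ[ℝ] E3)) : Prop where
  covers : (⋃ g ∈ G, g '' T.body) = Set.univ
  disjoint_interiors : ∀ g ∈ G, ∀ h ∈ G, g ≠ h →
    Disjoint (interior (g '' T.body)) (interior (h '' T.body))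
  face_to_face : ∀ g ∈ G, ∀ h ∈ G,
    g '' T.body ∩ h '' T.body = convexHull ℝ (g '' T.verts ∩ h '' T.verts)

/-- `T` is a face-to-face tile: `ℝ³` has a face-to-face tiling by copies congruent to `T`. -/
def Tetrahedron.TilesFaceToFace (T : Tetrahedron) : Prop :=
  ∃ G : Set (E3 ≃ᵃⁱ[ℝ] E3), T.IsFaceToFaceTiling G

/-- `T` belongs to Goldberg's first family with parameter `α`. -/
def Tetrahedron.IsGoldbergFirst (T : Tetrahedron) (α : ℝ) : Prop :=
  ∃ a b c : ℝ, 0 < a ∧ 0 < b ∧ 0 < c ∧ a ^ 2 / 3 + b ^ 2 = c ^ 2 ∧ Real.sin α = b / c ∧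
    T.HasEdgeLengths ![b, c, a, b, c, b]

/-- The five tiles. -/
inductive TileName : Type
  | sommerville3
  | sommerville2
  | goldbergTwoPiDivEight
  | goldbergTwoPiDivFive
  | sommerville1

/-- The integers `n₁₂, n₁₃, n₁₄, n₂₃, n₂₄, n₃₄` of the dihedral angles `2π/nᵢⱼ` of a tile. -/
def TileName.row : TileName → Fin 6 → ℕ
  | .sommerville3 => ![3, 6, 6, 8, 8, 4]
  | .sommerville2 => ![4, 4, 4, 6, 6, 8]
  | .goldbergTwoPiDivEight => ![4, 4, 8, 8, 4, 6]
  | .goldbergTwoPiDivFive => ![4, 5, 6, 10, 5, 4]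
  | .sommerville1 => ![4, 6, 6, 6, 6, 4]

/-- The definition of the named tetrahedra (up to similarity) by their edge lengths. -/
def TileName.Shape : TileName → Tetrahedron → Prop
  | .sommerville3, T => ∃ s : ℝ, 0 < s ∧
      T.HasEdgeLengths (s • ![√3, √3, √3, 2, 2, 2 * √2])
  | .sommerville2, T => ∃ s : ℝ, 0 < s ∧
      T.HasEdgeLengths (s • ![1, √2, √2, √3, √3, 2])
  | .goldbergTwoPiDivEight, T => T.IsGoldbergFirst (2 * Real.pi / 8)
  | .goldbergTwoPiDivFive, T => T.IsGoldbergFirst (2 * Real.pi / 5)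
  | .sommerville1, T => ∃ s : ℝ, 0 < s ∧
      T.HasEdgeLengths (s • ![2, √3, √3, √3, √3, 2])

/-- The six non-tiles NT(A)-NT(F). -/
inductive NonTileName : Type
  | A | B | C | D | E | F

/-- The integers `n₁₂, n₁₃, n₁₄, n₂₃, n₂₄, n₃₄` of the dihedral angles `2π/nᵢⱼ` of a non-tile. -/
def NonTileName.row : NonTileName → Fin 6 → ℕ
  | .A => ![3, 4, 5, 10, 6, 6]
  | .B => ![3, 5, 5, 10, 10, 4]
  | .C => ![3, 5, 10, 10, 6, 4]
  | .D => ![3, 6, 10, 10, 10, 3]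
  | .E => ![4, 4, 4, 5, 6, 10]
  | .F => ![4, 5, 6, 5, 6, 5]

end

/-! Three questions are involved: which sextuples of angles 2π/n occur, why five of the resulting
shapes tile, and why six do not.

Classification. Let A_i be the face areas and c_ij the cosines of the dihedral angles. Projecting
three faces onto the fourth gives A_i = Σ A_j c_ij, so the Gram matrix of the unit face normals
(diagonal 1, off-diagonal −c_ij) is singular with a positive kernel vector, and its principal 3×3
minors are positive (`areaRelations`). Positivity of such a minor says that the three angles at a
vertex form a spherical triangle; in particular their sum exceeds π, which forces the smallest n to
be at most 5. Adding the area relations of the two faces at an edge shows that at one end of this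
edge the other two angles have sum below π (`AreaRelations.cos_add_cos_pos`); with the angle sum at
that end, every n is at most 41. The remaining finite set is searched by kernel computation on
integer approximations of the cosines (`checkEdge_of_mem`). The tests are the spherical
inequalities, the acute pairs, and the sign and rank conditions on the adjugate of the singular Gram
matrix (`AreaRelations.edgeCofactor_pos`). Up to relabelling, eleven rows survive. Explicit edge
lengths realize all of them, and since the angles determine the areas up to scale and then the edges
by the sine rule (`AreaRelations.similar`), each row is a single similarity class.

Non-tiles. In each of the six shapes some length occurs only at edges with angle 2π/n, n odd, and
the two faces at such an edge have different side lengths. In a face-to-face tiling, turning around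
an edge of that length returns to the initial face after n tiles, while the two kinds of faces
alternate. This is impossible for odd n (`Tetrahedron.not_tilesFaceToFace`).

Tiles. The five tiles are simplices of periodic triangulations: an affine image of the Freudenthal
triangulation for the Goldberg shapes and Sommerville No. 1, and two subdivisions of the cubic
lattice into cones from the cube centres for Sommerville No. 2 and No. 3. That simplices meet in
common faces is derived from a description of open vertex stars invariant under the symmetries
(`Tetrahedron.tilesFaceToFace_of_star`). -/

/-! ### Tetrahedra in terms of squared edge lengths -/

/-- Sixteen times the squared area of a triangle with squared side lengths `x`, `y`, `z`. -/
def heron (x y z : ℝ) : ℝ := 2 * (x * y + y * z + z * x) - x ^ 2 - y ^ 2 - z ^ 2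

/-- The numerator of the cosine of the dihedral angle at the edge `12`, in terms of the squared
edge lengths. -/
def dihedralNum (x₁₂ x₁₃ x₁₄ x₂₃ x₂₄ x₃₄ : ℝ) : ℝ :=
  2 * x₁₂ * (x₁₃ + x₁₄ - x₃₄) - (x₁₂ + x₁₃ - x₂₃) * (x₁₂ + x₁₄ - x₂₄)

/-- Eight times the Gram determinant of a tetrahedron, in terms of the squared edge lengths. -/
def gramDet (x₁₂ x₁₃ x₁₄ x₂₃ x₂₄ x₃₄ : ℝ) : ℝ :=
  8 * x₁₂ * x₁₃ * x₁₄ + 2 * (x₁₂ + x₁₃ - x₂₃) * (x₁₂ + x₁₄ - x₂₄) * (x₁₃ + x₁₄ - x₃₄) -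
    2 * x₁₂ * (x₁₃ + x₁₄ - x₃₄) ^ 2 - 2 * x₁₃ * (x₁₂ + x₁₄ - x₂₄) ^ 2 -
    2 * x₁₄ * (x₁₂ + x₁₃ - x₂₃) ^ 2

theorem inner_sub_sub_eq (a b c : E3) :
    ⟪b - a, c - a⟫ = (dist a b ^ 2 + dist a c ^ 2 - dist b c ^ 2) / 2 := by
  have h := norm_sub_sq_real (b - a) (c - a)
  rw [sub_sub_sub_cancel_right] at h
  rw [dist_comm a b, dist_comm a c, dist_eq_norm, dist_eq_norm, dist_eq_norm]
  linarith

/-- Removing the components along u lowers the inner product by ⟪u, v⟫⟪u, w⟫ / ⟪u, u⟫; the factor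
⟪u, u⟫ keeps the identity polynomial. -/
theorem inner_starProjection_orthogonal {u : E3} (hu : u ≠ 0) (v w : E3) :
    ⟪u, u⟫ * ⟪(Submodule.span ℝ {u})ᗮ.starProjection v, (Submodule.span ℝ {u})ᗮ.starProjection w⟫ =
      ⟪u, u⟫ * ⟪v, w⟫ - ⟪u, v⟫ * ⟪u, w⟫ := by
  have huu : ⟪u, u⟫ ≠ 0 := inner_self_ne_zero.2 hu
  have key (v : E3) : (Submodule.span ℝ {u})ᗮ.starProjection v = v - (⟪u, v⟫ / ⟪u, u⟫) • u := by
    rw [Submodule.starProjection_orthogonal_val, Submodule.starProjection_singleton,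
      real_inner_self_eq_norm_sq]
    simp
  rw [key, key, inner_sub_left, inner_sub_right, inner_sub_right, real_inner_smul_left,
    real_inner_smul_left, real_inner_smul_right, real_inner_smul_right, real_inner_comm u v]
  field_simp
  ring

/-- The projected vectors are the altitudes from c and d to the line ab, and 2 · base · altitude is
the square root of `heron`. The law of cosines turns the inner products into squared distances.
Without division the identity needs only a ≠ b. -/
theorem dihedralNum_eq {a b : E3} (hab : a ≠ b) (c d : E3) :
    dihedralNum (dist a b ^ 2) (dist a c ^ 2) (dist a d ^ 2) (dist b c ^ 2) (dist b d ^ 2)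
        (dist c d ^ 2) =
      √(heron (dist a b ^ 2) (dist a c ^ 2) (dist b c ^ 2)) *
        √(heron (dist a b ^ 2) (dist a d ^ 2) (dist b d ^ 2)) *
        Real.cos (dihedralAngle a b c d) := by
  have hu : b - a ≠ 0 := sub_ne_zero.2 hab.symm
  have hpos : 0 < ⟪b - a, b - a⟫ := real_inner_self_pos.2 hu
  set P := (Submodule.span ℝ {b - a})ᗮ.starProjection
  have hnorm (c : E3) : √(heron (dist a b ^ 2) (dist a c ^ 2) (dist b c ^ 2)) =
      2 * √⟪b - a, b - a⟫ * ‖P (c - a)‖ := by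
    rw [← Real.sqrt_sq (norm_nonneg (P (c - a))), ← real_inner_self_eq_norm_sq, mul_assoc,
      ← Real.sqrt_mul hpos.le, inner_starProjection_orthogonal hu, inner_sub_sub_eq,
      inner_sub_sub_eq, inner_sub_sub_eq, dist_self, dist_self,
      show (2 : ℝ) = √(2 ^ 2) by simp, ← Real.sqrt_mul (by norm_num)]
    congr 1
    unfold heron
    ring_nf
  have h := InnerProductGeometry.cos_angle_mul_norm_mul_norm (P (c - a)) (P (d - a))
  have h2 := inner_starProjection_orthogonal hu (c - a) (d - a)
  have hs := Real.mul_self_sqrt hpos.le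
  rw [hnorm, hnorm]
  calc _ = 4 * (⟪b - a, b - a⟫ * ⟪c - a, d - a⟫ - ⟪b - a, c - a⟫ * ⟪b - a, d - a⟫) := by
        rw [inner_sub_sub_eq, inner_sub_sub_eq, inner_sub_sub_eq, inner_sub_sub_eq, dist_self]
        unfold dihedralNum
        ring
    _ = 4 * (⟪b - a, b - a⟫ * ⟪P (c - a), P (d - a)⟫) := by rw [h2]
    _ = 4 * ((√⟪b - a, b - a⟫ * √⟪b - a, b - a⟫) * ⟪P (c - a), P (d - a)⟫) := by rw [hs]
    _ = _ := by
        rw [← h]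
        change _ = _ * Real.cos (InnerProductGeometry.angle (P (c - a)) (P (d - a)))
        ring

theorem dihedralAngle_nonneg (a b c d : E3) : 0 ≤ dihedralAngle a b c d :=
  InnerProductGeometry.angle_nonneg _ _

theorem dihedralAngle_le_pi (a b c d : E3) : dihedralAngle a b c d ≤ Real.pi :=
  InnerProductGeometry.angle_le_pi _ _

theorem dihedralAngle_swap_right (a b c d : E3) : dihedralAngle a b c d = dihedralAngle a b d c :=
  InnerProductGeometry.angle_comm _ _

/-- The vectors c - a and c - b differ by a multiple of b - a, which the projection kills. -/
theorem dihedralAngle_swap_left (a b c d : E3) : dihedralAngle a b c d = dihedralAngle b a c d := by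
  have hspan : Submodule.span ℝ {b - a} = Submodule.span ℝ {a - b} := by
    rw [← neg_sub a b, ← Set.neg_singleton, Submodule.span_neg]
  unfold dihedralAngle
  have key (c : E3) : (Submodule.span ℝ {b - a})ᗮ.starProjection (c - a) =
      (Submodule.span ℝ {a - b})ᗮ.starProjection (c - b) := by
    simp only [hspan]
    rw [← sub_eq_zero, ← map_sub, sub_sub_sub_cancel_left]
    rw [Submodule.starProjection_apply_eq_zero_iff]
    rw [Submodule.orthogonal_orthogonal, ← hspan]
    exact Submodule.mem_span_singleton_self _
  rw [key, key]

/-- Six numbers are the squared edge lengths of a nondegenerate tetrahedron. -/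
structure IsTetrahedral (x₁₂ x₁₃ x₁₄ x₂₃ x₂₄ x₃₄ : ℝ) : Prop where
  edge_pos : 0 < x₁₂
  heron_pos : 0 < heron x₁₂ x₁₃ x₂₃
  gramDet_pos : 0 < gramDet x₁₂ x₁₃ x₁₄ x₂₃ x₂₄ x₃₄

/-- The three quantities are, up to constant factors, the leading principal minors of the Gram
matrix of the edge vectors at the first vertex. -/
theorem isTetrahedral_dist {p : Fin 4 → E3} (hp : AffineIndependent ℝ p) :
    IsTetrahedral (dist (p 0) (p 1) ^ 2) (dist (p 0) (p 2) ^ 2) (dist (p 0) (p 3) ^ 2)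
      (dist (p 1) (p 2) ^ 2) (dist (p 1) (p 3) ^ 2) (dist (p 2) (p 3) ^ 2) := by
  have hli : LinearIndependent ℝ ![p 1 - p 0, p 2 - p 0, p 3 - p 0] := by
    have h := (affineIndependent_iff_linearIndependent_vsub ℝ p 0).1 hp
    let e : Fin 3 → {x : Fin 4 // x ≠ 0} := fun i => ⟨i.succ, Fin.succ_ne_zero i⟩
    have he : Function.Injective e := fun i j hij => by
      simpa [e, Subtype.ext_iff] using hij
    have h2 := h.comp e he
    rw [show (fun i : {x : Fin 4 // x ≠ 0} => p i -ᵥ p 0) ∘ e =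
        ![p 1 - p 0, p 2 - p 0, p 3 - p 0] from
      funext fun i => by fin_cases i <;> rfl] at h2
    exact h2
  have hdet := (Matrix.posDef_gram_of_linearIndependent hli).det_pos
  have hli2 : LinearIndependent ℝ ![p 1 - p 0, p 2 - p 0] := by
    convert hli.comp ![0, 1] (by decide) using 1
    ext i
    fin_cases i <;> rfl
  have hdet2 := (Matrix.posDef_gram_of_linearIndependent hli2).det_pos
  rw [Matrix.det_fin_three] at hdet
  rw [Matrix.det_fin_two] at hdet2
  simp only [Matrix.gram_apply, Matrix.cons_val, inner_sub_sub_eq] at hdet hdet2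
  refine ⟨?_, ?_, ?_⟩
  · have : p 0 ≠ p 1 := hp.injective.ne (by decide)
    have := dist_pos.2 this
    positivity
  · unfold heron
    simp only [dist_self, dist_comm (p 2) (p 1)] at hdet2
    linarith
  · unfold gramDet
    simp only [dist_self, dist_comm (p 2) (p 1), dist_comm (p 3) (p 1), dist_comm (p 3) (p 2)]
      at hdet
    linarith

namespace IsTetrahedral

variable {x₁₂ x₁₃ x₁₄ x₂₃ x₂₄ x₃₄ : ℝ}

/-- This is cos² + sin² = 1 for the dihedral angle with denominators cleared; the last term is the
sine. It transfers positivity from one face at an edge to the other. -/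
theorem _root_.heron_mul_heron (x₁₂ x₁₃ x₁₄ x₂₃ x₂₄ x₃₄ : ℝ) :
    heron x₁₂ x₁₃ x₂₃ * heron x₁₂ x₁₄ x₂₄ =
      dihedralNum x₁₂ x₁₃ x₁₄ x₂₃ x₂₄ x₃₄ ^ 2 + 2 * x₁₂ * gramDet x₁₂ x₁₃ x₁₄ x₂₃ x₂₄ x₃₄ := by
  unfold heron dihedralNum gramDet
  ring

/-- One edge, one face and the determinant suffice for nondegeneracy, as in Sylvester's criterion;
the three adjacent transpositions carry positivity to every edge and face. -/
theorem swap₃₄ (h : IsTetrahedral x₁₂ x₁₃ x₁₄ x₂₃ x₂₄ x₃₄) :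
    IsTetrahedral x₁₂ x₁₄ x₁₃ x₂₄ x₂₃ x₃₄ := by
  obtain ⟨h1, h2, h3⟩ := h
  have hG : gramDet x₁₂ x₁₄ x₁₃ x₂₄ x₂₃ x₃₄ = gramDet x₁₂ x₁₃ x₁₄ x₂₃ x₂₄ x₃₄ := by
    unfold gramDet; ring
  refine ⟨h1, ?_, hG ▸ h3⟩
  have := heron_mul_heron x₁₂ x₁₃ x₁₄ x₂₃ x₂₄ x₃₄
  have h4 : 0 < heron x₁₂ x₁₃ x₂₃ * heron x₁₂ x₁₄ x₂₄ := by rw [this]; positivity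
  exact (pos_iff_pos_of_mul_pos h4).1 h2

theorem swap₁₂ (h : IsTetrahedral x₁₂ x₁₃ x₁₄ x₂₃ x₂₄ x₃₄) :
    IsTetrahedral x₁₂ x₂₃ x₂₄ x₁₃ x₁₄ x₃₄ := by
  obtain ⟨h1, h2, h3⟩ := h
  refine ⟨h1, ?_, ?_⟩
  · convert h2 using 1; unfold heron; ring
  · convert h3 using 1; unfold gramDet; ring

theorem swap₂₃ (h : IsTetrahedral x₁₂ x₁₃ x₁₄ x₂₃ x₂₄ x₃₄) :
    IsTetrahedral x₁₃ x₁₂ x₁₄ x₂₃ x₃₄ x₂₄ := by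
  obtain ⟨h1, h2, h3⟩ := h
  refine ⟨?_, ?_, ?_⟩
  · have : heron x₁₂ x₁₃ x₂₃ = 4 * x₁₂ * x₁₃ - (x₁₂ + x₁₃ - x₂₃) ^ 2 := by unfold heron; ring
    by_contra! hc
    nlinarith [sq_nonneg (x₁₂ + x₁₃ - x₂₃)]
  · convert h2 using 1; unfold heron; ring
  · convert h3 using 1; unfold gramDet; ring

end IsTetrahedral

/-- Nondegenerate tetrahedra exist with prescribed squared edge lengths. -/
theorem exists_tetrahedron {x₁₂ x₁₃ x₁₄ x₂₃ x₂₄ x₃₄ : ℝ}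
    (h : IsTetrahedral x₁₂ x₁₃ x₁₄ x₂₃ x₂₄ x₃₄) :
    ∃ T : Tetrahedron, dist (T.points 0) (T.points 1) ^ 2 = x₁₂ ∧
      dist (T.points 0) (T.points 2) ^ 2 = x₁₃ ∧ dist (T.points 0) (T.points 3) ^ 2 = x₁₄ ∧
      dist (T.points 1) (T.points 2) ^ 2 = x₂₃ ∧ dist (T.points 1) (T.points 3) ^ 2 = x₂₄ ∧
      dist (T.points 2) (T.points 3) ^ 2 = x₃₄ := by
  obtain ⟨h1, h2, h3⟩ := id h
  -- The vertices are placed at (0,0,0), (p,0,0), (q,r,0), (s,t,u); the three hypotheses make p, r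
  -- and u positive.
  set p := √x₁₂
  have hp : 0 < p := Real.sqrt_pos.2 h1
  have hp2 : p ^ 2 = x₁₂ := Real.sq_sqrt h1.le
  set q := (x₁₂ + x₁₃ - x₂₃) / (2 * p) with hq
  set r := √(heron x₁₂ x₁₃ x₂₃) / (2 * p) with hr
  have hr0 : 0 < r := by positivity
  have hqp : 2 * p * q = x₁₂ + x₁₃ - x₂₃ := by rw [hq]; field_simp
  have hrr : 4 * p ^ 2 * r ^ 2 = heron x₁₂ x₁₃ x₂₃ := by
    rw [← Real.sq_sqrt h2.le, hr]; field_simp; ring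
  set s := (x₁₂ + x₁₄ - x₂₄) / (2 * p) with hs
  have hsp : 2 * p * s = x₁₂ + x₁₄ - x₂₄ := by rw [hs]; field_simp
  set t := ((x₁₃ + x₁₄ - x₃₄) / 2 - q * s) / r with ht
  have htr : r * t = (x₁₃ + x₁₄ - x₃₄) / 2 - q * s := by rw [ht]; field_simp
  set u := √(x₁₄ - s ^ 2 - t ^ 2) with hu
  have hqr : q ^ 2 + r ^ 2 = x₁₃ := by
    have : 4 * p ^ 2 * (q ^ 2 + r ^ 2) = 4 * p ^ 2 * x₁₃ := by
      rw [mul_add, hrr, show 4 * p ^ 2 * q ^ 2 = (2 * p * q) ^ 2 by ring, hqp, hp2]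
      unfold heron; ring
    exact mul_left_cancel₀ (by positivity) this
  -- The matrix of edge vectors is triangular, so its Gram determinant is p² r² u².
  have hG : gramDet x₁₂ x₁₃ x₁₄ x₂₃ x₂₄ x₃₄ =
      8 * p ^ 2 * r ^ 2 * (x₁₄ - s ^ 2 - t ^ 2) := by
    have e1 : x₁₂ + x₁₃ - x₂₃ = 2 * p * q := hqp.symm
    have e2 : x₁₂ + x₁₄ - x₂₄ = 2 * p * s := hsp.symm
    have e3 : x₁₃ + x₁₄ - x₃₄ = 2 * (r * t + q * s) := by rw [htr]; ring
    unfold gramDet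
    rw [e1, e2, e3, ← hp2, ← hqr]
    ring
  have hupos : 0 < x₁₄ - s ^ 2 - t ^ 2 := by
    rw [hG] at h3
    exact (pos_iff_pos_of_mul_pos h3).1 (by positivity)
  have hu0 : 0 < u := Real.sqrt_pos.2 hupos
  have hu2 : u ^ 2 = x₁₄ - s ^ 2 - t ^ 2 := Real.sq_sqrt hupos.le
  let P : Fin 4 → E3 := ![!₂[0, 0, 0], !₂[p, 0, 0], !₂[q, r, 0], !₂[s, t, u]]
  have hP : AffineIndependent ℝ P := by
    rw [affineIndependent_iff_linearIndependent_vsub ℝ P 0,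
      ← linearIndependent_equiv (finSuccAboveEquiv (0 : Fin 4)), Fintype.linearIndependent_iff]
    intro g hg
    have h0 := congrArg (fun v : E3 => v 0) hg
    have h1 := congrArg (fun v : E3 => v 1) hg
    have h2 := congrArg (fun v : E3 => v 2) hg
    simp [Fin.sum_univ_three, P, finSuccAboveEquiv] at h0 h1 h2
    have g2 : g 2 = 0 := by
      rcases h2 with h | h
      · exact h
      · exact absurd h hu0.ne'
    rw [g2] at h0 h1
    have g1 : g 1 = 0 := by
      simp at h1
      rcases h1 with h | h
      · exact h
      · exact absurd h hr0.ne'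
    rw [g1] at h0
    have g0 : g 0 = 0 := by
      simp at h0
      rcases h0 with h | h
      · exact h
      · exact absurd h hp.ne'
    intro i
    fin_cases i <;> assumption
  refine ⟨⟨P, hP⟩, ?_, ?_, ?_, ?_, ?_, ?_⟩ <;>
    rw [EuclideanSpace.dist_eq, Real.sq_sqrt (by positivity), Fin.sum_univ_three] <;>
    simp only [Real.dist_eq, sq_abs] <;> simp [P]
  · exact hp2
  · exact hqr
  · linarith
  · linarith [hqr, hqp, hp2, show (p - q) ^ 2 = p ^ 2 - 2 * p * q + q ^ 2 by ring]
  · linarith [hsp, hp2, hu2, show (p - s) ^ 2 = p ^ 2 - 2 * p * s + s ^ 2 by ring]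
  · linarith [htr, hu2, hqr, show (q - s) ^ 2 = q ^ 2 - 2 * (q * s) + s ^ 2 by ring,
      show (r - t) ^ 2 = r ^ 2 - 2 * (r * t) + t ^ 2 by ring]

/-! ### Face areas, cosines and the relations between them -/

/-- The squared edge lengths `x₁₂, x₁₃, x₁₄, x₂₃, x₂₄, x₃₄` of four points. -/
noncomputable def sqEdges (p : Fin 4 → E3) : Fin 6 → ℝ :=
  ![dist (p 0) (p 1) ^ 2, dist (p 0) (p 2) ^ 2, dist (p 0) (p 3) ^ 2, dist (p 1) (p 2) ^ 2,
    dist (p 1) (p 3) ^ 2, dist (p 2) (p 3) ^ 2]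

/-- The dihedral angles at the edges `12, 13, 14, 23, 24, 34` of four points. -/
noncomputable def dihedralAngles (p : Fin 4 → E3) : Fin 6 → ℝ :=
  ![dihedralAngle (p 0) (p 1) (p 2) (p 3), dihedralAngle (p 0) (p 2) (p 1) (p 3),
    dihedralAngle (p 0) (p 3) (p 1) (p 2), dihedralAngle (p 1) (p 2) (p 0) (p 3),
    dihedralAngle (p 1) (p 3) (p 0) (p 2), dihedralAngle (p 2) (p 3) (p 0) (p 1)]

/-- `x` lists the squared edge lengths of a nondegenerate tetrahedron. -/
def IsEdgeVector (x : Fin 6 → ℝ) : Prop := IsTetrahedral (x 0) (x 1) (x 2) (x 3) (x 4) (x 5)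

/-- The squared areas (up to a factor) of the faces opposite to the vertices. -/
def faceSq (x : Fin 6 → ℝ) : Fin 4 → ℝ :=
  ![heron (x 3) (x 4) (x 5), heron (x 1) (x 2) (x 5), heron (x 0) (x 2) (x 4),
    heron (x 0) (x 1) (x 3)]

/-- The numerators of the cosines of the dihedral angles. -/
def cosNum (x : Fin 6 → ℝ) : Fin 6 → ℝ :=
  ![dihedralNum (x 0) (x 1) (x 2) (x 3) (x 4) (x 5),
    dihedralNum (x 1) (x 0) (x 2) (x 3) (x 5) (x 4),
    dihedralNum (x 2) (x 0) (x 1) (x 4) (x 5) (x 3),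
    dihedralNum (x 3) (x 0) (x 4) (x 1) (x 5) (x 2),
    dihedralNum (x 4) (x 0) (x 3) (x 2) (x 5) (x 1),
    dihedralNum (x 5) (x 1) (x 3) (x 2) (x 4) (x 0)]

/-- The two faces that meet at an edge. -/
def facesAt : Fin 6 → Fin 4 × Fin 4 := ![(3, 2), (3, 1), (2, 1), (3, 0), (2, 0), (1, 0)]

/-- A tetrahedron with squared edge lengths `x` has dihedral angles with cosines `c`. -/
def HasCosines (x c : Fin 6 → ℝ) : Prop :=
  ∀ e, cosNum x e = √(faceSq x (facesAt e).1) * √(faceSq x (facesAt e).2) * c e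

theorem isEdgeVector_sqEdges {p : Fin 4 → E3} (hp : AffineIndependent ℝ p) :
    IsEdgeVector (sqEdges p) :=
  isTetrahedral_dist hp

theorem hasCosines_sqEdges {p : Fin 4 → E3} (hp : AffineIndependent ℝ p) :
    HasCosines (sqEdges p) (fun e => Real.cos (dihedralAngles p e)) := by
  have hne {i j : Fin 4} (h : i ≠ j) : p i ≠ p j := hp.injective.ne h
  intro e
  fin_cases e
  · exact dihedralNum_eq (hne (by decide)) (p 2) (p 3)
  · have h := dihedralNum_eq (a := p 0) (b := p 2) (hne (by decide)) (p 1) (p 3)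
    have e1 : heron (dist (p 0) (p 2) ^ 2) (dist (p 0) (p 1) ^ 2) (dist (p 2) (p 1) ^ 2) =
      heron (dist (p 0) (p 1) ^ 2) (dist (p 0) (p 2) ^ 2) (dist (p 1) (p 2) ^ 2) := by
      rw [dist_comm (p 2)]; unfold heron; ring
    rw [e1, dist_comm (p 2) (p 1)] at h
    exact h
  · have h := dihedralNum_eq (a := p 0) (b := p 3) (hne (by decide)) (p 1) (p 2)
    have e1 : heron (dist (p 0) (p 3) ^ 2) (dist (p 0) (p 1) ^ 2) (dist (p 3) (p 1) ^ 2) =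
      heron (dist (p 0) (p 1) ^ 2) (dist (p 0) (p 3) ^ 2) (dist (p 1) (p 3) ^ 2) := by
      rw [dist_comm (p 3)]; unfold heron; ring
    have e2 : heron (dist (p 0) (p 3) ^ 2) (dist (p 0) (p 2) ^ 2) (dist (p 3) (p 2) ^ 2) =
      heron (dist (p 0) (p 2) ^ 2) (dist (p 0) (p 3) ^ 2) (dist (p 2) (p 3) ^ 2) := by
      rw [dist_comm (p 3)]; unfold heron; ring
    rw [e1, e2, dist_comm (p 3) (p 1), dist_comm (p 3) (p 2)] at h
    exact h
  · have h := dihedralNum_eq (a := p 1) (b := p 2) (hne (by decide)) (p 0) (p 3)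
    have e1 : heron (dist (p 1) (p 2) ^ 2) (dist (p 1) (p 0) ^ 2) (dist (p 2) (p 0) ^ 2) =
      heron (dist (p 0) (p 1) ^ 2) (dist (p 0) (p 2) ^ 2) (dist (p 1) (p 2) ^ 2) := by
      rw [dist_comm (p 2) (p 0), dist_comm (p 1) (p 0)]; unfold heron; ring
    rw [e1, dist_comm (p 1) (p 0), dist_comm (p 2) (p 0)] at h
    exact h
  · have h := dihedralNum_eq (a := p 1) (b := p 3) (hne (by decide)) (p 0) (p 2)
    have e1 : heron (dist (p 1) (p 3) ^ 2) (dist (p 1) (p 0) ^ 2) (dist (p 3) (p 0) ^ 2) =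
      heron (dist (p 0) (p 1) ^ 2) (dist (p 0) (p 3) ^ 2) (dist (p 1) (p 3) ^ 2) := by
      rw [dist_comm (p 3) (p 0), dist_comm (p 1) (p 0)]; unfold heron; ring
    have e2 : heron (dist (p 1) (p 3) ^ 2) (dist (p 1) (p 2) ^ 2) (dist (p 3) (p 2) ^ 2) =
      heron (dist (p 1) (p 2) ^ 2) (dist (p 1) (p 3) ^ 2) (dist (p 2) (p 3) ^ 2) := by
      rw [dist_comm (p 3) (p 2)]; unfold heron; ring
    rw [e1, e2, dist_comm (p 1) (p 0), dist_comm (p 3) (p 0), dist_comm (p 3) (p 2)] at h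
    exact h
  · have h := dihedralNum_eq (a := p 2) (b := p 3) (hne (by decide)) (p 0) (p 1)
    have e1 : heron (dist (p 2) (p 3) ^ 2) (dist (p 2) (p 0) ^ 2) (dist (p 3) (p 0) ^ 2) =
      heron (dist (p 0) (p 2) ^ 2) (dist (p 0) (p 3) ^ 2) (dist (p 2) (p 3) ^ 2) := by
      rw [dist_comm (p 3) (p 0), dist_comm (p 2) (p 0)]; unfold heron; ring
    have e2 : heron (dist (p 2) (p 3) ^ 2) (dist (p 2) (p 1) ^ 2) (dist (p 3) (p 1) ^ 2) =
      heron (dist (p 1) (p 2) ^ 2) (dist (p 1) (p 3) ^ 2) (dist (p 2) (p 3) ^ 2) := by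
      rw [dist_comm (p 3) (p 1), dist_comm (p 2) (p 1)]; unfold heron; ring
    rw [e1, e2, dist_comm (p 2) (p 0), dist_comm (p 3) (p 0), dist_comm (p 2) (p 1),
      dist_comm (p 3) (p 1)] at h
    exact h

theorem IsEdgeVector.faceSq_pos {x : Fin 6 → ℝ} (h : IsEdgeVector x) (i : Fin 4) :
    0 < faceSq x i := by
  fin_cases i
  · convert h.swap₁₂.swap₂₃.swap₃₄.swap₂₃.swap₁₂.swap₂₃.heron_pos using 1
    simp [faceSq, heron]; ring
  · convert h.swap₃₄.swap₂₃.swap₃₄.heron_pos using 1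
    simp [faceSq, heron]; ring
  · exact h.swap₃₄.heron_pos
  · exact h.heron_pos

theorem IsEdgeVector.pos {x : Fin 6 → ℝ} (h : IsEdgeVector x) (e : Fin 6) : 0 < x e := by
  fin_cases e
  · exact h.edge_pos
  · exact h.swap₂₃.edge_pos
  · exact h.swap₃₄.swap₂₃.edge_pos
  · exact h.swap₁₂.swap₂₃.edge_pos
  · exact h.swap₁₂.swap₃₄.swap₂₃.edge_pos
  · exact h.swap₂₃.swap₁₂.swap₃₄.swap₂₃.edge_pos

/-- The relations between the face areas `A` (up to a factor), the cosines `c` of the dihedral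
angles and the squared edge lengths `x` of a tetrahedron. -/
structure AreaRelations (x c : Fin 6 → ℝ) (A : Fin 4 → ℝ) (V : ℝ) : Prop where
  pos : ∀ i, 0 < A i
  vol_pos : 0 < V
  area₁ : A 0 = A 1 * c 5 + A 2 * c 4 + A 3 * c 3
  area₂ : A 1 = A 0 * c 5 + A 2 * c 2 + A 3 * c 1
  area₃ : A 2 = A 0 * c 4 + A 1 * c 2 + A 3 * c 0
  area₄ : A 3 = A 0 * c 3 + A 1 * c 1 + A 2 * c 0
  sine : ∀ e, (A (facesAt e).1 * A (facesAt e).2) ^ 2 * (1 - c e ^ 2) = 2 * x e * V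
  minor₁ : 0 < 1 - c 0 ^ 2 - c 1 ^ 2 - c 2 ^ 2 - 2 * c 0 * c 1 * c 2
  minor₂ : 0 < 1 - c 0 ^ 2 - c 3 ^ 2 - c 4 ^ 2 - 2 * c 0 * c 3 * c 4
  minor₃ : 0 < 1 - c 1 ^ 2 - c 3 ^ 2 - c 5 ^ 2 - 2 * c 1 * c 3 * c 5
  minor₄ : 0 < 1 - c 2 ^ 2 - c 4 ^ 2 - c 5 ^ 2 - 2 * c 2 * c 4 * c 5

theorem pos_of_mul_sq_eq {a t d : ℝ} (ha : 0 < a) (hd : 0 < d) (h : a ^ 2 * t = d ^ 2) : 0 < t := by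
  have : 0 < a ^ 2 * t := by rw [h]; positivity
  exact (pos_iff_pos_of_mul_pos this).1 (by positivity)

/-- All relations become polynomial identities in the squared edge lengths once the products of
areas and cosines are replaced by `cosNum` and the squared areas by `faceSq`. -/
theorem areaRelations {x c : Fin 6 → ℝ} (h : IsEdgeVector x) (hc : HasCosines x c) :
    AreaRelations x c (fun i => √(faceSq x i))
      (gramDet (x 0) (x 1) (x 2) (x 3) (x 4) (x 5)) := by
  set G := gramDet (x 0) (x 1) (x 2) (x 3) (x 4) (x 5) with hG
  have hGpos : 0 < G := h.gramDet_pos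
  have hpos (i : Fin 4) : 0 < √(faceSq x i) := Real.sqrt_pos.2 (h.faceSq_pos i)
  have hsq (i : Fin 4) : √(faceSq x i) ^ 2 = faceSq x i := Real.sq_sqrt (h.faceSq_pos i).le
  unfold HasCosines at hc
  generalize hA : (fun i => √(faceSq x i)) = A
  have hA' (i : Fin 4) : √(faceSq x i) = A i := congrFun hA i
  simp only [hA'] at hc hpos hsq
  have c0 := hc 0
  have c1 := hc 1
  have c2 := hc 2
  have c3 := hc 3
  have c4 := hc 4
  have c5 := hc 5
  have s0 := hsq 0
  have s1 := hsq 1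
  have s2 := hsq 2
  have s3 := hsq 3
  have sine (e : Fin 6) (he : faceSq x (facesAt e).1 * faceSq x (facesAt e).2 =
      cosNum x e ^ 2 + 2 * x e * G) :
      (A (facesAt e).1 * A (facesAt e).2) ^ 2 * (1 - c e ^ 2) =
        2 * x e * G := by
    have h1 := hc e
    have h2 := hsq (facesAt e).1
    have h3 := hsq (facesAt e).2
    rw [← h2, ← h3, h1] at he
    linear_combination he
  -- The face normals at a vertex are cross products of the edge vectors there, so their Gram
  -- determinant is, up to normalization, the square of that of the edge vectors.
  have minor (i j k : Fin 4) (u v w : ℝ)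
      (he : A i ^ 2 * A j ^ 2 * A k ^ 2 *
        (1 - u ^ 2 - v ^ 2 - w ^ 2 - 2 * u * v * w) = G ^ 2) :
      0 < 1 - u ^ 2 - v ^ 2 - w ^ 2 - 2 * u * v * w := by
    refine pos_of_mul_sq_eq (a := A i * A j * A k)
      (mul_pos (mul_pos (hpos i) (hpos j)) (hpos k)) hGpos ?_
    rw [← he]; ring
  simp only [facesAt, Matrix.cons_val] at c0 c1 c2 c3 c4 c5
  refine ⟨hpos, hGpos, ?_, ?_, ?_, ?_, ?_, ?_, ?_, ?_, ?_⟩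
  -- Multiplied by the area on the left, the projection formula reads A_i² = Σ A_i A_j c_ij, which
  -- is free of square roots.
  · refine mul_left_cancel₀ (hpos 0).ne' ?_
    have : faceSq x 0 = cosNum x 5 + cosNum x 4 + cosNum x 3 := by
      simp [faceSq, cosNum, heron, dihedralNum]; ring
    rw [c5, c4, c3, ← s0] at this
    linear_combination this
  · refine mul_left_cancel₀ (hpos 1).ne' ?_
    have : faceSq x 1 = cosNum x 5 + cosNum x 2 + cosNum x 1 := by
      simp [faceSq, cosNum, heron, dihedralNum]; ring
    rw [c5, c2, c1, ← s1] at this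
    linear_combination this
  · refine mul_left_cancel₀ (hpos 2).ne' ?_
    have : faceSq x 2 = cosNum x 4 + cosNum x 2 + cosNum x 0 := by
      simp [faceSq, cosNum, heron, dihedralNum]; ring
    rw [c4, c2, c0, ← s2] at this
    linear_combination this
  · refine mul_left_cancel₀ (hpos 3).ne' ?_
    have : faceSq x 3 = cosNum x 3 + cosNum x 1 + cosNum x 0 := by
      simp [faceSq, cosNum, heron, dihedralNum]; ring
    rw [c3, c1, c0, ← s3] at this
    linear_combination this
  · intro e
    refine sine e ?_
    fin_cases e <;>
      · simp [facesAt, faceSq, cosNum, heron, dihedralNum, hG, gramDet]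
        ring
  · apply minor 1 2 3
    have : faceSq x 1 * faceSq x 2 * faceSq x 3 - cosNum x 0 ^ 2 * faceSq x 1 -
        cosNum x 1 ^ 2 * faceSq x 2 - cosNum x 2 ^ 2 * faceSq x 3 -
        2 * cosNum x 0 * cosNum x 1 * cosNum x 2 = G ^ 2 := by
      simp [faceSq, cosNum, heron, dihedralNum, hG, gramDet]; ring
    rw [c0, c1, c2, ← s1, ← s2, ← s3] at this
    linear_combination this
  · apply minor 0 2 3
    have : faceSq x 0 * faceSq x 2 * faceSq x 3 - cosNum x 0 ^ 2 * faceSq x 0 -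
        cosNum x 3 ^ 2 * faceSq x 2 - cosNum x 4 ^ 2 * faceSq x 3 -
        2 * cosNum x 0 * cosNum x 3 * cosNum x 4 = G ^ 2 := by
      simp [faceSq, cosNum, heron, dihedralNum, hG, gramDet]; ring
    rw [c0, c3, c4, ← s0, ← s2, ← s3] at this
    linear_combination this
  · apply minor 0 1 3
    have : faceSq x 0 * faceSq x 1 * faceSq x 3 - cosNum x 1 ^ 2 * faceSq x 0 -
        cosNum x 3 ^ 2 * faceSq x 1 - cosNum x 5 ^ 2 * faceSq x 3 -
        2 * cosNum x 1 * cosNum x 3 * cosNum x 5 = G ^ 2 := by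
      simp [faceSq, cosNum, heron, dihedralNum, hG, gramDet]; ring
    rw [c1, c3, c5, ← s0, ← s1, ← s3] at this
    linear_combination this
  · apply minor 0 1 2
    have : faceSq x 0 * faceSq x 1 * faceSq x 2 - cosNum x 2 ^ 2 * faceSq x 0 -
        cosNum x 4 ^ 2 * faceSq x 1 - cosNum x 5 ^ 2 * faceSq x 2 -
        2 * cosNum x 2 * cosNum x 4 * cosNum x 5 = G ^ 2 := by
      simp [faceSq, cosNum, heron, dihedralNum, hG, gramDet]; ring
    rw [c2, c4, c5, ← s0, ← s1, ← s2] at this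
    linear_combination this

/-- Dihedral angles determine a tetrahedron up to similarity. -/
theorem AreaRelations.similar {x x' c : Fin 6 → ℝ} {A A' : Fin 4 → ℝ} {V V' : ℝ}
    (h : AreaRelations x c A V) (h' : AreaRelations x' c A' V') :
    ∃ k : ℝ, 0 < k ∧ x' = k • x := by
  have hA3 := h.pos 3
  -- Scaled to agree at the last face, the two area vectors differ by a solution (p, q, r) of the
  -- homogeneous system whose determinant is the minor at the fourth vertex. The coefficients below
  -- are the rows of its adjugate.
  have hB : ∀ i, A' i * A 3 = A i * A' 3 := by
    have e1 : A' 0 * A 3 - A 0 * A' 3 = (A' 1 * A 3 - A 1 * A' 3) * c 5 +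
        (A' 2 * A 3 - A 2 * A' 3) * c 4 := by
      linear_combination A 3 * h'.area₁ - A' 3 * h.area₁
    have e2 : A' 1 * A 3 - A 1 * A' 3 = (A' 0 * A 3 - A 0 * A' 3) * c 5 +
        (A' 2 * A 3 - A 2 * A' 3) * c 2 := by
      linear_combination A 3 * h'.area₂ - A' 3 * h.area₂
    have e3 : A' 2 * A 3 - A 2 * A' 3 = (A' 0 * A 3 - A 0 * A' 3) * c 4 +
        (A' 1 * A 3 - A 1 * A' 3) * c 2 := by
      linear_combination A 3 * h'.area₃ - A' 3 * h.area₃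
    have hm := h.minor₄.ne'
    generalize hp : A' 0 * A 3 - A 0 * A' 3 = p at *
    generalize hq : A' 1 * A 3 - A 1 * A' 3 = q at *
    generalize hr : A' 2 * A 3 - A 2 * A' 3 = r at *
    have p0 : p = 0 := by
      refine (mul_eq_zero.1 ?_).resolve_left hm
      linear_combination (1 - c 2 ^ 2) * e1 + (c 5 + c 4 * c 2) * e2 + (c 4 + c 5 * c 2) * e3
    have q0 : q = 0 := by
      refine (mul_eq_zero.1 ?_).resolve_left hm
      linear_combination (c 5 + c 4 * c 2) * e1 + (1 - c 4 ^ 2) * e2 + (c 2 + c 4 * c 5) * e3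
    have r0 : r = 0 := by
      refine (mul_eq_zero.1 ?_).resolve_left hm
      linear_combination (c 4 + c 5 * c 2) * e1 + (c 2 + c 4 * c 5) * e2 + (1 - c 5 ^ 2) * e3
    intro i
    fin_cases i
    · exact sub_eq_zero.1 (hp.trans p0)
    · exact sub_eq_zero.1 (hq.trans q0)
    · exact sub_eq_zero.1 (hr.trans r0)
    · exact mul_comm _ _
  set t := A' 3 / A 3 with ht
  have htpos : 0 < t := div_pos (h'.pos 3) hA3
  have hAt (i : Fin 4) : A' i = t * A i := by
    rw [ht, div_mul_eq_mul_div, eq_div_iff hA3.ne', hB i, mul_comm]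
  have hV := h.vol_pos
  have hV' := h'.vol_pos
  -- In the sine rule (A_i A_j)² (1 − c²) = 2 x V the left side scales by t⁴.
  refine ⟨t ^ 4 * V / V', by positivity, funext fun e => ?_⟩
  have h1 := h.sine e
  have h2 := h'.sine e
  rw [hAt, hAt] at h2
  have h3 : 2 * V' * x' e = 2 * t ^ 4 * V * x e := by linear_combination t ^ 4 * h1 - h2
  simp only [Pi.smul_apply, smul_eq_mul]
  field_simp
  linarith

/-! ### Explicit tetrahedra realizing the eleven rows -/

/-- The squared edge lengths of a tetrahedron with the dihedral angles `t.row`. -/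
noncomputable def TileName.sqEdges : TileName → Fin 6 → ℝ
  | .sommerville3 => ![3, 3, 3, 4, 4, 8]
  | .sommerville2 => ![1, 2, 2, 3, 3, 4]
  | .goldbergTwoPiDivEight => ![1, 2, 1, 1, 2, 3]
  | .goldbergTwoPiDivFive => ![6 + 2 * √5, 5 + 2 * √5, 3, 5 + 2 * √5, 5 + 2 * √5, 6 + 2 * √5]
  | .sommerville1 => ![4, 3, 3, 3, 3, 4]

/-- The squared edge lengths of a tetrahedron with the dihedral angles `t.row`. -/
noncomputable def NonTileName.sqEdges : NonTileName → Fin 6 → ℝ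
  | .A => ![9 - 3 * √5, 8, 5 - √5, 5 + √5, 6, 9 + 3 * √5]
  | .B => ![6, 5 - √5, 5 - √5, 5 + √5, 5 + √5, 8]
  | .C => ![6, 5 + √5, 5 + √5, 5 - √5, 9 + 3 * √5, 12 + 4 * √5]
  | .D => ![6, 9 - 3 * √5, 5 - √5, 5 - √5, 5 + √5, 6]
  | .E => ![3 - √5, 2, 3 + √5, 5 - √5, 6, 5 + √5]
  | .F => ![12 - 4 * √5, 5 - √5, 6, 5 - √5, 6, 5 + √5]

/-- Removes nested radicals: a cosine relation follows from its square and the sign of N c, which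
for the explicit shapes are polynomial statements in √2 and √5. -/
theorem eq_sqrt_mul_sqrt_mul {N M M' c : ℝ} (hM : 0 ≤ M) (hM' : 0 ≤ M') (hs : 0 ≤ N * c)
    (h : N ^ 2 = M * M' * c ^ 2) : N = √M * √M' * c := by
  have h1 : N ^ 2 = (√M * √M' * c) ^ 2 := by
    rw [h, mul_pow, mul_pow, Real.sq_sqrt hM, Real.sq_sqrt hM']
  rcases sq_eq_sq_iff_eq_or_eq_neg.1 h1 with h2 | h2
  · exact h2
  · have h3 : 0 ≤ √M * √M' * c ^ 2 := by positivity
    have h4 : N * c = 0 := by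
      refine le_antisymm ?_ hs
      rw [h2]
      linarith [show -(√M * √M' * c) * c = -(√M * √M' * c ^ 2) by ring]
    rcases mul_eq_zero.1 h4 with h5 | h5
    · linarith
    · rw [h2, h5]; simp

theorem cos_two_pi_div_three : Real.cos (2 * Real.pi / 3) = -1 / 2 := by
  rw [show 2 * Real.pi / 3 = Real.pi - Real.pi / 3 by ring, Real.cos_pi_sub, Real.cos_pi_div_three]
  norm_num

theorem cos_two_pi_div_four : Real.cos (2 * Real.pi / 4) = 0 := by
  rw [show 2 * Real.pi / 4 = Real.pi / 2 by ring, Real.cos_pi_div_two]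

theorem cos_two_pi_div_five : Real.cos (2 * Real.pi / 5) = (√5 - 1) / 4 := by
  rw [show 2 * Real.pi / 5 = 2 * (Real.pi / 5) by ring, Real.cos_two_mul, Real.cos_pi_div_five]
  have := Real.sq_sqrt (show (0 : ℝ) ≤ 5 by norm_num)
  linarith [show ((1 + √5) / 4) ^ 2 = (1 + 2 * √5 + √5 ^ 2) / 16 by ring]

theorem cos_two_pi_div_six : Real.cos (2 * Real.pi / 6) = 1 / 2 := by
  rw [show 2 * Real.pi / 6 = Real.pi / 3 by ring, Real.cos_pi_div_three]

theorem cos_two_pi_div_eight : Real.cos (2 * Real.pi / 8) = √2 / 2 := by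
  rw [show 2 * Real.pi / 8 = Real.pi / 4 by ring, Real.cos_pi_div_four]

theorem cos_two_pi_div_ten : Real.cos (2 * Real.pi / 10) = (1 + √5) / 4 := by
  rw [show 2 * Real.pi / 10 = Real.pi / 5 by ring, Real.cos_pi_div_five]

/-- A tetrahedron with squared edge lengths `x` has dihedral angles `2π/n`. -/
structure Realizes (n : Fin 6 → ℕ) (x : Fin 6 → ℝ) : Prop where
  isEdgeVector : IsEdgeVector x
  hasCosines : HasCosines x (fun e => Real.cos (2 * Real.pi / n e))

theorem sqrt_five_bounds : 2236 / 1000 < √5 ∧ √5 < 2237 / 1000 := by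
  constructor
  · exact Real.lt_sqrt_of_sq_lt (by norm_num)
  · rw [Real.sqrt_lt' (by norm_num)]; norm_num

theorem realizes_of_sq {n : Fin 6 → ℕ} {x : Fin 6 → ℝ} (hx : IsEdgeVector x)
    (hs : ∀ e, 0 ≤ cosNum x e * Real.cos (2 * Real.pi / n e) ∧
      cosNum x e ^ 2 = faceSq x (facesAt e).1 * faceSq x (facesAt e).2 *
        Real.cos (2 * Real.pi / n e) ^ 2) : Realizes n x :=
  ⟨hx, fun e => eq_sqrt_mul_sqrt_mul (hx.faceSq_pos _).le (hx.faceSq_pos _).le (hs e).1 (hs e).2⟩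

set_option maxHeartbeats 4000000 in
theorem TileName.realizes (t : TileName) : Realizes t.row t.sqEdges := by
  have w2 := Real.sq_sqrt (show (0 : ℝ) ≤ 5 by norm_num)
  have v2 := Real.sq_sqrt (show (0 : ℝ) ≤ 2 by norm_num)
  have v3 := Real.sqrt_nonneg 2
  obtain ⟨w3, w4⟩ := sqrt_five_bounds
  refine realizes_of_sq ?_ fun e => ?_
  · cases t <;> refine ⟨?_, ?_, ?_⟩ <;>
      simp only [TileName.sqEdges, Matrix.cons_val, heron, gramDet] <;> nlinarith
  · cases t <;> fin_cases e <;>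
      simp only [TileName.sqEdges, TileName.row, facesAt, Fin.mk_one, Fin.zero_eta, Fin.reduceFinMk,
        Matrix.cons_val, faceSq, cosNum, heron, dihedralNum, Nat.cast_ofNat, cos_two_pi_div_three,
        cos_two_pi_div_four, cos_two_pi_div_five, cos_two_pi_div_six, cos_two_pi_div_eight,
        cos_two_pi_div_ten] <;> (generalize √5 = w at *; generalize √2 = v at *) <;>
        constructor <;> first | nlinarith | grind

set_option maxHeartbeats 4000000 in
theorem NonTileName.realizes (t : NonTileName) : Realizes t.row t.sqEdges := by
  have w2 := Real.sq_sqrt (show (0 : ℝ) ≤ 5 by norm_num)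
  obtain ⟨w3, w4⟩ := sqrt_five_bounds
  refine realizes_of_sq ?_ fun e => ?_
  · cases t <;> refine ⟨?_, ?_, ?_⟩ <;>
      simp only [NonTileName.sqEdges, Matrix.cons_val, heron, gramDet] <;> nlinarith
  · cases t <;> fin_cases e <;>
      simp only [NonTileName.sqEdges, NonTileName.row, facesAt, Fin.mk_one, Fin.zero_eta,
        Fin.reduceFinMk, Matrix.cons_val, faceSq, cosNum, heron, dihedralNum, Nat.cast_ofNat, cos_two_pi_div_three,
        cos_two_pi_div_four, cos_two_pi_div_five, cos_two_pi_div_six, cos_two_pi_div_ten] <;>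
        generalize √5 = w at * <;>
        constructor <;> first | nlinarith | grind

/-! ### From dihedral angles to edge lengths and back -/

theorem hasAngles_iff_dihedralAngles (T : Tetrahedron) (n : Fin 6 → ℕ) :
    T.HasAngles n ↔
      ∃ σ : Equiv.Perm (Fin 4), ∀ e, dihedralAngles (T.points ∘ σ) e = 2 * Real.pi / n e := by
  refine exists_congr fun σ => ⟨?_, fun h => ⟨h 0, h 1, h 2, h 3, h 4, h 5⟩⟩
  rintro ⟨h0, h1, h2, h3, h4, h5⟩ e
  fin_cases e <;> assumption

theorem dihedralAngles_mem_Icc (p : Fin 4 → E3) (e : Fin 6) :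
    dihedralAngles p e ∈ Set.Icc 0 Real.pi := by
  fin_cases e <;> exact ⟨dihedralAngle_nonneg _ _ _ _, dihedralAngle_le_pi _ _ _ _⟩

theorem two_pi_div_mem_Icc {n : ℕ} (hn : 2 ≤ n) : 2 * Real.pi / n ∈ Set.Icc 0 Real.pi := by
  have hn' : (2 : ℝ) ≤ n := by exact_mod_cast hn
  refine ⟨by positivity, ?_⟩
  rw [div_le_iff₀ (by linarith)]
  nlinarith [Real.pi_pos]

theorem affineIndependent_comp_perm (T : Tetrahedron) (σ : Equiv.Perm (Fin 4)) :
    AffineIndependent ℝ (T.points ∘ σ) :=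
  T.independent.comp_embedding σ.toEmbedding

theorem heron_smul (k x y z : ℝ) : heron (k * x) (k * y) (k * z) = k ^ 2 * heron x y z := by
  unfold heron; ring

theorem dihedralNum_smul (k a b c d e f : ℝ) :
    dihedralNum (k * a) (k * b) (k * c) (k * d) (k * e) (k * f) =
      k ^ 2 * dihedralNum a b c d e f := by
  unfold dihedralNum; ring

theorem HasCosines.smul {x c : Fin 6 → ℝ} (h : HasCosines x c) {k : ℝ} (hk : 0 < k) :
    HasCosines (k • x) c := by
  have hf (i : Fin 4) : √(faceSq (k • x) i) = k * √(faceSq x i) := by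
    rw [← Real.sqrt_sq hk.le, ← Real.sqrt_mul (sq_nonneg _), Real.sqrt_sq hk.le]
    congr 1
    fin_cases i <;> exact heron_smul _ _ _ _
  have hn (e : Fin 6) : cosNum (k • x) e = k ^ 2 * cosNum x e := by
    fin_cases e <;> exact dihedralNum_smul _ _ _ _ _ _ _
  intro e
  rw [hf, hf, hn, h e]
  ring

theorem HasCosines.unique {x c c' : Fin 6 → ℝ} (hx : IsEdgeVector x) (h : HasCosines x c)
    (h' : HasCosines x c') (e : Fin 6) : c e = c' e := by
  have h1 := Real.sqrt_pos.2 (hx.faceSq_pos (facesAt e).1)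
  have h2 := Real.sqrt_pos.2 (hx.faceSq_pos (facesAt e).2)
  exact mul_left_cancel₀ (mul_pos h1 h2).ne' ((h e).symm.trans (h' e))

/-- A single realization decides: any other one is similar to it. Conversely cosines are invariant
under scaling and the cosine is injective on [0, π], where n ≥ 2 places 2π/n. -/
theorem hasAngles_iff_sqEdges {n : Fin 6 → ℕ} {x : Fin 6 → ℝ} (hr : Realizes n x)
    (hn : ∀ e, 2 ≤ n e) (T : Tetrahedron) :
    T.HasAngles n ↔
      ∃ σ : Equiv.Perm (Fin 4), ∃ k : ℝ, 0 < k ∧ sqEdges (T.points ∘ σ) = k • x := by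
  rw [hasAngles_iff_dihedralAngles]
  refine exists_congr fun σ => ?_
  have hp := affineIndependent_comp_perm T σ
  constructor
  · intro h
    have hc := hasCosines_sqEdges hp
    simp only [h] at hc
    exact (areaRelations hr.isEdgeVector hr.hasCosines).similar
      (areaRelations (isEdgeVector_sqEdges hp) hc)
  · rintro ⟨k, hk, hkx⟩ e
    have h1 := hr.hasCosines.smul hk
    rw [← hkx] at h1
    exact Real.injOn_cos (dihedralAngles_mem_Icc _ e) (two_pi_div_mem_Icc (hn e))
      ((hasCosines_sqEdges hp).unique (isEdgeVector_sqEdges hp) h1 e)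

theorem Realizes.exists_hasAngles {n : Fin 6 → ℕ} {x : Fin 6 → ℝ} (hr : Realizes n x)
    (hn : ∀ e, 2 ≤ n e) : ∃ T : Tetrahedron, T.HasAngles n := by
  obtain ⟨T, h0, h1, h2, h3, h4, h5⟩ := exists_tetrahedron hr.isEdgeVector
  refine ⟨T, (hasAngles_iff_sqEdges hr hn T).2 ⟨1, 1, one_pos, ?_⟩⟩
  funext e
  rw [one_smul]
  fin_cases e <;> assumption

theorem TileName.two_le_row (t : TileName) (e : Fin 6) : 2 ≤ t.row e := by
  cases t <;> fin_cases e <;> simp [TileName.row]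

theorem NonTileName.two_le_row (t : NonTileName) (e : Fin 6) : 2 ≤ t.row e := by
  cases t <;> fin_cases e <;> simp [NonTileName.row]

/-! ### The named tetrahedra by their edge lengths -/

theorem hasEdgeLengths_iff {T : Tetrahedron} {d : Fin 6 → ℝ} (hd : ∀ e, 0 ≤ d e) :
    T.HasEdgeLengths d ↔
      ∃ σ : Equiv.Perm (Fin 4), sqEdges (T.points ∘ σ) = fun e => d e ^ 2 := by
  refine exists_congr fun σ => ⟨?_, fun h => ?_⟩
  · rintro ⟨h0, h1, h2, h3, h4, h5⟩
    funext e
    fin_cases e <;> simp [sqEdges, *]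
  · have key (e : Fin 6) (a b : E3) (h' : dist a b ^ 2 = d e ^ 2) : dist a b = d e :=
      (pow_left_inj₀ dist_nonneg (hd e) two_ne_zero).1 h'
    exact ⟨key 0 (T.points (σ 0)) (T.points (σ 1)) (congrFun h 0),
      key 1 (T.points (σ 0)) (T.points (σ 2)) (congrFun h 1),
      key 2 (T.points (σ 0)) (T.points (σ 3)) (congrFun h 2),
      key 3 (T.points (σ 1)) (T.points (σ 2)) (congrFun h 3),
      key 4 (T.points (σ 1)) (T.points (σ 3)) (congrFun h 4),
      key 5 (T.points (σ 2)) (T.points (σ 3)) (congrFun h 5)⟩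

theorem exists_smul_hasEdgeLengths_iff {T : Tetrahedron} {d x : Fin 6 → ℝ} (hd : ∀ e, 0 ≤ d e)
    (hx : ∀ e, x e = d e ^ 2) :
    (∃ s : ℝ, 0 < s ∧ T.HasEdgeLengths (s • d)) ↔
      ∃ σ : Equiv.Perm (Fin 4), ∃ k : ℝ, 0 < k ∧ sqEdges (T.points ∘ σ) = k • x := by
  constructor
  · rintro ⟨s, hs, h⟩
    obtain ⟨σ, hσ⟩ := (hasEdgeLengths_iff fun e => mul_nonneg hs.le (hd e)).1 h
    refine ⟨σ, s ^ 2, by positivity, hσ.trans (funext fun e => ?_)⟩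
    simp [hx, mul_pow]
  · rintro ⟨σ, k, hk, h⟩
    refine ⟨√k, Real.sqrt_pos.2 hk,
      (hasEdgeLengths_iff fun e => mul_nonneg (Real.sqrt_nonneg k) (hd e)).2
        ⟨σ, h.trans (funext fun e => ?_)⟩⟩
    simp [hx, mul_pow, Real.sq_sqrt hk.le]

/-- The squared edge lengths of a tetrahedron of Goldberg's first family. -/
theorem isGoldbergFirst_iff {T : Tetrahedron} {α : ℝ} (h0 : 0 < Real.sin α)
    (h1 : Real.sin α ^ 2 < 1) :
    T.IsGoldbergFirst α ↔ ∃ σ : Equiv.Perm (Fin 4), ∃ k : ℝ, 0 < k ∧ sqEdges (T.points ∘ σ) =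
      k • ![Real.sin α ^ 2, 1, 3 * (1 - Real.sin α ^ 2), Real.sin α ^ 2, 1, Real.sin α ^ 2] := by
  set s := Real.sin α
  constructor
  · rintro ⟨a, b, c, ha, hb, hc, habc, hs, h⟩
    have hb' : b = c * s := by rw [show s = b / c from hs]; field_simp
    have hd : ∀ e, 0 ≤ (![b, c, a, b, c, b] : Fin 6 → ℝ) e := by
      intro e
      fin_cases e <;> simp [ha.le, hb.le, hc.le]
    obtain ⟨σ, hσ⟩ := (hasEdgeLengths_iff hd).1 h
    have ha2 : a ^ 2 = c ^ 2 * (3 * (1 - s ^ 2)) := by rw [hb'] at habc; linarith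
    refine ⟨σ, c ^ 2, by positivity, hσ.trans (funext fun e => ?_)⟩
    fin_cases e <;> simp [ha2, hb', mul_pow]
  · rintro ⟨σ, k, hk, h⟩
    have hpos : 0 < 3 * k * (1 - s ^ 2) := by
      have : 0 < 1 - s ^ 2 := by linarith
      positivity
    have hk2 := Real.sq_sqrt hk.le
    have ha2 := Real.sq_sqrt hpos.le
    have hk0 := Real.sqrt_pos.2 hk
    refine ⟨√(3 * k * (1 - s ^ 2)), √k * s, √k, Real.sqrt_pos.2 hpos, by positivity, hk0, ?_, ?_,
      (hasEdgeLengths_iff ?_).2 ⟨σ, h.trans (funext fun e => ?_)⟩⟩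
    · rw [mul_pow, ha2, hk2]; ring
    · exact (mul_div_cancel_left₀ s hk0.ne').symm
    · intro e
      fin_cases e <;> simp <;> positivity
    · fin_cases e <;> simp [ha2, mul_pow, hk2]; ring

/-- Needed because the vertex order and the scale in the definition of Goldberg's family differ from
those of the angle rows. -/
theorem exists_perm_sqEdges_congr {T : Tetrahedron} {x y : Fin 6 → ℝ} (τ : Equiv.Perm (Fin 4))
    (h : ∀ (p : Fin 4 → E3) (k : ℝ), 0 < k → sqEdges p = k • x →
      ∃ k' : ℝ, 0 < k' ∧ sqEdges (p ∘ τ) = k' • y)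
    (hx : ∃ σ : Equiv.Perm (Fin 4), ∃ k : ℝ, 0 < k ∧ sqEdges (T.points ∘ σ) = k • x) :
    ∃ σ : Equiv.Perm (Fin 4), ∃ k : ℝ, 0 < k ∧ sqEdges (T.points ∘ σ) = k • y := by
  obtain ⟨σ, k, hk, hσ⟩ := hx
  obtain ⟨k', hk', h'⟩ := h _ k hk hσ
  exact ⟨σ * τ, k', hk', h'⟩

theorem sqEdges_comp_swap_zero_two (p : Fin 4 → E3) :
    sqEdges (p ∘ Equiv.swap 0 2) = ![sqEdges p 3, sqEdges p 1, sqEdges p 5, sqEdges p 0,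
      sqEdges p 4, sqEdges p 2] := by
  funext e
  have h1 : Equiv.swap (0 : Fin 4) 2 1 = 1 := by decide
  have h3 : Equiv.swap (0 : Fin 4) 2 3 = 3 := by decide
  fin_cases e <;> simp [sqEdges, h1, h3, dist_comm]

theorem sqEdges_comp_swap_one_two (p : Fin 4 → E3) :
    sqEdges (p ∘ Equiv.swap 1 2) = ![sqEdges p 1, sqEdges p 0, sqEdges p 2, sqEdges p 3,
      sqEdges p 5, sqEdges p 4] := by
  funext e
  have h0 : Equiv.swap (1 : Fin 4) 2 0 = 0 := by decide
  have h3 : Equiv.swap (1 : Fin 4) 2 3 = 3 := by decide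
  fin_cases e <;> simp [sqEdges, h0, h3, dist_comm]

theorem sin_sq_two_pi_div_eight : Real.sin (2 * Real.pi / 8) ^ 2 = 1 / 2 := by
  rw [Real.sin_sq, cos_two_pi_div_eight, div_pow, Real.sq_sqrt (by norm_num)]
  norm_num

theorem sin_sq_two_pi_div_five : Real.sin (2 * Real.pi / 5) ^ 2 = (5 + √5) / 8 := by
  have := Real.sq_sqrt (show (0 : ℝ) ≤ 5 by norm_num)
  rw [Real.sin_sq, cos_two_pi_div_five]
  linarith [show ((√5 - 1) / 4) ^ 2 = (√5 ^ 2 - 2 * √5 + 1) / 16 by ring]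

theorem sin_two_pi_div_pos {n : ℕ} (hn : 3 ≤ n) : 0 < Real.sin (2 * Real.pi / n) := by
  have hn' : (3 : ℝ) ≤ n := by exact_mod_cast hn
  have hpi := Real.pi_pos
  apply Real.sin_pos_of_pos_of_lt_pi
  · positivity
  · rw [div_lt_iff₀ (by linarith)]
    nlinarith

theorem goldbergTwoPiDivEight_iff (T : Tetrahedron) :
    TileName.goldbergTwoPiDivEight.Shape T ↔ ∃ σ : Equiv.Perm (Fin 4), ∃ k : ℝ, 0 < k ∧
      sqEdges (T.points ∘ σ) = k • TileName.goldbergTwoPiDivEight.sqEdges := by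
  have hs := sin_sq_two_pi_div_eight
  have h0 : 0 < Real.sin (2 * Real.pi / 8) := sin_two_pi_div_pos (n := 8) (by norm_num)
  refine (isGoldbergFirst_iff h0 (by rw [hs]; norm_num)).trans ?_
  rw [hs]
  constructor
  -- For sin² α = 1/2 the family gives (1, 2, 3, 1, 2, 1) up to the factor 1/2.
  · refine exists_perm_sqEdges_congr (Equiv.swap 0 2) fun p k hk h => ⟨k / 2, by positivity, ?_⟩
    rw [sqEdges_comp_swap_zero_two, h]
    funext e
    fin_cases e <;> simp [TileName.sqEdges] <;> ring
  · refine exists_perm_sqEdges_congr (Equiv.swap 0 2) fun p k hk h => ⟨k * 2, by positivity, ?_⟩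
    rw [sqEdges_comp_swap_zero_two, h]
    funext e
    fin_cases e <;> simp [TileName.sqEdges]
    ring

theorem goldbergTwoPiDivFive_iff (T : Tetrahedron) :
    TileName.goldbergTwoPiDivFive.Shape T ↔ ∃ σ : Equiv.Perm (Fin 4), ∃ k : ℝ, 0 < k ∧
      sqEdges (T.points ∘ σ) = k • TileName.goldbergTwoPiDivFive.sqEdges := by
  have hs := sin_sq_two_pi_div_five
  have h0 : 0 < Real.sin (2 * Real.pi / 5) := sin_two_pi_div_pos (n := 5) (by norm_num)
  have w2 := Real.sq_sqrt (show (0 : ℝ) ≤ 5 by norm_num)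
  obtain ⟨w3, w4⟩ := sqrt_five_bounds
  refine (isGoldbergFirst_iff h0 (by rw [hs]; linarith)).trans ?_
  rw [hs]
  have hne : 6 + 2 * √5 ≠ 0 := by positivity
  constructor
  -- The scale comes from (6 + 2√5)(5 + √5)/8 = 5 + 2√5 and (6 + 2√5)(3 − √5)/8 = 1.
  · refine exists_perm_sqEdges_congr (Equiv.swap 1 2) fun p k hk h =>
      ⟨k / (6 + 2 * √5), by positivity, ?_⟩
    rw [sqEdges_comp_swap_one_two, h]
    funext e
    rw [TileName.sqEdges]
    clear h hs h0
    generalize √5 = w at *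
    fin_cases e <;> simp <;> field_simp <;> grind
  · refine exists_perm_sqEdges_congr (Equiv.swap 1 2) fun p k hk h =>
      ⟨k * (6 + 2 * √5), by positivity, ?_⟩
    rw [sqEdges_comp_swap_one_two, h]
    funext e
    rw [TileName.sqEdges]
    clear h hs h0
    generalize √5 = w at *
    fin_cases e <;> simp <;> grind

theorem TileName.shape_iff_sqEdges (t : TileName) (T : Tetrahedron) :
    t.Shape T ↔ ∃ σ : Equiv.Perm (Fin 4), ∃ k : ℝ, 0 < k ∧
      _root_.sqEdges (T.points ∘ σ) = k • t.sqEdges := by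
  cases t
  case goldbergTwoPiDivEight => exact goldbergTwoPiDivEight_iff T
  case goldbergTwoPiDivFive => exact goldbergTwoPiDivFive_iff T
  all_goals
    refine exists_smul_hasEdgeLengths_iff (fun e => ?_) (fun e => ?_)
    · fin_cases e <;> simp
    · fin_cases e <;> simp [TileName.sqEdges, mul_pow] <;> norm_num

theorem TileName.hasAngles_iff_shape (t : TileName) (T : Tetrahedron) :
    T.HasAngles t.row ↔ t.Shape T :=
  (hasAngles_iff_sqEdges t.realizes t.two_le_row T).trans (t.shape_iff_sqEdges T).symm

/-! ### Local structure of a face-to-face tiling -/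

/-- Four affinely independent points as an affine basis of space. -/
noncomputable def baryBasis {p : Fin 4 → E3} (hp : AffineIndependent ℝ p) :
    AffineBasis (Fin 4) ℝ E3 :=
  ⟨p, hp, hp.affineSpan_eq_top_iff_card_eq_finrank_add_one.2 (by simp)⟩

theorem baryBasis_coord_sum {p : Fin 4 → E3} (hp : AffineIndependent ℝ p) {w : Fin 4 → ℝ}
    (hw : ∑ i, w i = 1) (a : Fin 4) : (baryBasis hp).coord a (∑ i, w i • p i) = w a := by
  have h := (baryBasis hp).coord_apply_combination_of_mem (Finset.mem_univ a) hw
  rwa [Finset.affineCombination_eq_linear_combination _ _ _ hw] at h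

theorem mem_convexHull_range_iff {p : Fin 4 → E3} {x : E3} :
    x ∈ convexHull ℝ (Set.range p) ↔
      ∃ w : Fin 4 → ℝ, (∀ i, 0 ≤ w i) ∧ ∑ i, w i = 1 ∧ ∑ i, w i • p i = x := by
  constructor
  · intro h
    let f : (Fin 4 → ℝ) →ₗ[ℝ] E3 := Fintype.linearCombination ℝ p
    have hr : Set.range p = f '' Set.range fun i j : Fin 4 => if i = j then (1 : ℝ) else 0 := by
      rw [← Set.range_comp]
      congr 1
      funext i
      simp [f, Fintype.linearCombination_apply]
    rw [hr, ← LinearMap.image_convexHull, convexHull_basis_eq_stdSimplex] at h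
    obtain ⟨w, hw, rfl⟩ := h
    exact ⟨w, hw.1, hw.2, rfl⟩
  · rintro ⟨w, h0, h1, rfl⟩
    exact (convex_convexHull ℝ _).sum_mem (fun i _ => h0 i) h1
      fun i _ => subset_convexHull ℝ _ ⟨i, rfl⟩

/-- If the vertex a were not in s, its barycentric coordinate would vanish on s, hence on the hull
of s. -/
theorem mem_of_mem_convexHull {p : Fin 4 → E3} (hp : AffineIndependent ℝ p) {w : Fin 4 → ℝ}
    (hw : ∑ i, w i = 1) {s : Set E3} (hs : s ⊆ Set.range p)
    (hx : ∑ i, w i • p i ∈ convexHull ℝ s) {a : Fin 4} (ha : w a ≠ 0) : p a ∈ s := by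
  by_contra hc
  have hzero : convexHull ℝ s ⊆ {x | (baryBasis hp).coord a x = 0} := by
    refine convexHull_min ?_ ((convex_singleton (0 : ℝ)).affine_preimage _)
    intro x hx
    obtain ⟨i, rfl⟩ := hs hx
    have hia : a ≠ i := by rintro rfl; exact hc hx
    exact (baryBasis hp).coord_apply_ne hia
  have h := hzero hx
  rw [Set.mem_ofPred_eq, baryBasis_coord_sum hp hw] at h
  exact ha h

namespace Tetrahedron

theorem body_eq (T : Tetrahedron) (g : E3 ≃ᵃⁱ[ℝ] E3) :
    g '' T.body = convexHull ℝ (Set.range fun i => g (T.points i)) := by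
  have h := AffineMap.image_convexHull g.toAffineEquiv.toAffineMap T.verts
  have hr : (fun i => g (T.points i)) = g ∘ T.points := rfl
  rw [body, hr, Set.range_comp]
  exact h

theorem image_verts (T : Tetrahedron) (g : E3 ≃ᵃⁱ[ℝ] E3) :
    g '' T.verts = Set.range fun i => g (T.points i) := by
  rw [verts, ← Set.range_comp]
  rfl

theorem affineIndependent_image (T : Tetrahedron) (g : E3 ≃ᵃⁱ[ℝ] E3) :
    AffineIndependent ℝ fun i => g (T.points i) :=
  (AffineEquiv.affineIndependent_iff g.toAffineEquiv).2 T.independent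

theorem isCompact_body (T : Tetrahedron) : IsCompact T.body :=
  (Set.finite_range _).isCompact_convexHull ℝ

theorem exists_ball_subset_body (T : Tetrahedron) :
    ∃ c : E3, ∃ ρ : ℝ, 0 < ρ ∧ Metric.ball c ρ ⊆ T.body := by
  have h : (interior T.body).Nonempty :=
    ⟨_, (baryBasis T.independent).centroid_mem_interior_convexHull⟩
  obtain ⟨c, hc⟩ := h
  obtain ⟨ρ, hρ, hsub⟩ := Metric.isOpen_iff.1 isOpen_interior c hc
  exact ⟨c, ρ, hρ, hsub.trans interior_subset⟩

variable {T : Tetrahedron} {G : Set (E3 ≃ᵃⁱ[ℝ] E3)}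

/-- A face-to-face tiling is locally finite. -/
theorem IsFaceToFaceTiling.finite_near (hG : T.IsFaceToFaceTiling G) (q : E3) :
    {g ∈ G | (g '' T.body ∩ Metric.closedBall q 1).Nonempty}.Finite := by
  obtain ⟨c, ρ, hρ, hc⟩ := T.exists_ball_subset_body
  obtain ⟨D, hD⟩ := T.isCompact_body.isBounded.subset_closedBall c
  -- Each tile contains a ball of radius ρ about its marked point g c, so disjoint interiors keep
  -- these points at distance at least ρ.
  have hsep : ∀ g ∈ G, ∀ h ∈ G, g ≠ h → ρ ≤ dist (g c) (h c) := by
    intro g hg h hh hne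
    by_contra! hlt
    have hsub (k : E3 ≃ᵃⁱ[ℝ] E3) : Metric.ball (k c) ρ ⊆ interior (k '' T.body) := by
      refine interior_maximal ?_ Metric.isOpen_ball
      have := k.toIsometryEquiv.image_ball c ρ
      rw [show Metric.ball (k c) ρ = k '' Metric.ball c ρ from this.symm]
      exact Set.image_mono hc
    refine Set.disjoint_left.1 (hG.disjoint_interiors g hg h hh hne)
      (hsub g (Metric.mem_ball_self hρ)) (hsub h ?_)
    exact hlt
  have hbdd : ∀ g ∈ {g ∈ G | (g '' T.body ∩ Metric.closedBall q 1).Nonempty},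
      g c ∈ Metric.closedBall q (1 + D) := by
    rintro g ⟨-, _, ⟨x, hx, rfl⟩, hxq⟩
    have h1 : dist x c ≤ D := hD hx
    have h2 : dist (g x) (g c) = dist x c := g.dist_map x c
    have h3 : dist (g x) q ≤ 1 := hxq
    rw [Metric.mem_closedBall]
    calc dist (g c) q ≤ dist (g c) (g x) + dist (g x) q := dist_triangle _ _ _
      _ ≤ 1 + D := by rw [dist_comm (g c), h2]; linarith
  -- A ball of radius ρ/2 contains at most one marked point, so finitely many such balls bound the
  -- number of tiles.
  obtain ⟨t, -, ht, hcov⟩ :=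
    (isCompact_closedBall q (1 + D)).finite_cover_balls (half_pos hρ)
  have hchoose : ∀ g ∈ {g ∈ G | (g '' T.body ∩ Metric.closedBall q 1).Nonempty},
      ∃ x ∈ t, dist (g c) x < ρ / 2 := by
    intro g hg
    simpa using hcov (hbdd g hg)
  choose! f hft hf using hchoose
  refine Set.Finite.of_injOn (f := f) hft (fun g hg h hh hgh => ?_) ht
  by_contra hne
  have h1 := hsep g hg.1 h hh.1 hne
  have h2 := hf g hg
  have h3 := hf h hh
  rw [← hgh] at h3
  have := dist_triangle_right (g c) (h c) (f g)
  linarith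

theorem _root_.affineMap_sum (f : E3 →ᵃ[ℝ] ℝ) {w : Fin 4 → ℝ} (hw : ∑ i, w i = 1)
    (x : Fin 4 → E3) : f (∑ i, w i • x i) = ∑ i, w i * f (x i) := by
  have h := Finset.map_affineCombination Finset.univ x w hw f
  rw [Finset.affineCombination_eq_linear_combination _ _ _ hw,
    Finset.affineCombination_eq_linear_combination _ _ _ hw] at h
  simpa using h

/-- Across each face of a tile there is a tile on the other side. -/
theorem IsFaceToFaceTiling.exists_adjacent (hG : T.IsFaceToFaceTiling G) {g : E3 ≃ᵃⁱ[ℝ] E3}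
    (hg : g ∈ G) (a : Fin 4) :
    ∃ h ∈ G, ∃ b : Fin 4, (∀ i ≠ a, ∃ j ≠ b, h (T.points j) = g (T.points i)) ∧
      ∃ w : Fin 4 → ℝ, ∑ i, w i = 1 ∧ w a < 0 ∧ h (T.points b) = ∑ i, w i • g (T.points i) := by
  have hgi := T.affineIndependent_image g
  -- These are the weights of q, the centroid of the face opposite to the vertex a.
  set c : Fin 4 → ℝ := fun i => if i = a then 0 else 1 / 3 with hc
  have hcsum : ∑ i, c i = 1 := by
    fin_cases a <;> simp [hc, Fin.sum_univ_four] <;> norm_num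
  set q := ∑ i, c i • g (T.points i) with hq
  -- The tiles near q that miss q are finite in number, so their union is closed and a small ball
  -- about q avoids it.
  set K := ⋃ k ∈ {k ∈ {g ∈ G | (g '' T.body ∩ Metric.closedBall q 1).Nonempty} | q ∉ k '' T.body},
    k '' T.body with hK
  have hKc : IsClosed K := by
    refine Set.Finite.isClosed_biUnion ((hG.finite_near q).subset (Set.sep_subset _ _)) ?_
    intro k _
    exact (T.isCompact_body.image k.continuous).isClosed
  have hqK : q ∈ Kᶜ := by
    simp only [hK, Set.mem_compl_iff, Set.mem_iUnion, not_exists]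
    intro k hk
    exact hk.2
  obtain ⟨δ, hδ, hδK⟩ := Metric.isOpen_iff.1 hKc.isOpen_compl q hqK
  set M := ‖q - g (T.points a)‖ + 1 with hM
  have hMpos : 0 < M := by positivity
  set t := min (δ / 2) 1 / M with ht
  have ht0 : 0 < t := by positivity
  -- A point just beyond the face. The tile k that covers it also contains q, since y is too close
  -- to q to lie in K.
  set y := q + t • (q - g (T.points a)) with hy
  have hyq : dist y q ≤ min (δ / 2) 1 := by
    rw [hy, dist_self_add_left, norm_smul, Real.norm_of_nonneg ht0.le, ht,
      div_mul_eq_mul_div, div_le_iff₀ hMpos]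
    gcongr
    linarith
  have hycov : y ∈ ⋃ g ∈ G, g '' T.body := by rw [hG.covers]; trivial
  simp only [Set.mem_iUnion] at hycov
  obtain ⟨k, hk, hyk⟩ := hycov
  have hqk : q ∈ k '' T.body := by
    by_contra hcon
    have hyK : y ∈ K := by
      simp only [hK, Set.mem_iUnion]
      exact ⟨k, ⟨⟨hk, y, hyk, hyq.trans (min_le_right _ _)⟩, hcon⟩, hyk⟩
    refine hδK ?_ hyK
    have := hyq.trans (min_le_left _ _)
    rw [Metric.mem_ball]
    linarith
  have hqg : q ∈ g '' T.body := by
    rw [body_eq, mem_convexHull_range_iff]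
    exact ⟨c, fun i => by simp only [hc]; split_ifs <;> norm_num, hcsum, rfl⟩
  -- All three vertices of the face have weight 1/3 in q, so the face-to-face property makes each of
  -- them a vertex of k.
  have hcommon : q ∈ convexHull ℝ (g '' T.verts ∩ k '' T.verts) := by
    rw [← hG.face_to_face g hg k hk]
    exact ⟨hqg, hqk⟩
  have hmatch : ∀ i, i ≠ a → ∃ j, k (T.points j) = g (T.points i) := by
    intro i hi
    have h1 := mem_of_mem_convexHull hgi hcsum (by rw [image_verts]; exact Set.inter_subset_left)
      hcommon (a := i) (by simp [hc, hi])
    have h2 := h1.2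
    rw [image_verts] at h2
    exact h2
  choose! f hf using hmatch
  have hfinj : Set.InjOn f (Finset.univ.erase a : Finset (Fin 4)) := by
    intro i hi j hj hij
    have hi' : i ≠ a := by simpa using hi
    have hj' : j ≠ a := by simpa using hj
    have h1 := hf i hi'
    rw [hij, hf j hj'] at h1
    exact (hgi.injective h1).symm
  have hcard : ((Finset.univ.erase a).image f).card = 3 := by
    rw [Finset.card_image_of_injOn hfinj, Finset.card_erase_of_mem (Finset.mem_univ a)]
    simp
  obtain ⟨b, hb⟩ : ∃ b, b ∉ (Finset.univ.erase a).image f := by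
    by_contra! hall
    have : (Finset.univ.erase a).image f = Finset.univ := by ext; simp [hall]
    rw [this] at hcard
    simp at hcard
  have himage : (Finset.univ.erase a).image f = Finset.univ.erase b := by
    refine Finset.eq_of_subset_of_card_le ?_ ?_
    · intro j hj
      rw [Finset.mem_erase]
      exact ⟨fun h => hb (h ▸ hj), Finset.mem_univ _⟩
    · rw [hcard, Finset.card_erase_of_mem (Finset.mem_univ b)]
      simp
  have hcoord (j : Fin 4) (hj : j ≠ b) : (baryBasis hgi).coord a (k (T.points j)) = 0 := by
    have : j ∈ (Finset.univ.erase a).image f := by rw [himage]; simp [hj]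
    obtain ⟨i, hi, rfl⟩ := Finset.mem_image.1 this
    have hi' : i ≠ a := by simpa using hi
    rw [hf i hi']
    exact (baryBasis hgi).coord_apply_ne hi'.symm
  have hywt : (baryBasis hgi).coord a y = -t := by
    have hy' : y = ∑ i, ((1 + t) * c i - if i = a then t else 0) • g (T.points i) := by
      simp only [sub_smul, Finset.sum_sub_distrib, mul_smul, ← Finset.smul_sum, ← hq]
      simp only [ite_smul, zero_smul, Finset.sum_ite_eq', Finset.mem_univ, if_true, hy]
      module
    have hs : ∑ i, ((1 + t) * c i - if i = a then t else 0) = 1 := by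
      rw [Finset.sum_sub_distrib, ← Finset.mul_sum, hcsum]
      simp
    rw [hy', baryBasis_coord_sum hgi hs]
    simp [hc]
  rw [body_eq, mem_convexHull_range_iff] at hyk
  obtain ⟨v, hv0, hv1, hvy⟩ := hyk
  -- The coordinate at a is −t at y, a convex combination of vertices of k; three of these have
  -- coordinate 0, so the fourth one is on the negative side.
  have hneg : (baryBasis hgi).coord a (k (T.points b)) < 0 := by
    rw [← hvy, affineMap_sum _ hv1, Finset.sum_eq_single b] at hywt
    · have h1 := hv0 b
      by_contra! hcon
      have := mul_nonneg h1 hcon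
      linarith
    · intro j _ hj
      rw [hcoord j hj, mul_zero]
    · simp
  refine ⟨k, hk, b, fun i hi => ⟨f i, ?_, hf i hi⟩,
    fun i => (baryBasis hgi).coord i (k (T.points b)),
    (baryBasis hgi).sum_coord_apply_eq_one _, hneg, ?_⟩
  · rintro rfl
    exact hb (Finset.mem_image_of_mem f (by simp [hi]))
  · exact ((baryBasis hgi).linear_combination_coord_eq_self (k (T.points b))).symm

end Tetrahedron

/-! ### Turning around an edge of a tiling -/

/-- A unit vector in the plane of `x` and `y`, on the other side of `y` than `x` and at the same
angle to `y`, is the mirror image of `x`. -/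
theorem eq_reflection_of_neg {x y z : E3} {r s c : ℝ} (hx : ‖x‖ = 1) (hy : ‖y‖ = 1) (hz : ‖z‖ = 1)
    (hxy : ⟪x, y⟫ = c) (hyz : ⟪y, z⟫ = c) (hc : c ^ 2 < 1) (h : z = r • y + s • x) (hs : s < 0) :
    z = (2 * c) • y - x := by
  have hxx : ⟪x, x⟫ = 1 := by rw [real_inner_self_eq_norm_sq, hx, one_pow]
  have hyy : ⟪y, y⟫ = 1 := by rw [real_inner_self_eq_norm_sq, hy, one_pow]
  have hzz : ⟪z, z⟫ = 1 := by rw [real_inner_self_eq_norm_sq, hz, one_pow]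
  have hyx : ⟪y, x⟫ = c := by rw [real_inner_comm, hxy]
  have e1 : r + s * c = c := by
    rw [h, inner_add_right, real_inner_smul_right, real_inner_smul_right, hyy, hyx] at hyz
    linarith
  have e2 : r ^ 2 + 2 * r * s * c + s ^ 2 = 1 := by
    rw [h] at hzz
    simp only [inner_add_left, inner_add_right, real_inner_smul_left, real_inner_smul_right, hxx,
      hyy, hxy, hyx] at hzz
    linarith
  have e3 : (1 - c ^ 2) * (s ^ 2 - 1) = 0 := by
    have : r = c - s * c := by linarith
    rw [this] at e2
    linear_combination e2
  have e4 : s ^ 2 = 1 := by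
    rcases mul_eq_zero.1 e3 with h | h <;> linarith
  have e5 : s = -1 := by nlinarith
  have e6 : r = 2 * c := by rw [e5] at e1; linarith
  rw [h, e5, e6]
  module

/-- Both sides satisfy the recurrence u (k + 2) = 2 cos θ · u (k + 1) − u k of the sines of
multiples of θ. The factor sin θ avoids a division. -/
theorem rotation_sequence {ζ : ℕ → E3} {θ : ℝ}
    (h : ∀ k, ζ (k + 2) = (2 * Real.cos θ) • ζ (k + 1) - ζ k) (k : ℕ) :
    Real.sin θ • ζ (k + 1) = Real.sin ((k + 1 : ℕ) * θ) • ζ 1 - Real.sin (k * θ) • ζ 0 := by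
  induction k using Nat.twoStepInduction with
  | zero => simp
  | one =>
    rw [h 0, smul_sub, smul_smul]
    push_cast
    rw [Real.sin_two_mul, one_mul]
    congr 2
    ring
  | more k h1 h2 =>
    rw [show k + 2 + 1 = (k + 1) + 2 from rfl, h (k + 1), smul_sub, smul_comm, h1,
      show k + 1 + 1 = k + 1 + 1 from rfl, h2]
    have key (m : ℝ) : Real.sin ((m + 2) * θ) =
        2 * Real.cos θ * Real.sin ((m + 1) * θ) - Real.sin (m * θ) := by
      rw [show (m + 2) * θ = (m + 1) * θ + θ by ring, show m * θ = (m + 1) * θ - θ by ring,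
        Real.sin_add, Real.sin_sub]
      ring
    have k1 := key k
    have k2 := key (k + 1)
    push_cast
    rw [k2,
      show ((k : ℝ) + 1 + 1) = k + 2 by ring, k1]
    module

/-- After `n` reflections by the angle `2π/n` one is back at the start. -/
theorem rotation_sequence_closes {ζ : ℕ → E3} {n : ℕ} (hn : 3 ≤ n)
    (h : ∀ k, ζ (k + 2) = (2 * Real.cos (2 * Real.pi / n)) • ζ (k + 1) - ζ k) : ζ n = ζ 0 := by
  obtain ⟨k, rfl⟩ : ∃ k, n = k + 1 := ⟨n - 1, by omega⟩
  set θ := 2 * Real.pi / (k + 1 : ℕ) with hθ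
  have hs : 0 < Real.sin θ := sin_two_pi_div_pos hn
  have h1 := rotation_sequence h k
  have hne : ((k + 1 : ℕ) : ℝ) ≠ 0 := by positivity
  have e1 : ((k + 1 : ℕ) : ℝ) * θ = 2 * Real.pi := by rw [hθ]; field_simp
  have e2 : (k : ℝ) * θ = 2 * Real.pi - θ := by
    rw [← e1]; push_cast; ring
  rw [e1, e2, Real.sin_two_pi, Real.sin_two_pi_sub, zero_smul, neg_smul, zero_sub, neg_neg] at h1
  exact smul_right_injective E3 hs.ne' h1

namespace Tetrahedron

/-- Isometries preserve the numerator of the cosine, a polynomial in squared distances. The common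
factor is cancelled later, where it is known to be nonzero. -/
theorem dihedralAngle_image (T : Tetrahedron) (g : E3 ≃ᵃⁱ[ℝ] E3) {i j : Fin 4} (hij : i ≠ j)
    (k l : Fin 4) :
    √(heron (dist (T.points i) (T.points j) ^ 2) (dist (T.points i) (T.points k) ^ 2)
        (dist (T.points j) (T.points k) ^ 2)) *
      √(heron (dist (T.points i) (T.points j) ^ 2) (dist (T.points i) (T.points l) ^ 2)
        (dist (T.points j) (T.points l) ^ 2)) *
      Real.cos (dihedralAngle (g (T.points i)) (g (T.points j)) (g (T.points k)) (g (T.points l))) =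
    √(heron (dist (T.points i) (T.points j) ^ 2) (dist (T.points i) (T.points k) ^ 2)
        (dist (T.points j) (T.points k) ^ 2)) *
      √(heron (dist (T.points i) (T.points j) ^ 2) (dist (T.points i) (T.points l) ^ 2)
        (dist (T.points j) (T.points l) ^ 2)) *
      Real.cos (T.angle i j k l) := by
  have hne : T.points i ≠ T.points j := T.independent.injective.ne hij
  have h1 := dihedralNum_eq hne (T.points k) (T.points l)
  have h2 := dihedralNum_eq (g.injective.ne hne) (g (T.points k)) (g (T.points l))
  simp only [AffineIsometryEquiv.dist_map] at h2
  rw [Tetrahedron.angle, ← h1, ← h2]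

theorem cos_dihedralAngle_image (T : Tetrahedron) (g : E3 ≃ᵃⁱ[ℝ] E3) (σ : Equiv.Perm (Fin 4)) :
    Real.cos (dihedralAngle (g (T.points (σ 0))) (g (T.points (σ 1))) (g (T.points (σ 2)))
      (g (T.points (σ 3)))) = Real.cos (T.angle (σ 0) (σ 1) (σ 2) (σ 3)) := by
  have hx := isEdgeVector_sqEdges (affineIndependent_comp_perm T σ)
  have h1 := Real.sqrt_pos.2 (hx.faceSq_pos 3)
  have h2 := Real.sqrt_pos.2 (hx.faceSq_pos 2)
  exact mul_left_cancel₀ (mul_pos h1 h2).ne'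
    (T.dihedralAngle_image g (σ.injective.ne (by decide)) (σ 2) (σ 3))

theorem exists_perm_of_ne {i j k l : Fin 4} (hij : i ≠ j) (hik : i ≠ k) (hil : i ≠ l) (hjk : j ≠ k)
    (hjl : j ≠ l) (hkl : k ≠ l) :
    ∃ σ : Equiv.Perm (Fin 4), σ 0 = i ∧ σ 1 = j ∧ σ 2 = k ∧ σ 3 = l := by
  have hinj : Function.Injective ![i, j, k, l] := by
    intro a b hab
    fin_cases a <;> fin_cases b <;> simp_all
  refine ⟨Equiv.ofBijective _ ⟨hinj, Finite.surjective_of_injective hinj⟩, ?_, ?_, ?_, ?_⟩ <;> rfl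

/-- A tile around the edge `PQ` of a tiling, as seen in a rotation around this edge: the vertices
`σ 0` and `σ 1` are at `P` and `Q`. -/
def IsAround (T : Tetrahedron) (G : Set (E3 ≃ᵃⁱ[ℝ] E3)) (P Q : E3)
    (s : (E3 ≃ᵃⁱ[ℝ] E3) × Equiv.Perm (Fin 4)) : Prop :=
  s.1 ∈ G ∧ s.1 (T.points (s.2 0)) = P ∧ s.1 (T.points (s.2 1)) = Q

variable {T : Tetrahedron} {G : Set (E3 ≃ᵃⁱ[ℝ] E3)} {P Q : E3}

/-- The face opposite to `σ 2` contains PQ and is crossed. The old vertex 3 becomes vertex 2 of the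
next tile, and the negative weight at the old vertex 2 records that the new vertex 3 lies on the
other side. -/
theorem IsFaceToFaceTiling.exists_next (hG : T.IsFaceToFaceTiling G)
    {s : (E3 ≃ᵃⁱ[ℝ] E3) × Equiv.Perm (Fin 4)} (hs : T.IsAround G P Q s) :
    ∃ s', T.IsAround G P Q s' ∧ s'.1 (T.points (s'.2 2)) = s.1 (T.points (s.2 3)) ∧
      ∃ w : Fin 4 → ℝ, ∑ i, w i = 1 ∧ w 3 < 0 ∧ s'.1 (T.points (s'.2 3)) =
        w 0 • P + w 1 • Q + w 2 • s.1 (T.points (s.2 3)) + w 3 • s.1 (T.points (s.2 2)) := by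
  obtain ⟨g, σ⟩ := s
  obtain ⟨hg, hP, hQ⟩ := hs
  obtain ⟨h, hh, b, hf, w, hw1, hwa, hwb⟩ := hG.exists_adjacent hg (σ 2)
  obtain ⟨i, hib, hi⟩ := hf (σ 0) (σ.injective.ne (by decide))
  obtain ⟨j, hjb, hj⟩ := hf (σ 1) (σ.injective.ne (by decide))
  obtain ⟨k, hkb, hk⟩ := hf (σ 3) (σ.injective.ne (by decide))
  have hgi := (T.affineIndependent_image g).injective
  have hne {x y m n : Fin 4} (hxy : x ≠ y) (hm : h (T.points m) = g (T.points (σ x)))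
      (hn : h (T.points n) = g (T.points (σ y))) : m ≠ n := by
    rintro rfl
    exact hxy (σ.injective (hgi (hm.symm.trans hn)))
  obtain ⟨τ, h0, h1, h2, h3⟩ := exists_perm_of_ne (hne (by decide) hi hj)
    (hne (by decide) hi hk) hib
    (hne (by decide) hj hk) hjb hkb
  refine ⟨(h, τ), ⟨hh, ?_, ?_⟩, ?_, ![w (σ 0), w (σ 1), w (σ 3), w (σ 2)], ?_, ?_, ?_⟩
  · simp only [h0, hi]; exact hP
  · simp only [h1, hj]; exact hQ
  · simp only [h2, hk]
  · rw [← Equiv.sum_comp σ, Fin.sum_univ_four] at hw1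
    rw [Fin.sum_univ_four]
    simp only [Matrix.cons_val]
    linarith
  · exact hwa
  · simp only [h3, hwb, ← hP, ← hQ]
    rw [← Equiv.sum_comp σ, Fin.sum_univ_four]
    exact add_right_comm _ _ _

/-- The tiles around an edge, in order. -/
theorem IsFaceToFaceTiling.exists_sequence (hG : T.IsFaceToFaceTiling G)
    {s₀ : (E3 ≃ᵃⁱ[ℝ] E3) × Equiv.Perm (Fin 4)} (hs₀ : T.IsAround G P Q s₀) :
    ∃ s : ℕ → (E3 ≃ᵃⁱ[ℝ] E3) × Equiv.Perm (Fin 4), ∃ R : ℕ → E3, (∀ k, T.IsAround G P Q (s k)) ∧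
      (∀ k, (s k).1 (T.points ((s k).2 2)) = R k) ∧
      (∀ k, (s k).1 (T.points ((s k).2 3)) = R (k + 1)) ∧
      ∀ k, ∃ w : Fin 4 → ℝ, ∑ i, w i = 1 ∧ w 3 < 0 ∧
        R (k + 2) = w 0 • P + w 1 • Q + w 2 • R (k + 1) + w 3 • R k := by
  choose! f hf1 hf2 hf3 using fun s (hs : T.IsAround G P Q s) => hG.exists_next hs
  set s : ℕ → (E3 ≃ᵃⁱ[ℝ] E3) × Equiv.Perm (Fin 4) := fun k => f^[k] s₀ with hsdef
  have hs : ∀ k, T.IsAround G P Q (s k) := by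
    intro k
    induction k with
    | zero => exact hs₀
    | succ k ih =>
      simp only [hsdef, Function.iterate_succ_apply'] at ih ⊢
      exact hf1 _ ih
  have hstep (k : ℕ) : s (k + 1) = f (s k) := Function.iterate_succ_apply' f k s₀
  have h3 (k : ℕ) : (s k).1 (T.points ((s k).2 3)) =
      (s (k + 1)).1 (T.points ((s (k + 1)).2 2)) := by
    rw [hstep, hf2 _ (hs k)]
  refine ⟨s, fun k => (s k).1 (T.points ((s k).2 2)), hs, fun _ => rfl, h3, fun k => ?_⟩
  obtain ⟨w, h1, h2, h4⟩ := hf3 _ (hs k)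
  refine ⟨w, h1, h2, ?_⟩
  rw [← hstep] at h4
  change (s (k + 1 + 1)).1 _ = _
  rw [← h3 (k + 1), h4, h3 k]

/-- If the length of an edge occurs only with the dihedral angle `2π/n`, `n` odd, and each time one
of the two faces at the edge is distinguished from the other by its edge lengths, then there is no
face-to-face tiling. -/
theorem not_tilesFaceToFace (T : Tetrahedron) {n : ℕ} (hn : 3 ≤ n) (hodd : Odd n) (ℓ v : ℝ)
    (hℓ : ∃ σ : Equiv.Perm (Fin 4), dist (T.points (σ 0)) (T.points (σ 1)) ^ 2 = ℓ)
    (H : ∀ σ : Equiv.Perm (Fin 4), dist (T.points (σ 0)) (T.points (σ 1)) ^ 2 = ℓ →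
      T.angle (σ 0) (σ 1) (σ 2) (σ 3) = 2 * Real.pi / n ∧
      (dist (T.points (σ 0)) (T.points (σ 3)) ^ 2 + dist (T.points (σ 1)) (T.points (σ 3)) ^ 2 = v ↔
        ¬ dist (T.points (σ 0)) (T.points (σ 2)) ^ 2 +
          dist (T.points (σ 1)) (T.points (σ 2)) ^ 2 = v)) :
    ¬ T.TilesFaceToFace := by
  rintro ⟨G, hG⟩
  obtain ⟨g₀, hg₀⟩ : ∃ g, g ∈ G := by
    have h0 : (0 : E3) ∈ ⋃ g ∈ G, g '' T.body := by rw [hG.covers]; trivial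
    simp only [Set.mem_iUnion] at h0
    obtain ⟨g, hg, -⟩ := h0
    exact ⟨g, hg⟩
  obtain ⟨σ₀, hσ₀⟩ := hℓ
  obtain ⟨P, hP⟩ : ∃ P, g₀ (T.points (σ₀ 0)) = P := ⟨_, rfl⟩
  obtain ⟨Q, hQ⟩ : ∃ Q, g₀ (T.points (σ₀ 1)) = Q := ⟨_, rfl⟩
  obtain ⟨s, R, hs, hR2, hR3, hR⟩ := hG.exists_sequence (P := P) (Q := Q) (s₀ := (g₀, σ₀))
    ⟨hg₀, hP, hQ⟩
  have hPQ : dist P Q ^ 2 = ℓ := by rw [← hP, ← hQ, g₀.dist_map, hσ₀]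
  have hlen (k : ℕ) : dist (T.points ((s k).2 0)) (T.points ((s k).2 1)) ^ 2 = ℓ := by
    rw [← hPQ, ← (hs k).2.1, ← (hs k).2.2, (s k).1.dist_map]
  have hang (k : ℕ) : Real.cos (dihedralAngle P Q (R k) (R (k + 1))) =
      Real.cos (2 * Real.pi / n) := by
    rw [← (H (s k).2 (hlen k)).1, ← T.cos_dihedralAngle_image (s k).1, (hs k).2.1, (hs k).2.2, hR2,
      hR3]
  -- the labels of the faces alternate
  have hlab (k : ℕ) : (dist P (R (k + 1)) ^ 2 + dist Q (R (k + 1)) ^ 2 = v ↔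
      ¬ dist P (R k) ^ 2 + dist Q (R k) ^ 2 = v) := by
    have := (H (s k).2 (hlen k)).2
    have hd (a b : Fin 4) : dist (T.points a) (T.points b) =
        dist ((s k).1 (T.points a)) ((s k).1 (T.points b)) := ((s k).1.dist_map _ _).symm
    rw [hd ((s k).2 0) ((s k).2 3), hd ((s k).2 1) ((s k).2 3), hd ((s k).2 0) ((s k).2 2),
      hd ((s k).2 1) ((s k).2 2)] at this
    rwa [(hs k).2.1, (hs k).2.2, hR2, hR3] at this
  have hparity (k : ℕ) : (dist P (R k) ^ 2 + dist Q (R k) ^ 2 = v ↔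
      (Even k ↔ dist P (R 0) ^ 2 + dist Q (R 0) ^ 2 = v)) := by
    induction k with
    | zero => exact ⟨fun h => ⟨fun _ => h, fun _ => Even.zero⟩, fun h => h.1 Even.zero⟩
    | succ k ih => rw [hlab k, ih, Nat.even_add_one]; tauto
  -- The labels alternate, so a return to the initial face after an odd number of steps is
  -- contradictory.
  suffices hclose : R n = R 0 by
    have h1 := hparity n
    rw [hclose] at h1
    have : ¬ Even n := Nat.not_even_iff_odd.2 hodd
    tauto
  have hind (k : ℕ) : AffineIndependent ℝ fun i => (s k).1 (T.points ((s k).2 i)) :=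
    (T.affineIndependent_image (s k).1).comp_embedding (s k).2.toEmbedding
  have hpts (k : ℕ) (w : Fin 4 → ℝ) : ∑ i, w i • (s k).1 (T.points ((s k).2 i)) =
      w 0 • P + w 1 • Q + w 2 • R k + w 3 • R (k + 1) := by
    rw [Fin.sum_univ_four, (hs k).2.1, (hs k).2.2, hR2, hR3]
  set pr := (Submodule.span ℝ {Q - P})ᗮ.starProjection with hpr
  have hker (x : E3) (hx : pr x = 0) : ∃ c : ℝ, x = c • (Q - P) := by
    rw [hpr, Submodule.starProjection_apply_eq_zero_iff, Submodule.orthogonal_orthogonal,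
      Submodule.mem_span_singleton] at hx
    obtain ⟨c, hc⟩ := hx
    exact ⟨c, hc.symm⟩
  have hprPQ : pr (Q - P) = 0 := by
    rw [hpr, Submodule.starProjection_apply_eq_zero_iff, Submodule.orthogonal_orthogonal]
    exact Submodule.mem_span_singleton_self _
  -- Viewed along PQ, the points R k become directions ζ k in a plane. Consecutive ones enclose the
  -- angle 2π/n on alternate sides, so each step is the same rotation.
  set u : ℕ → E3 := fun k => pr (R k - P) with hu
  have hu0 (k : ℕ) : 0 < ‖u k‖ := by
    rw [norm_pos_iff]
    intro h0
    obtain ⟨c, hc⟩ := hker _ h0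
    have hsum : ∑ i, (![1 - c, c, 0, 0] : Fin 4 → ℝ) i = 1 := by simp [Fin.sum_univ_four]
    have h1 := baryBasis_coord_sum (hind k) hsum 2
    rw [hpts] at h1
    simp only [Matrix.cons_val] at h1
    rw [show (1 - c) • P + c • Q + (0 : ℝ) • R k + (0 : ℝ) • R (k + 1) = R k by
      rw [← sub_eq_zero]; rw [← sub_eq_zero] at hc; rw [← neg_eq_zero, ← hc]; module, ← hR2 k] at h1
    have h2 := (baryBasis (hind k)).coord_apply_eq 2
    rw [show baryBasis (hind k) 2 = (s k).1 (T.points ((s k).2 2)) from rfl, h1] at h2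
    exact zero_ne_one h2
  set ζ : ℕ → E3 := fun k => ‖u k‖⁻¹ • u k with hζ
  have hζ1 (k : ℕ) : ‖ζ k‖ = 1 := by
    rw [hζ, norm_smul, norm_inv, norm_norm, inv_mul_cancel₀ (hu0 k).ne']
  have huζ (k : ℕ) : u k = ‖u k‖ • ζ k := by
    rw [hζ, smul_smul, mul_inv_cancel₀ (hu0 k).ne', one_smul]
  set c := Real.cos (2 * Real.pi / n) with hc
  have hc1 : c ^ 2 < 1 := by
    have h1 := sin_two_pi_div_pos hn
    have h2 := Real.sin_sq_add_cos_sq (2 * Real.pi / n)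
    rw [← hc] at h2
    nlinarith
  have hinner (k : ℕ) : ⟪ζ k, ζ (k + 1)⟫ = c := by
    rw [← hang k, dihedralAngle, InnerProductGeometry.cos_angle, hζ, real_inner_smul_left,
      real_inner_smul_right]
    have h1 := (hu0 k).ne'
    have h2 := (hu0 (k + 1)).ne'
    change ‖u k‖⁻¹ * (‖u (k + 1)‖⁻¹ * ⟪u k, u (k + 1)⟫) = ⟪u k, u (k + 1)⟫ / (‖u k‖ * ‖u (k + 1)‖)
    field_simp
  have hrec (k : ℕ) : ζ (k + 2) = (2 * c) • ζ (k + 1) - ζ k := by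
    obtain ⟨w, hw1, hw3, hw⟩ := hR k
    rw [Fin.sum_univ_four] at hw1
    have h1 : u (k + 2) = w 2 • u (k + 1) + w 3 • u k := by
      have h2 : R (k + 2) - P = w 1 • (Q - P) + w 2 • (R (k + 1) - P) + w 3 • (R k - P) := by
        rw [hw, show w 0 = 1 - w 1 - w 2 - w 3 by linarith]
        module
      simp only [hu]
      rw [h2, map_add, map_add, map_smul, map_smul, map_smul, hprPQ, smul_zero, zero_add]
    refine eq_reflection_of_neg (r := ‖u (k + 2)‖⁻¹ * (w 2 * ‖u (k + 1)‖))
      (s := ‖u (k + 2)‖⁻¹ * (w 3 * ‖u k‖)) (hζ1 k) (hζ1 (k + 1)) (hζ1 (k + 2)) (hinner k)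
      (hinner (k + 1)) hc1 ?_ ?_
    · have h3 : ζ (k + 2) = ‖u (k + 2)‖⁻¹ • u (k + 2) := rfl
      rw [h3, h1, huζ (k + 1), huζ k]
      simp only [norm_smul, norm_norm, hζ1, mul_one]
      module
    · exact mul_neg_of_pos_of_neg (inv_pos.2 (hu0 _)) (mul_neg_of_neg_of_pos hw3 (hu0 k))
  have hζn : ζ n = ζ 0 := rotation_sequence_closes hn hrec
  obtain ⟨m, hm⟩ : ∃ m, n = m + 1 := ⟨n - 1, by omega⟩
  -- At this stage R n is only known to lie in the half-plane bounded by the line PQ that contains R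
  -- 0; equality of the points needs the face-to-face property.
  set lam := ‖u n‖ / ‖u 0‖ with hlam
  have hlam0 : 0 < lam := div_pos (hu0 n) (hu0 0)
  have hun : u n = lam • u 0 := by
    calc u n = ‖u n‖ • ζ 0 := by rw [← hζn]; exact huζ n
      _ = ‖u n‖ • ‖u 0‖⁻¹ • u 0 := rfl
      _ = lam • u 0 := by rw [smul_smul, hlam, div_eq_mul_inv]
  obtain ⟨μ, hμ⟩ := hker (R n - P - lam • (R 0 - P)) (by
    rw [map_sub, map_smul]
    exact sub_eq_zero.2 hun)
  have hRn : R n = P + lam • (R 0 - P) + μ • (Q - P) := by rw [← hμ]; abel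
  -- Near the midpoint of PQ the triangles PQ(R 0) and PQ(R n) overlap. The weights w₀ and w₁
  -- describe one common point; ε is small enough to make them nonnegative.
  set ε := 1 / (4 * (1 + lam + |μ|)) with hε
  have hden : 0 < 4 * (1 + lam + |μ|) := by positivity
  have hε0 : 0 < ε := by positivity
  have hεμ : |ε * μ| ≤ 1 / 4 ∧ ε * lam ≤ 1 / 4 ∧ ε ≤ 1 / 4 := by
    have e1 : ε * (4 * (1 + lam + |μ|)) = 1 := by rw [hε]; field_simp
    rw [abs_mul, abs_of_pos hε0]
    have e2 : 0 ≤ ε * |μ| := by positivity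
    have e3 : 0 < ε * lam := by positivity
    refine ⟨?_, ?_, ?_⟩ <;> linarith
  obtain ⟨hε1, hε2, hε3⟩ := hεμ
  have hε1' := abs_le.1 hε1
  set w₀ : Fin 4 → ℝ := ![1 / 2 - ε * lam - ε * μ, 1 / 2 + ε * μ, ε * lam, 0] with hw₀
  set w₁ : Fin 4 → ℝ := ![1 / 2 - ε, 1 / 2, 0, ε] with hw₁
  have hw₀s : ∑ i, w₀ i = 1 := by simp [hw₀, Fin.sum_univ_four]; ring
  have hw₁s : ∑ i, w₁ i = 1 := by simp [hw₁, Fin.sum_univ_four]; ring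
  have hrange (k : ℕ) : Set.range (fun i => (s k).1 (T.points ((s k).2 i))) =
      Set.range fun i => (s k).1 (T.points i) :=
    (s k).2.surjective.range_comp fun i => (s k).1 (T.points i)
  have hx0 : ∑ i, w₀ i • (s 0).1 (T.points ((s 0).2 i)) ∈ (s 0).1 '' T.body := by
    rw [body_eq, ← hrange, mem_convexHull_range_iff]
    refine ⟨w₀, fun i => ?_, hw₀s, rfl⟩
    fin_cases i <;> simp [hw₀] <;> first | positivity | linarith
  have hx1 : ∑ i, w₁ i • (s m).1 (T.points ((s m).2 i)) ∈ (s m).1 '' T.body := by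
    rw [body_eq, ← hrange, mem_convexHull_range_iff]
    refine ⟨w₁, fun i => ?_, hw₁s, rfl⟩
    fin_cases i <;> simp [hw₁] <;> linarith
  have hx01 : ∑ i, w₀ i • (s 0).1 (T.points ((s 0).2 i)) =
      ∑ i, w₁ i • (s m).1 (T.points ((s m).2 i)) := by
    rw [hpts, hpts, ← hm, hRn]
    simp only [hw₀, hw₁, Matrix.cons_val]
    module
  have hx : ∑ i, w₀ i • (s 0).1 (T.points ((s 0).2 i)) ∈
      convexHull ℝ ((s 0).1 '' T.verts ∩ (s m).1 '' T.verts) := by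
    rw [← hG.face_to_face _ (hs 0).1 _ (hs m).1]
    exact ⟨hx0, hx01 ▸ hx1⟩
  -- R 0 has positive weight in the common point, so it is a vertex of the tile m = n − 1. It is
  -- neither P nor Q, and R m = R 0 would give ζ m = ζ n, hence c = 1; only the vertex R n remains.
  have hR0 := mem_of_mem_convexHull (hind 0) hw₀s
    (by rw [hrange, ← image_verts]; exact Set.inter_subset_left) hx (a := 2)
    (by simp only [hw₀, Matrix.cons_val]; positivity)
  have hR0m := hR0.2
  rw [image_verts, ← hrange] at hR0m
  obtain ⟨i, hi⟩ := hR0m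
  simp only [hR2] at hi
  have hinj := (hind 0).injective
  have hP0 : P ≠ R 0 := by
    rw [← hR2 0, ← (hs 0).2.1]
    exact fun h => absurd (hinj (a₁ := 0) (a₂ := 2) h) (by decide)
  have hQ0 : Q ≠ R 0 := by
    rw [← hR2 0, ← (hs 0).2.2]
    exact fun h => absurd (hinj (a₁ := 1) (a₂ := 2) h) (by decide)
  fin_cases i
  · exact absurd ((hs m).2.1.symm.trans hi) hP0
  · exact absurd ((hs m).2.2.symm.trans hi) hQ0
  · have h1 : R m = R 0 := (hR2 m).symm.trans hi
    have h2 := hinner m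
    rw [← hm, hζn, show ζ m = ζ 0 by simp only [hζ, hu, h1], real_inner_self_eq_norm_sq, hζ1] at h2
    rw [← h2] at hc1
    norm_num at hc1
  · rw [hm]
    exact (hR3 m).symm.trans hi

end Tetrahedron

/-! ### The six non-tiles -/

/-- The position of the edge `ij` in the list `12, 13, 14, 23, 24, 34`. -/
def edgeIndex (i j : Fin 4) : Fin 6 :=
  (![![0, 0, 1, 2], ![0, 0, 3, 4], ![1, 3, 0, 5], ![2, 4, 5, 0]] : Fin 4 → Fin 4 → Fin 6) i j

theorem dist_sq_eq_sqEdges (p : Fin 4 → E3) {i j : Fin 4} (hij : i ≠ j) :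
    dist (p i) (p j) ^ 2 = sqEdges p (edgeIndex i j) := by
  fin_cases i <;> fin_cases j <;> first | exact absurd rfl hij | rfl | (rw [dist_comm]; rfl)

theorem dihedralAngle_eq_dihedralAngles (p : Fin 4 → E3) {i j k l : Fin 4} (hij : i ≠ j)
    (hik : i ≠ k) (hil : i ≠ l) (hjk : j ≠ k) (hjl : j ≠ l) (hkl : k ≠ l) :
    dihedralAngle (p i) (p j) (p k) (p l) = dihedralAngles p (edgeIndex i j) := by
  fin_cases i <;> fin_cases j <;> first | exact absurd rfl hij | skip
  all_goals
    fin_cases k <;> first | exact absurd rfl hik | exact absurd rfl hjk | skip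
    all_goals
      fin_cases l <;> first
        | exact absurd rfl hil
        | exact absurd rfl hjl
        | exact absurd rfl hkl
        | rfl
        | (rw [dihedralAngle_swap_right]; rfl)
        | (rw [dihedralAngle_swap_left]; rfl)
        | (rw [dihedralAngle_swap_right, dihedralAngle_swap_left]; rfl)

theorem dihedralAngle_perm (p : Fin 4 → E3) (τ : Equiv.Perm (Fin 4)) :
    dihedralAngle (p (τ 0)) (p (τ 1)) (p (τ 2)) (p (τ 3)) =
      dihedralAngles p (edgeIndex (τ 0) (τ 1)) := by
  apply dihedralAngle_eq_dihedralAngles <;> exact τ.injective.ne (by decide)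

/-- The coefficients of `1` and `√5` in the squared edge lengths. -/
def NonTileName.coeffs : NonTileName → Fin 6 → ℤ × ℤ
  | .A => ![(9, -3), (8, 0), (5, -1), (5, 1), (6, 0), (9, 3)]
  | .B => ![(6, 0), (5, -1), (5, -1), (5, 1), (5, 1), (8, 0)]
  | .C => ![(6, 0), (5, 1), (5, 1), (5, -1), (9, 3), (12, 4)]
  | .D => ![(6, 0), (9, -3), (5, -1), (5, -1), (5, 1), (6, 0)]
  | .E => ![(3, -1), (2, 0), (3, 1), (5, -1), (6, 0), (5, 1)]
  | .F => ![(12, -4), (5, -1), (6, 0), (5, -1), (6, 0), (5, 1)]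

/-- The number `a + b √5`. -/
noncomputable def ofCoeffs (z : ℤ × ℤ) : ℝ := z.1 + z.2 * √5

/-- By irrationality of √5, comparing edge lengths reduces to comparing integers, which makes the
condition on odd edges decidable. -/
theorem ofCoeffs_injective : Function.Injective ofCoeffs := by
  have hirr : Irrational √5 := by
    simpa using Nat.Prime.irrational_sqrt (show Nat.Prime 5 by norm_num)
  rintro ⟨a, b⟩ ⟨c, d⟩ h
  simp only [ofCoeffs] at h
  have hbd : b = d := by
    by_contra hne
    have hne' : ((d - b : ℤ) : ℝ) ≠ 0 := by exact_mod_cast sub_ne_zero.2 (Ne.symm hne)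
    apply hirr
    refine ⟨((a - c : ℤ) : ℚ) / ((d - b : ℤ) : ℚ), ?_⟩
    push_cast at hne' ⊢
    rw [div_eq_iff hne']
    linarith
  subst hbd
  have hac : (a : ℝ) = c := by linarith
  rw [Int.cast_inj.1 hac]

theorem ofCoeffs_add (y z : ℤ × ℤ) : ofCoeffs y + ofCoeffs z = ofCoeffs (y + z) := by
  simp [ofCoeffs]; ring

theorem NonTileName.sqEdges_eq (t : NonTileName) (e : Fin 6) :
    t.sqEdges e = ofCoeffs (t.coeffs e) := by
  cases t <;> fin_cases e <;> simp [NonTileName.sqEdges, NonTileName.coeffs, ofCoeffs] <;> ring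

/-- A length that occurs only at edges with the dihedral angle `2π/n`, where `n` is odd, such that
exactly one of the faces at each of these edges has the other two squared edge lengths of sum `v`.
-/
def HasOddEdge (n : Fin 6 → ℕ) (x : Fin 6 → ℤ × ℤ) (m : ℕ) (ℓ v : ℤ × ℤ) : Prop :=
  (∃ τ : Equiv.Perm (Fin 4), x (edgeIndex (τ 0) (τ 1)) = ℓ) ∧
  ∀ τ : Equiv.Perm (Fin 4), x (edgeIndex (τ 0) (τ 1)) = ℓ → n (edgeIndex (τ 0) (τ 1)) = m ∧
    (x (edgeIndex (τ 0) (τ 3)) + x (edgeIndex (τ 1) (τ 3)) = v ↔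
      ¬ x (edgeIndex (τ 0) (τ 2)) + x (edgeIndex (τ 1) (τ 2)) = v)

instance (n : Fin 6 → ℕ) (x : Fin 6 → ℤ × ℤ) (m : ℕ) (ℓ v : ℤ × ℤ) :
    Decidable (HasOddEdge n x m ℓ v) := by
  unfold HasOddEdge; infer_instance

/-- The chosen length occurs at one edge in A, C, E and at two edges in B, D, F. -/
theorem NonTileName.exists_hasOddEdge (t : NonTileName) :
    ∃ m ℓ v, 3 ≤ m ∧ Odd m ∧ HasOddEdge t.row t.coeffs m ℓ v := by
  cases t
  · exact ⟨3, (9, -3), (13, 1), by decide, by decide, by decide +kernel⟩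
  · exact ⟨5, (5, -1), (11, 1), by decide, by decide, by decide +kernel⟩
  · exact ⟨3, (6, 0), (10, 0), by decide, by decide, by decide +kernel⟩
  · exact ⟨3, (6, 0), (10, 0), by decide, by decide, by decide +kernel⟩
  · exact ⟨5, (5, -1), (11, 1), by decide, by decide, by decide +kernel⟩
  · exact ⟨5, (5, -1), (11, 1), by decide, by decide, by decide +kernel⟩

theorem NonTileName.not_tilesFaceToFace (t : NonTileName) (T : Tetrahedron)
    (h : T.HasAngles t.row) : ¬ T.TilesFaceToFace := by
  obtain ⟨m, ℓ, v, hm, hodd, ⟨τ₀, hτ₀⟩, hodd'⟩ := t.exists_hasOddEdge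
  obtain ⟨σ, k, hk, hσ⟩ := (hasAngles_iff_sqEdges t.realizes t.two_le_row T).1 h
  have hp := affineIndependent_comp_perm T σ
  have hang (e : Fin 6) : dihedralAngles (T.points ∘ σ) e = 2 * Real.pi / t.row e := by
    have h1 := t.realizes.hasCosines.smul hk
    rw [← hσ] at h1
    exact Real.injOn_cos (dihedralAngles_mem_Icc _ e) (two_pi_div_mem_Icc (t.two_le_row e))
      ((hasCosines_sqEdges hp).unique (isEdgeVector_sqEdges hp) h1 e)
  have hdist {i j : Fin 4} (hij : i ≠ j) : dist (T.points (σ i)) (T.points (σ j)) ^ 2 =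
      k * ofCoeffs (t.coeffs (edgeIndex i j)) := by
    rw [← t.sqEdges_eq, ← smul_eq_mul, ← Pi.smul_apply, ← hσ]
    exact dist_sq_eq_sqEdges (T.points ∘ σ) hij
  have hinj {y z : ℤ × ℤ} : k * ofCoeffs y = k * ofCoeffs z ↔ y = z :=
    ⟨fun h => ofCoeffs_injective (mul_left_cancel₀ hk.ne' h), fun h => by rw [h]⟩
  refine T.not_tilesFaceToFace hm hodd (k * ofCoeffs ℓ) (k * ofCoeffs v) ⟨σ * τ₀, ?_⟩ ?_
  · rw [Equiv.Perm.mul_apply, Equiv.Perm.mul_apply, hdist (τ₀.injective.ne (by decide)), hτ₀]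
  · intro ρ hρ
    obtain ⟨τ, rfl⟩ : ∃ τ, ρ = σ * τ := ⟨σ⁻¹ * ρ, by simp⟩
    simp only [Equiv.Perm.mul_apply] at hρ ⊢
    rw [hdist (τ.injective.ne (by decide)), hinj] at hρ
    obtain ⟨h1, h2⟩ := hodd' τ hρ
    constructor
    · rw [← h1, ← hang]
      exact dihedralAngle_perm (T.points ∘ σ) τ
    · rw [hdist (τ.injective.ne (by decide)), hdist (τ.injective.ne (by decide)),
        hdist (τ.injective.ne (by decide)), hdist (τ.injective.ne (by decide)), ← mul_add,
        ← mul_add, ofCoeffs_add, ofCoeffs_add, hinj, hinj]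
      exact h2

/-! ### The exhaustive search -/

/-- The pairs `(n, c)` with `3 ≤ n ≤ 41` and `c` the integer nearest to `10¹² cos (2π/n)`. -/
def cosTable : List (ℕ × ℤ) :=
  [(3, -500000000000), (4, 0), (5, 309016994375), (6, 500000000000), (7, 623489801859),
   (8, 707106781187), (9, 766044443119), (10, 809016994375), (11, 841253532831),
   (12, 866025403784), (13, 885456025653), (14, 900968867902), (15, 913545457643),
   (16, 923879532511), (17, 932472229404), (18, 939692620786), (19, 945817241701),
   (20, 951056516295), (21, 955572805786), (22, 959492973614), (23, 962917287348),
   (24, 965925826289), (25, 968583161129), (26, 970941817426), (27, 973044870580),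
   (28, 974927912182), (29, 976620555710), (30, 978147600734), (31, 979529941252),
   (32, 980785280403), (33, 981928697263), (34, 982973099684), (35, 983929588599),
   (36, 984807753012), (37, 985615910348), (38, 986361303403), (39, 987050262638),
   (40, 987688340595), (41, 988280423780)]

/-- The angles `2π/a`, `2π/b`, `2π/c` have sum greater than `π`. -/
def angleSumOK (a b c : ℕ) : Bool := Nat.blt (a * b * c) (2 * (a * b + b * c + c * a))

/-- `2π/b + 2π/c < 2π/a + π`. -/
def angleTriOK (a b c : ℕ) : Bool := Nat.blt (2 * (a * c + a * b)) (2 * (b * c) + a * b * c)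

/-- The angles `2π/a`, `2π/b`, `2π/c` are the angles of a spherical triangle. -/
def vertexOK (a b c : ℕ) : Bool :=
  angleSumOK a b c && angleTriOK a b c && angleTriOK b c a && angleTriOK c a b

/-- `2π/a + 2π/b < π`. -/
def acutePair (a b : ℕ) : Bool := Nat.blt (2 * (a + b)) (a * b)

/-- The possible entries at the two other edges at an end of an edge whose number a is minimal. -/
def candidatePairs (a : ℕ) : List ((ℕ × ℤ) × (ℕ × ℤ)) :=
  cosTable.flatMap fun p => (cosTable.filter fun q =>
    Nat.ble a p.1 && Nat.ble a q.1 && vertexOK a p.1 q.1).map fun q => (p, q)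

/-- `10³⁶` times the vertex minor. -/
def minorApprox (x b c : ℤ) : ℤ :=
  10 ^ 36 - 10 ^ 12 * (b * b + c * c + x * x) - 2 * (b * c * x)

/-- 10³⁶ times the cofactor of the face-normal Gram matrix at the edge with cosine z, where x
belongs to the opposite edge. -/
def cofactorApprox (x z b c d e : ℤ) : ℤ :=
  z * (10 ^ 24 - x * x) + 10 ^ 12 * (b * d + c * e) + x * (b * e + c * d)

/-- Twenty lists for eleven shapes, since several labellings of one shape can satisfy the
normalization of the search. -/
def solutions : List (List ℕ) :=
  [[3, 4, 5, 10, 6, 6], [3, 5, 5, 10, 10, 4], [3, 5, 10, 10, 6, 4], [3, 6, 6, 8, 8, 4],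
   [3, 6, 10, 10, 10, 3], [4, 4, 4, 5, 6, 10], [4, 4, 4, 5, 10, 6], [4, 4, 4, 6, 5, 10],
   [4, 4, 4, 6, 6, 8], [4, 4, 4, 6, 8, 6], [4, 4, 4, 6, 10, 5], [4, 4, 4, 8, 6, 6],
   [4, 4, 4, 10, 5, 6], [4, 4, 4, 10, 6, 5], [4, 4, 8, 8, 4, 6], [4, 4, 8, 8, 6, 4],
   [4, 5, 6, 5, 6, 5], [4, 5, 6, 10, 5, 4], [4, 5, 10, 6, 5, 4], [4, 6, 6, 6, 6, 4]]

/-- For a tetrahedron both cofactors are positive and the square of the first equals the product of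
two minors. The tolerances, 10⁻⁹ at scale 10³⁶ and 10⁻⁷ at scale 10⁷², exceed the errors caused by
the rounded cosines. -/
def excluded (x z b c d e : ℤ) : Bool :=
  decide (cofactorApprox x z b c d e < -10 ^ 27) ||
  decide (cofactorApprox z x b d c e < -10 ^ 27) ||
  decide (10 ^ 65 < |cofactorApprox x z b c d e ^ 2 - minorApprox x b c * minorApprox x d e|)

def checkAt (a b c d e f : ℕ × ℤ) : Bool :=
  !(vertexOK b.1 d.1 f.1 && vertexOK c.1 e.1 f.1 && Nat.ble a.1 f.1 &&
      (acutePair a.1 c.1 || acutePair d.1 f.1) && (acutePair a.1 b.1 || acutePair e.1 f.1) &&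
      (acutePair a.1 e.1 || acutePair b.1 f.1) && (acutePair a.1 d.1 || acutePair c.1 f.1)) ||
    excluded a.2 f.2 b.2 c.2 d.2 e.2 || solutions.contains [a.1, b.1, c.1, d.1, e.1, f.1]

/-- Tests that do not involve the last edge come first to cut the search. The angle sums at its two
ends decrease as its number grows, so `takeWhile` loses no admissible value. -/
def checkPair (a : ℕ × ℤ) (bc de : (ℕ × ℤ) × (ℕ × ℤ)) : Bool :=
  !(Nat.ble bc.1.1 de.1.1 && Nat.ble bc.1.1 de.2.1 &&
      (acutePair bc.1.1 bc.2.1 || acutePair de.1.1 de.2.1) &&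
      (acutePair bc.1.1 de.1.1 || acutePair bc.2.1 de.2.1)) ||
    (cosTable.takeWhile fun f =>
      angleSumOK bc.1.1 de.1.1 f.1 && angleSumOK bc.2.1 de.2.1 f.1).all fun f =>
        checkAt a bc.1 bc.2 de.1 de.2 f

def checkEdge (a : ℕ × ℤ) : Bool :=
  (candidatePairs a.1).all fun bc => !(Nat.ble bc.1.1 bc.2.1) ||
    (candidatePairs a.1).all fun de => checkPair a bc de


/-- By `min_le_five` the smallest of the six numbers is 3, 4 or 5. -/
theorem checkEdge_of_mem : ∀ a ∈ [(3, -500000000000), (4, 0), (5, 309016994375)],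
    checkEdge a = true := by
  decide +kernel

theorem cosTable_pairwise : cosTable.Pairwise fun p q => p.1 < q.1 := by decide +kernel

/-! ### Certified cosine values -/

/-- The Taylor polynomial of degree 14 of the cosine. -/
noncomputable def cosPoly (x : ℝ) : ℝ :=
  1 - x ^ 2 / 2 + x ^ 4 / 24 - x ^ 6 / 720 + x ^ 8 / 40320 - x ^ 10 / 3628800 + x ^ 12 / 479001600 -
    x ^ 14 / 87178291200

/-- The polynomial is the real part of the first 16 terms of the exponential series at ix; the
remainder is at most 17 / (16 · 16!). -/
theorem abs_cos_sub_cosPoly_le {x : ℝ} (hx : |x| ≤ 1) :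
    |Real.cos x - cosPoly x| ≤ 1 / 10 ^ 12 := by
  have hn : ‖(x : ℂ) * Complex.I‖ ≤ 1 := by simpa using hx
  have h := Complex.exp_bound hn (n := 16) (by norm_num)
  have hre : (Complex.exp (x * Complex.I) -
      ∑ m ∈ Finset.range 16, ((x : ℂ) * Complex.I) ^ m / (m.factorial : ℂ)).re =
      Real.cos x - cosPoly x := by
    rw [Complex.sub_re, Complex.exp_ofReal_mul_I_re]
    congr 1
    have h2 : Complex.I ^ 2 = -1 := Complex.I_sq
    have h3 : Complex.I ^ 3 = -Complex.I := Complex.I_pow_three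
    have key : ∑ m ∈ Finset.range 16, ((x : ℂ) * Complex.I) ^ m / (m.factorial : ℂ) =
        (cosPoly x : ℝ) + (x - x ^ 3 / 6 + x ^ 5 / 120 - x ^ 7 / 5040 + x ^ 9 / 362880 -
          x ^ 11 / 39916800 + x ^ 13 / 6227020800 - x ^ 15 / 1307674368000 : ℝ) * Complex.I := by
      simp only [Finset.sum_range_succ, Finset.sum_range_zero, Nat.factorial, cosPoly, mul_pow]
      push_cast
      simp only [pow_zero, pow_one, h2, h3]
      ring
    rw [key]
    simp [-Complex.ofReal_sub, -Complex.ofReal_add, Complex.ofReal_re]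
  have h1 := (Complex.abs_re_le_norm _).trans h
  rw [hre] at h1
  refine h1.trans ?_
  have hp : ‖(x : ℂ) * Complex.I‖ ^ 16 ≤ 1 := pow_le_one₀ (norm_nonneg _) hn
  refine (mul_le_mul_of_nonneg_right hp (by positivity)).trans ?_
  norm_num [Nat.factorial]

/-- From n = 7 on, the angle lies in the range |x| ≤ 1 of the Taylor bound. In units of 10⁻¹², 5 are
allowed for rounding, 1 for the Taylor remainder and 1 for the decimal value of π. -/
theorem abs_cos_two_pi_div_sub_le {n : ℕ} (hn : 7 ≤ n) {z : ℤ}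
    (h : |10 ^ 12 * cosPoly (2 * (314159265358979323846 / 10 ^ 20) / n) - z| ≤ 5) :
    |10 ^ 12 * Real.cos (2 * Real.pi / n) - z| ≤ 10 := by
  have hn' : (7 : ℝ) ≤ n := by exact_mod_cast hn
  set y : ℝ := 2 * (314159265358979323846 / 10 ^ 20) / n with hy
  have hpi1 := Real.pi_gt_d20
  have hpi2 := Real.pi_lt_d20
  have hy1 : |y| ≤ 1 := by
    rw [abs_of_nonneg (by positivity), hy, div_le_one (by linarith)]
    refine le_trans ?_ hn'
    norm_num
  have h1 := abs_cos_sub_cosPoly_le hy1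
  have h2 : |2 * Real.pi / n - y| ≤ 1 / 10 ^ 12 := by
    rw [hy, ← sub_div, abs_div, abs_of_nonneg (show (0 : ℝ) ≤ n by linarith),
      div_le_iff₀ (by linarith)]
    refine (?_ : _ ≤ (1 / 10 ^ 12 * 7 : ℝ)).trans (by gcongr)
    rw [abs_le]
    constructor <;> norm_num at hpi1 hpi2 ⊢ <;> linarith
  have h3 : |Real.cos (2 * Real.pi / n) - Real.cos y| ≤ |2 * Real.pi / n - y| :=
    Real.abs_cos_sub_cos_le _ _
  have h4 := h3.trans h2
  clear h2 h3
  rw [abs_le] at *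
  constructor <;> linarith

theorem abs_cos_sub_cosTable_le {p : ℕ × ℤ} (hp : p ∈ cosTable) :
    |10 ^ 12 * Real.cos (2 * Real.pi / p.1) - p.2| ≤ 10 := by
  simp only [cosTable, List.mem_cons, List.not_mem_nil, or_false] at hp
  rcases hp with rfl | rfl | rfl | rfl | hp
  · norm_num [cos_two_pi_div_three]
  · norm_num [cos_two_pi_div_four]
  · have h1 : (2236067977490 : ℝ) / 10 ^ 12 < √5 := Real.lt_sqrt_of_sq_lt (by norm_num)
    have h2 : √5 < (2236067977510 : ℝ) / 10 ^ 12 := (Real.sqrt_lt' (by norm_num)).2 (by norm_num)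
    rw [Nat.cast_ofNat, cos_two_pi_div_five, abs_le]
    constructor <;> norm_num at h1 h2 ⊢ <;> linarith
  · norm_num [cos_two_pi_div_six]
  · casesm* _ ∨ _ <;> subst p <;> refine abs_cos_two_pi_div_sub_le (by norm_num) ?_ <;>
      norm_num [cosPoly, abs_le]

/-! ### Inequalities between the angles and the bound 41 -/

theorem cos_add_cos_pos_iff {x y : ℝ} (hx : x ∈ Set.Icc 0 Real.pi) (hy : y ∈ Set.Icc 0 Real.pi) :
    0 < Real.cos x + Real.cos y ↔ x + y < Real.pi := by
  have hy' : Real.pi - y ∈ Set.Icc 0 Real.pi := ⟨by linarith [hy.2], by linarith [hy.1]⟩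
  rw [← lt_sub_iff_add_lt, ← Real.strictAntiOn_cos.lt_iff_gt hy' hx, Real.cos_pi_sub,
    neg_lt_iff_pos_add]

/-- The vertex inequalities say that the dihedral angles at a vertex are the angles of a spherical
triangle. -/
theorem spherical_triangle {x y z : ℝ} (hx : x ∈ Set.Ioo 0 Real.pi) (hy : y ∈ Set.Ioo 0 Real.pi)
    (hz : z ∈ Set.Ioo 0 Real.pi)
    (h : 0 < 1 - Real.cos x ^ 2 - Real.cos y ^ 2 - Real.cos z ^ 2 -
      2 * Real.cos x * Real.cos y * Real.cos z) :
    Real.pi < x + y + z ∧ |x - y| + z < Real.pi := by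
  have hxy : 0 < Real.sin x * Real.sin y :=
    mul_pos (Real.sin_pos_of_mem_Ioo hx) (Real.sin_pos_of_mem_Ioo hy)
  -- The minor is minus this product, and cos (x + y) < cos (x − y) decides which factor is
  -- negative.
  have hprod : (Real.cos (x + y) + Real.cos z) * (Real.cos (x - y) + Real.cos z) < 0 := by
    rw [Real.cos_add, Real.cos_sub]
    nlinarith [Real.sin_sq_add_cos_sq x, Real.sin_sq_add_cos_sq y,
      mul_pow (Real.sin x) (Real.sin y) 2,
      show Real.sin x ^ 2 = 1 - Real.cos x ^ 2 by linarith [Real.sin_sq_add_cos_sq x],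
      show (Real.sin x * Real.sin y) ^ 2 = (1 - Real.cos x ^ 2) * (1 - Real.cos y ^ 2) by
        rw [mul_pow, Real.sin_sq, Real.sin_sq]]
  have hlt : Real.cos (x + y) < Real.cos (x - y) := by
    rw [Real.cos_add, Real.cos_sub]; linarith
  obtain ⟨h1, h2⟩ | ⟨h1, h2⟩ := mul_neg_iff.1 hprod
  · linarith
  constructor
  · by_contra! hle
    have hmem : x + y ∈ Set.Icc 0 Real.pi := ⟨by linarith [hx.1, hy.1], by linarith [hz.1]⟩
    have hz' : z ∈ Set.Icc 0 Real.pi := ⟨hz.1.le, hz.2.le⟩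
    have := Real.strictAntiOn_cos.antitoneOn hmem
      (show Real.pi - z ∈ Set.Icc 0 Real.pi from ⟨by linarith [hz.2], by linarith [hz.1]⟩)
      (by linarith)
    rw [Real.cos_pi_sub] at this
    linarith
  · rw [← cos_add_cos_pos_iff ⟨abs_nonneg _, ?_⟩ ⟨hz.1.le, hz.2.le⟩, Real.cos_abs]
    · exact h2
    · rw [abs_le]; constructor <;> linarith [hx.1, hx.2, hy.1, hy.2]

theorem two_pi_div_mem_Ioo {n : ℕ} (hn : 3 ≤ n) : 2 * Real.pi / n ∈ Set.Ioo 0 Real.pi := by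
  have hn' : (3 : ℝ) ≤ n := by exact_mod_cast hn
  have := Real.pi_pos
  refine ⟨by positivity, ?_⟩
  rw [div_lt_iff₀ (by linarith)]
  nlinarith

/-- Multiplying the inequalities of the spherical triangle by abc/π turns them into inequalities
between natural numbers. -/
theorem vertexOK_of_minor_pos {a b c : ℕ} (ha : 3 ≤ a) (hb : 3 ≤ b) (hc : 3 ≤ c)
    (h : 0 < 1 - Real.cos (2 * Real.pi / a) ^ 2 - Real.cos (2 * Real.pi / b) ^ 2 -
      Real.cos (2 * Real.pi / c) ^ 2 -
      2 * Real.cos (2 * Real.pi / a) * Real.cos (2 * Real.pi / b) * Real.cos (2 * Real.pi / c)) :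
    vertexOK a b c = true := by
  have ma := two_pi_div_mem_Ioo ha
  have mb := two_pi_div_mem_Ioo hb
  have mc := two_pi_div_mem_Ioo hc
  obtain ⟨h1, h2⟩ := spherical_triangle ma mb mc h
  obtain ⟨-, h3⟩ := spherical_triangle ma mc mb (by linarith)
  have e1 := (abs_lt.1 (lt_sub_iff_add_lt.2 h2)).1
  have e2 := (abs_lt.1 (lt_sub_iff_add_lt.2 h2)).2
  have e3 := (abs_lt.1 (lt_sub_iff_add_lt.2 h3)).2
  have hpi := Real.pi_pos
  have ha' : (0 : ℝ) < a := by exact_mod_cast (show 0 < a by omega)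
  have hb' : (0 : ℝ) < b := by exact_mod_cast (show 0 < b by omega)
  have hc' : (0 : ℝ) < c := by exact_mod_cast (show 0 < c by omega)
  have key {u v : ℝ} (huv : u * (a * b * c / Real.pi) < v * (a * b * c / Real.pi)) {m n : ℕ}
      (hm : (m : ℝ) = u * (a * b * c / Real.pi)) (hn : (n : ℝ) = v * (a * b * c / Real.pi)) :
      m < n := by
    rw [← hm, ← hn] at huv; exact_mod_cast huv
  have hs : 0 < a * b * c / Real.pi := by positivity
  simp only [vertexOK, angleSumOK, angleTriOK, Bool.and_eq_true, Nat.blt_eq]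
  refine ⟨⟨⟨key (mul_lt_mul_of_pos_right h1 hs) ?_ ?_, key (mul_lt_mul_of_pos_right
    (show 2 * Real.pi / b + 2 * Real.pi / c < 2 * Real.pi / a + Real.pi by linarith) hs) ?_ ?_⟩,
    key (mul_lt_mul_of_pos_right
    (show 2 * Real.pi / c + 2 * Real.pi / a < 2 * Real.pi / b + Real.pi by linarith) hs) ?_ ?_⟩,
    key (mul_lt_mul_of_pos_right
    (show 2 * Real.pi / a + 2 * Real.pi / b < 2 * Real.pi / c + Real.pi by linarith) hs) ?_ ?_⟩
  all_goals push_cast; field_simp <;> ring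

theorem acutePair_of_cos_add_cos_pos {a b : ℕ} (ha : 3 ≤ a) (hb : 3 ≤ b)
    (h : 0 < Real.cos (2 * Real.pi / a) + Real.cos (2 * Real.pi / b)) : acutePair a b = true := by
  rw [cos_add_cos_pos_iff (Set.Ioo_subset_Icc_self (two_pi_div_mem_Ioo ha))
    (Set.Ioo_subset_Icc_self (two_pi_div_mem_Ioo hb))] at h
  have hpi := Real.pi_pos
  have ha' : (0 : ℝ) < a := by exact_mod_cast (show 0 < a by omega)
  have hb' : (0 : ℝ) < b := by exact_mod_cast (show 0 < b by omega)
  simp only [acutePair, Nat.blt_eq]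
  rw [div_add_div _ _ ha'.ne' hb'.ne', div_lt_iff₀ (by positivity)] at h
  have h2 : (2 * (a + b) : ℝ) < a * b := by
    refine lt_of_mul_lt_mul_left ?_ hpi.le
    linarith
  exact_mod_cast h2

/-- The hypotheses say 2/a > 1 − 2/b − 2/c > 0. The smallest positive value of the middle term is
1/21, attained for {b, c} = {3, 7}, hence a < 42. -/
theorem le_of_angleSumOK {a b c : ℕ} (hb : 3 ≤ b) (hc : 3 ≤ c) (h : angleSumOK a b c = true)
    (hbc : acutePair b c = true) : a ≤ 41 := by
  simp only [angleSumOK, acutePair, Nat.blt_eq] at h hbc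
  by_contra! ha
  obtain ⟨k, hk⟩ := Nat.exists_eq_add_of_lt hbc
  have h1 : a * (k + 1) < 2 * (b * c) := by nlinarith
  have h2 : 42 * (k + 1) < 2 * (b * c) := lt_of_le_of_lt (Nat.mul_le_mul_right _ ha) h1
  have h3 : 10 * (b * c) < 21 * (b + c) := by omega
  have hb7 : b < 7 := by
    by_contra! hb7
    nlinarith
  interval_cases b <;> omega

/-- Three angles of at most 2π/6 have sum at most π. -/
theorem min_le_five {a b c : ℕ} (hb : a ≤ b) (hc : a ≤ c)
    (h : angleSumOK a b c = true) : a ≤ 5 := by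
  simp only [angleSumOK, Nat.blt_eq] at h
  by_contra! h6
  have h1 : 6 * (b * c) ≤ a * b * c := by rw [mul_assoc]; exact Nat.mul_le_mul_right _ h6
  have h2 : a * b ≤ c * b := Nat.mul_le_mul_right _ hc
  have h3 : c * a ≤ c * b := Nat.mul_le_mul_left _ hb
  nlinarith

theorem angleSumOK_of_lt {a b f f' : ℕ} (ha : 0 < a) (hb : 0 < b) (hf : f < f')
    (h : angleSumOK a b f' = true) : angleSumOK a b f = true := by
  simp only [angleSumOK, Nat.blt_eq] at h ⊢
  have hab : 0 < a * b := Nat.mul_pos ha hb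
  rcases le_total (a * b) (2 * a + 2 * b) with h1 | h1
  · nlinarith [Nat.mul_le_mul_right f h1]
  · zify at *
    nlinarith [mul_nonneg (sub_nonneg.2 hf.le) (sub_nonneg.2 h1)]

theorem List.mem_takeWhile_of_pairwise {α : Type*} {r : α → α → Prop} {q : α → Bool} :
    ∀ {l : List α}, l.Pairwise r → (∀ a b, a ∈ l → r a b → q b = true → q a = true) →
      ∀ {x : α}, x ∈ l → q x = true → x ∈ l.takeWhile q
  | [], _, _, _, hx, _ => absurd hx List.not_mem_nil
  | a :: l, hl, hq, x, hx, hqx => by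
    rw [List.pairwise_cons] at hl
    rcases List.mem_cons.1 hx with rfl | hx'
    · simp [hqx]
    · have ha : q a = true := hq a x List.mem_cons_self (hl.1 x hx') hqx
      rw [List.takeWhile_cons_of_pos ha]
      exact List.mem_cons_of_mem _ (List.mem_takeWhile_of_pairwise hl.2
        (fun a b ha => hq a b (List.mem_cons_of_mem _ ha)) hx' hqx)

theorem mem_candidatePairs {a : ℕ} {p q : ℕ × ℤ} (hp : p ∈ cosTable) (hq : q ∈ cosTable)
    (hap : a ≤ p.1) (haq : a ≤ q.1) (h : vertexOK a p.1 q.1 = true) :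
    (p, q) ∈ candidatePairs a := by
  simp only [candidatePairs, List.mem_flatMap, List.mem_map, List.mem_filter]
  exact ⟨p, hp, q, ⟨hq, by simp [hap, haq, h]⟩, rfl⟩

theorem exists_mem_cosTable {n : ℕ} (h3 : 3 ≤ n) (h41 : n ≤ 41) : ∃ p ∈ cosTable, p.1 = n := by
  interval_cases n <;> decide

theorem mem_of_mem_cosTable_of_le : ∀ p ∈ cosTable, p.1 ≤ 5 →
    p ∈ [(3, -500000000000), (4, 0), ((5, 309016994375) : ℕ × ℤ)] := by
  decide

theorem three_le_of_mem_cosTable : ∀ p ∈ cosTable, 3 ≤ p.1 := by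
  decide

theorem abs_le_of_mem_cosTable : ∀ p ∈ cosTable, |p.2| ≤ 10 ^ 12 := by
  decide

/-- The exhaustive search, for a labelling of the vertices in which the first edge carries the
smallest number and the second one the smallest number among its neighbours. -/
theorem mem_solutions {P : Fin 6 → ℕ × ℤ} (hP : ∀ e, P e ∈ cosTable)
    (h0 : ∀ e, (P 0).1 ≤ (P e).1) (h12 : (P 1).1 ≤ (P 2).1) (h13 : (P 1).1 ≤ (P 3).1)
    (h14 : (P 1).1 ≤ (P 4).1)
    (v₁ : vertexOK (P 0).1 (P 1).1 (P 2).1 = true) (v₂ : vertexOK (P 0).1 (P 3).1 (P 4).1 = true)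
    (v₃ : vertexOK (P 1).1 (P 3).1 (P 5).1 = true) (v₄ : vertexOK (P 2).1 (P 4).1 (P 5).1 = true)
    (a₀ : acutePair (P 1).1 (P 2).1 = true ∨ acutePair (P 3).1 (P 4).1 = true)
    (a₁ : acutePair (P 0).1 (P 2).1 = true ∨ acutePair (P 3).1 (P 5).1 = true)
    (a₂ : acutePair (P 0).1 (P 1).1 = true ∨ acutePair (P 4).1 (P 5).1 = true)
    (a₃ : acutePair (P 0).1 (P 4).1 = true ∨ acutePair (P 1).1 (P 5).1 = true)
    (a₄ : acutePair (P 0).1 (P 3).1 = true ∨ acutePair (P 2).1 (P 5).1 = true)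
    (a₅ : acutePair (P 1).1 (P 3).1 = true ∨ acutePair (P 2).1 (P 4).1 = true)
    (hex : excluded (P 0).2 (P 5).2 (P 1).2 (P 2).2 (P 3).2 (P 4).2 = false) :
    [(P 0).1, (P 1).1, (P 2).1, (P 3).1, (P 4).1, (P 5).1] ∈ solutions := by
  have s₁ : angleSumOK (P 0).1 (P 1).1 (P 2).1 = true := by
    simp only [vertexOK, Bool.and_eq_true] at v₁; exact v₁.1.1.1
  have s₃ : angleSumOK (P 1).1 (P 3).1 (P 5).1 = true := by
    simp only [vertexOK, Bool.and_eq_true] at v₃; exact v₃.1.1.1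
  have s₄ : angleSumOK (P 2).1 (P 4).1 (P 5).1 = true := by
    simp only [vertexOK, Bool.and_eq_true] at v₄; exact v₄.1.1.1
  have hpos (e : Fin 6) : 0 < (P e).1 := by have := three_le_of_mem_cosTable _ (hP e); omega
  have h5 : (P 0).1 ≤ 5 := min_le_five (h0 1) (h0 2) s₁
  have hc := checkEdge_of_mem _ (mem_of_mem_cosTable_of_le _ (hP 0) h5)
  rw [checkEdge, List.all_eq_true] at hc
  have hc := hc _ (mem_candidatePairs (hP 1) (hP 2) (h0 1) (h0 2) v₁)
  simp only [Nat.ble_eq_true_of_le h12, Bool.not_true, Bool.false_or, List.all_eq_true] at hc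
  have hc := hc _ (mem_candidatePairs (hP 3) (hP 4) (h0 3) (h0 4) v₂)
  simp only [checkPair, Nat.ble_eq_true_of_le h13, Nat.ble_eq_true_of_le h14,
    Bool.or_eq_true_iff.2 a₀,
    Bool.or_eq_true_iff.2 a₅, Bool.and_self, Bool.not_true, Bool.false_or, List.all_eq_true] at hc
  have hc := hc (P 5) (List.mem_takeWhile_of_pairwise cosTable_pairwise (fun f f' _ hf h => by
    rw [Bool.and_eq_true] at h ⊢
    exact ⟨angleSumOK_of_lt (hpos 1) (hpos 3) hf h.1, angleSumOK_of_lt (hpos 2) (hpos 4) hf h.2⟩)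
    (hP 5) (by rw [s₃, s₄]; rfl))
  simpa only [checkAt, v₃, v₄, Nat.ble_eq_true_of_le (h0 5), Bool.or_eq_true_iff.2 a₁,
    Bool.or_eq_true_iff.2 a₂, Bool.or_eq_true_iff.2 a₃, Bool.or_eq_true_iff.2 a₄, hex,
    Bool.and_self, Bool.not_true, Bool.false_or, List.contains_iff_mem] using hc

/-! ### Error bounds and the adjugate of the Gram matrix -/

/-- The determinant of the Gram matrix of the normals of the faces at a vertex. -/
def vertexMinor (x b c : ℝ) : ℝ := 1 - x ^ 2 - b ^ 2 - c ^ 2 - 2 * x * b * c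

/-- A cofactor of the Gram matrix of the face normals. -/
def edgeCofactor (x z b c d e : ℝ) : ℝ := z * (1 - x ^ 2) + (b * d + c * e) + x * (b * e + c * d)

theorem cast_minorApprox (x b c : ℤ) : (minorApprox x b c : ℝ) =
    10 ^ 36 * vertexMinor (x / 10 ^ 12) (b / 10 ^ 12) (c / 10 ^ 12) := by
  simp only [minorApprox, vertexMinor]; push_cast; ring

theorem cast_cofactorApprox (x z b c d e : ℤ) : (cofactorApprox x z b c d e : ℝ) =
    10 ^ 36 * edgeCofactor (x / 10 ^ 12) (z / 10 ^ 12) (b / 10 ^ 12) (c / 10 ^ 12) (d / 10 ^ 12)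
      (e / 10 ^ 12) := by
  simp only [cofactorApprox, edgeCofactor]; push_cast; ring

/-- The numbers `x` and `y` in `[-1, 1]` are at distance at most `ε`. -/
def NearBy (ε x y : ℝ) : Prop := |x - y| ≤ ε ∧ |x| ≤ 1 ∧ |y| ≤ 1

theorem NearBy.mul {ε δ x y z w : ℝ} (h : NearBy ε x y) (h' : NearBy δ z w) :
    NearBy (ε + δ) (x * z) (y * w) := by
  refine ⟨?_, ?_, ?_⟩
  · rw [show x * z - y * w = (x - y) * z + y * (z - w) by ring]
    refine (abs_add_le _ _).trans (add_le_add ?_ ?_)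
    · rw [abs_mul]
      exact (mul_le_of_le_one_right (abs_nonneg _) h'.2.1).trans h.1
    · rw [abs_mul]
      exact (mul_le_of_le_one_left (abs_nonneg _) h.2.2).trans h'.1
  · rw [abs_mul]; exact mul_le_one₀ h.2.1 (abs_nonneg _) h'.2.1
  · rw [abs_mul]; exact mul_le_one₀ h.2.2 (abs_nonneg _) h'.2.2

/-- Each of the three squares contributes 2ε and the doubled triple product 6ε. -/
theorem abs_vertexMinor_sub_le {ε x b c x' b' c' : ℝ} (hx : NearBy ε x x') (hb : NearBy ε b b')
    (hc : NearBy ε c c') : |vertexMinor x b c - vertexMinor x' b' c'| ≤ 12 * ε ∧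
      |vertexMinor x b c| ≤ 6 ∧ |vertexMinor x' b' c'| ≤ 6 := by
  have h1 := hx.mul hx
  have h2 := hb.mul hb
  have h3 := hc.mul hc
  have h4 := (hx.mul hb).mul hc
  simp only [NearBy, abs_le, vertexMinor, pow_two] at *
  refine ⟨⟨?_, ?_⟩, ⟨?_, ?_⟩, ?_, ?_⟩ <;> linarith

theorem abs_edgeCofactor_sub_le {ε x z b c d e x' z' b' c' d' e' : ℝ} (hx : NearBy ε x x')
    (hz : NearBy ε z z') (hb : NearBy ε b b') (hc : NearBy ε c c') (hd : NearBy ε d d')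
    (he : NearBy ε e e') :
    |edgeCofactor x z b c d e - edgeCofactor x' z' b' c' d' e'| ≤ 14 * ε ∧
      |edgeCofactor x z b c d e| ≤ 6 ∧ |edgeCofactor x' z' b' c' d' e'| ≤ 6 := by
  have h1 := hz.mul (hx.mul hx)
  have h2 := hb.mul hd
  have h3 := hc.mul he
  have h4 := hx.mul (hb.mul he)
  have h5 := hx.mul (hc.mul hd)
  simp only [NearBy, abs_le, edgeCofactor, pow_two, mul_add, mul_sub, mul_one] at *
  refine ⟨⟨?_, ?_⟩, ⟨?_, ?_⟩, ?_, ?_⟩ <;> linarith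

theorem nearBy_cosTable {p : ℕ × ℤ} (hp : p ∈ cosTable) :
    NearBy (1 / 10 ^ 11) (Real.cos (2 * Real.pi / p.1)) (p.2 / 10 ^ 12) := by
  refine ⟨?_, Real.abs_cos_le_one _, ?_⟩
  · have h := abs_cos_sub_cosTable_le hp
    rw [abs_le] at h ⊢
    constructor <;> linarith
  · rw [abs_div, div_le_one (by positivity), abs_of_nonneg (show (0 : ℝ) ≤ 10 ^ 12 by positivity)]
    exact_mod_cast abs_le_of_mem_cosTable p hp

/-- With ε = 10⁻¹¹ the cofactors are off by at most 14ε and the difference of the square and the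
product by at most (72 + 72 + 168)ε, well inside the tolerances. -/
theorem excluded_eq_false {P : Fin 6 → ℕ × ℤ} (hP : ∀ e, P e ∈ cosTable) {c : Fin 6 → ℝ}
    (hc : ∀ e, c e = Real.cos (2 * Real.pi / (P e).1))
    (h₁ : 0 < edgeCofactor (c 0) (c 5) (c 1) (c 2) (c 3) (c 4))
    (h₂ : 0 < edgeCofactor (c 5) (c 0) (c 1) (c 3) (c 2) (c 4))
    (h₃ : edgeCofactor (c 0) (c 5) (c 1) (c 2) (c 3) (c 4) ^ 2 =
      vertexMinor (c 0) (c 1) (c 2) * vertexMinor (c 0) (c 3) (c 4)) :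
    excluded (P 0).2 (P 5).2 (P 1).2 (P 2).2 (P 3).2 (P 4).2 = false := by
  have hn (e : Fin 6) : NearBy (1 / 10 ^ 11) (c e) ((P e).2 / 10 ^ 12) := by
    rw [hc]; exact nearBy_cosTable (hP e)
  obtain ⟨f₁, f₂, f₃⟩ := abs_edgeCofactor_sub_le (hn 0) (hn 5) (hn 1) (hn 2) (hn 3) (hn 4)
  obtain ⟨g₁, -, -⟩ := abs_edgeCofactor_sub_le (hn 5) (hn 0) (hn 1) (hn 3) (hn 2) (hn 4)
  obtain ⟨d₁, d₂, d₃⟩ := abs_vertexMinor_sub_le (hn 0) (hn 1) (hn 2)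
  obtain ⟨d₁', d₂', d₃'⟩ := abs_vertexMinor_sub_le (hn 0) (hn 3) (hn 4)
  have k₁ := cast_cofactorApprox (P 0).2 (P 5).2 (P 1).2 (P 2).2 (P 3).2 (P 4).2
  have k₂ := cast_cofactorApprox (P 5).2 (P 0).2 (P 1).2 (P 3).2 (P 2).2 (P 4).2
  have k₃ := cast_minorApprox (P 0).2 (P 1).2 (P 2).2
  have k₄ := cast_minorApprox (P 0).2 (P 3).2 (P 4).2
  generalize edgeCofactor (c 0) (c 5) (c 1) (c 2) (c 3) (c 4) = F at *
  generalize edgeCofactor (c 5) (c 0) (c 1) (c 3) (c 2) (c 4) = G at *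
  generalize vertexMinor (c 0) (c 1) (c 2) = D at *
  generalize vertexMinor (c 0) (c 3) (c 4) = D' at *
  generalize edgeCofactor _ _ _ _ _ _ = F₁ at *
  generalize edgeCofactor _ _ _ _ _ _ = G₁ at *
  generalize vertexMinor _ _ _ = D₁ at *
  generalize vertexMinor _ _ _ = D₁' at *
  simp only [excluded, Bool.or_eq_false_iff, decide_eq_false_iff_not, not_lt]
  rw [abs_le] at g₁
  refine ⟨⟨?_, ?_⟩, ?_⟩
  · rw [abs_le] at f₁
    rw [← Int.cast_le (R := ℝ), k₁]
    push_cast; linarith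
  · rw [← Int.cast_le (R := ℝ), k₂]
    push_cast; linarith
  · rw [← Int.cast_le (R := ℝ)]
    push_cast
    rw [k₁, k₃, k₄, show (10 ^ 36 * F₁) ^ 2 - 10 ^ 36 * D₁ * (10 ^ 36 * D₁') =
      10 ^ 72 * ((D - D₁) * D' + D₁ * (D' - D₁') - (F - F₁) * (F + F₁)) by
        linear_combination 10 ^ 72 * h₃, abs_mul]
    have t₁ : |(D - D₁) * D'| ≤ 12 * (1 / 10 ^ 11) * 6 := by
      rw [abs_mul]; gcongr
    have t₂ : |D₁ * (D' - D₁')| ≤ 6 * (12 * (1 / 10 ^ 11)) := by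
      rw [abs_mul]; gcongr
    have t₃ : |(F - F₁) * (F + F₁)| ≤ 14 * (1 / 10 ^ 11) * (6 + 6) := by
      rw [abs_mul]
      have := (abs_add_le F F₁).trans (add_le_add f₂ f₃)
      gcongr
    have t : |(D - D₁) * D' + D₁ * (D' - D₁') - (F - F₁) * (F + F₁)| ≤ 1 / 10 ^ 7 := by
      refine (abs_sub _ _).trans ?_
      linarith [abs_add_le ((D - D₁) * D') (D₁ * (D' - D₁'))]
    calc |(10 : ℝ) ^ 72| * _ ≤ |(10 : ℝ) ^ 72| * (1 / 10 ^ 7) := by gcongr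
      _ ≤ _ := by rw [abs_of_nonneg (by positivity)]; norm_num

/-- The Gram matrix annihilates the positive vector A, so its adjugate is a multiple of A Aᵀ.
Cofactors therefore have the sign of the principal minors, and the 2×2 minors of the adjugate
vanish. -/
theorem AreaRelations.edgeCofactor_pos {x c : Fin 6 → ℝ} {A : Fin 4 → ℝ} {V : ℝ}
    (h : AreaRelations x c A V) :
    0 < edgeCofactor (c 0) (c 5) (c 1) (c 2) (c 3) (c 4) ∧
    0 < edgeCofactor (c 5) (c 0) (c 1) (c 3) (c 2) (c 4) ∧
    edgeCofactor (c 0) (c 5) (c 1) (c 2) (c 3) (c 4) ^ 2 =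
      vertexMinor (c 0) (c 1) (c 2) * vertexMinor (c 0) (c 3) (c 4) := by
  have e₁ : A 0 * vertexMinor (c 0) (c 3) (c 4) =
      A 1 * edgeCofactor (c 0) (c 5) (c 1) (c 2) (c 3) (c 4) := by
    simp only [vertexMinor, edgeCofactor]
    linear_combination (1 - c 0 ^ 2) * h.area₁ + (c 4 + c 0 * c 3) * h.area₃ +
      (c 3 + c 0 * c 4) * h.area₄
  have e₂ : A 1 * vertexMinor (c 0) (c 1) (c 2) =
      A 0 * edgeCofactor (c 0) (c 5) (c 1) (c 2) (c 3) (c 4) := by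
    simp only [vertexMinor, edgeCofactor]
    linear_combination (1 - c 0 ^ 2) * h.area₂ + (c 2 + c 0 * c 1) * h.area₃ +
      (c 1 + c 0 * c 2) * h.area₄
  have e₃ : A 2 * vertexMinor (c 5) (c 2) (c 4) =
      A 3 * edgeCofactor (c 5) (c 0) (c 1) (c 3) (c 2) (c 4) := by
    simp only [vertexMinor, edgeCofactor]
    linear_combination (1 - c 5 ^ 2) * h.area₃ + (c 4 + c 5 * c 2) * h.area₁ +
      (c 2 + c 5 * c 4) * h.area₂
  have p₂ : 0 < vertexMinor (c 0) (c 3) (c 4) := h.minor₂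
  have p₃ : 0 < vertexMinor (c 5) (c 2) (c 4) := by
    have := h.minor₄
    simp only [vertexMinor]; linarith
  refine ⟨pos_of_mul_pos_right (e₁ ▸ mul_pos (h.pos 0) p₂) (h.pos 1).le,
    pos_of_mul_pos_right (e₃ ▸ mul_pos (h.pos 2) p₃) (h.pos 3).le, ?_⟩
  refine mul_left_cancel₀ (mul_pos (h.pos 0) (h.pos 1)).ne' ?_
  linear_combination (-A 1 * edgeCofactor (c 0) (c 5) (c 1) (c 2) (c 3) (c 4)) * e₂ -
    (A 1 * vertexMinor (c 0) (c 1) (c 2)) * e₁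

/-- For the faces A, B at an edge with cosine z, the sum of their area relations expresses (A + B)(1
− z) > 0 as a positive combination of the two cosine sums at the ends of the edge. -/
theorem AreaRelations.cos_add_cos_pos {x c : Fin 6 → ℝ} {A : Fin 4 → ℝ} {V : ℝ}
    (h : AreaRelations x c A V) (hlt : ∀ e, c e < 1) :
    (0 < c 1 + c 2 ∨ 0 < c 3 + c 4) ∧ (0 < c 0 + c 2 ∨ 0 < c 3 + c 5) ∧
    (0 < c 0 + c 1 ∨ 0 < c 4 + c 5) ∧ (0 < c 0 + c 4 ∨ 0 < c 1 + c 5) ∧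
    (0 < c 0 + c 3 ∨ 0 < c 2 + c 5) ∧ (0 < c 1 + c 3 ∨ 0 < c 2 + c 4) := by
  have key {a b a' b' z u v : ℝ} (ha : 0 < a) (hb : 0 < b) (ha' : 0 < a') (hb' : 0 < b')
      (hz : z < 1) (heq : (a + b) * (1 - z) = a' * u + b' * v) : 0 < u ∨ 0 < v := by
    by_contra! hn
    have : 0 < (a + b) * (1 - z) := mul_pos (by linarith) (by linarith)
    nlinarith [mul_nonneg ha'.le (neg_nonneg.2 hn.1), mul_nonneg hb'.le (neg_nonneg.2 hn.2)]
  refine ⟨?_, ?_, ?_, ?_, ?_, ?_⟩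
  · exact key (h.pos 2) (h.pos 3) (h.pos 1) (h.pos 0) (hlt 0)
      (by linear_combination h.area₃ + h.area₄)
  · exact key (h.pos 1) (h.pos 3) (h.pos 2) (h.pos 0) (hlt 1)
      (by linear_combination h.area₂ + h.area₄)
  · exact key (h.pos 1) (h.pos 2) (h.pos 3) (h.pos 0) (hlt 2)
      (by linear_combination h.area₂ + h.area₃)
  · exact key (h.pos 0) (h.pos 3) (h.pos 2) (h.pos 1) (hlt 3)
      (by linear_combination h.area₁ + h.area₄)
  · exact key (h.pos 0) (h.pos 2) (h.pos 3) (h.pos 1) (hlt 4)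
      (by linear_combination h.area₁ + h.area₃)
  · exact key (h.pos 0) (h.pos 1) (h.pos 3) (h.pos 2) (hlt 5)
      (by linear_combination h.area₁ + h.area₂)

theorem three_le_of_cos_sq_lt_one {n : ℕ} (hn : 0 < n) (h : Real.cos (2 * Real.pi / n) ^ 2 < 1) :
    3 ≤ n := by
  by_contra! hlt
  interval_cases n <;> norm_num at h

theorem le_fortyone_of_vertexOK {a b c d e : ℕ} (hb : 3 ≤ b) (hc : 3 ≤ c) (hd : 3 ≤ d)
    (he : 3 ≤ e) (h₁ : vertexOK a b c = true) (h₂ : vertexOK a d e = true)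
    (h : acutePair b c = true ∨ acutePair d e = true) : a ≤ 41 := by
  simp only [vertexOK, Bool.and_eq_true] at h₁ h₂
  exact h.elim (le_of_angleSumOK hb hc h₁.1.1.1) (le_of_angleSumOK hd he h₂.1.1.1)

theorem row_mem_solutions {x : Fin 6 → ℝ} (hx : IsEdgeVector x) {N : Fin 6 → ℕ}
    (hN : ∀ e, 0 < N e) (hc : HasCosines x fun e => Real.cos (2 * Real.pi / N e))
    (h0 : ∀ e, N 0 ≤ N e) (h12 : N 1 ≤ N 2) (h13 : N 1 ≤ N 3) (h14 : N 1 ≤ N 4) :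
    [N 0, N 1, N 2, N 3, N 4, N 5] ∈ solutions := by
  have hA := areaRelations hx hc
  set A := fun i => √(faceSq x i)
  -- The sine rule gives sin² > 0, which excludes n = 1 and n = 2.
  have hsq (e : Fin 6) : Real.cos (2 * Real.pi / N e) ^ 2 < 1 := by
    have h := hA.sine e
    have : 0 < 2 * x e * gramDet (x 0) (x 1) (x 2) (x 3) (x 4) (x 5) :=
      mul_pos (mul_pos two_pos (hx.pos e)) hA.vol_pos
    have h2 := pos_of_mul_pos_right (h ▸ this) (sq_nonneg _)
    linarith
  have h3 (e : Fin 6) : 3 ≤ N e := three_le_of_cos_sq_lt_one (hN e) (hsq e)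
  have hac {i j : Fin 6} := acutePair_of_cos_add_cos_pos (h3 i) (h3 j)
  obtain ⟨a₀, a₁, a₂, a₃, a₄, a₅⟩ := hA.cos_add_cos_pos fun e =>
    (abs_lt.1 ((sq_lt_one_iff_abs_lt_one _).1 (hsq e))).2
  replace a₀ := a₀.imp hac hac
  replace a₁ := a₁.imp hac hac
  replace a₂ := a₂.imp hac hac
  replace a₃ := a₃.imp hac hac
  replace a₄ := a₄.imp hac hac
  replace a₅ := a₅.imp hac hac
  have w {a b c : ℕ} (h : vertexOK a b c = true) : vertexOK b a c = true ∧
      vertexOK c a b = true := by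
    simp only [vertexOK, angleSumOK, angleTriOK, Bool.and_eq_true, Nat.blt_eq] at h ⊢
    have e2 : b * c * a = a * b * c := by ring
    have e4 : a * c * b = a * b * c := by ring
    simp only [e2, e4, mul_comm b a, mul_comm c a, mul_comm c b] at h ⊢
    omega
  have v₁ := vertexOK_of_minor_pos (h3 0) (h3 1) (h3 2) hA.minor₁
  have v₂ := vertexOK_of_minor_pos (h3 0) (h3 3) (h3 4) hA.minor₂
  have v₃ := vertexOK_of_minor_pos (h3 1) (h3 3) (h3 5) hA.minor₃
  have v₄ := vertexOK_of_minor_pos (h3 2) (h3 4) (h3 5) hA.minor₄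
  have h41 (e : Fin 6) : N e ≤ 41 := by
    fin_cases e
    · exact le_fortyone_of_vertexOK (h3 _) (h3 _) (h3 _) (h3 _) v₁ v₂ a₀
    · exact le_fortyone_of_vertexOK (h3 _) (h3 _) (h3 _) (h3 _) (w v₁).1 v₃ a₁
    · exact le_fortyone_of_vertexOK (h3 _) (h3 _) (h3 _) (h3 _) (w v₁).2 v₄ a₂
    · exact le_fortyone_of_vertexOK (h3 _) (h3 _) (h3 _) (h3 _) (w v₂).1 (w v₃).1 a₃
    · exact le_fortyone_of_vertexOK (h3 _) (h3 _) (h3 _) (h3 _) (w v₂).2 (w v₄).1 a₄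
    · exact le_fortyone_of_vertexOK (h3 _) (h3 _) (h3 _) (h3 _) (w v₃).2 (w v₄).2 a₅
  choose P hP hPN using fun e => exists_mem_cosTable (h3 e) (h41 e)
  obtain ⟨p₁, p₂, p₃⟩ := hA.edgeCofactor_pos
  have hex := excluded_eq_false hP (fun e => by rw [hPN]) p₁ p₂ p₃
  simp only [← hPN] at *
  exact mem_solutions hP h0 h12 h13 h14 v₁ v₂ v₃ v₄ a₀ a₁ a₂ a₃ a₄ a₅ hex

/-! ### From the search to the classification -/

/-- Relabelling the vertices so that the first edge carries the smallest number, and the second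
edge the smallest number among the edges adjacent to the first one. -/
theorem exists_perm_minimal (M : Fin 6 → ℕ) : ∃ τ : Equiv.Perm (Fin 4),
    (∀ i j, i ≠ j → M (edgeIndex (τ 0) (τ 1)) ≤ M (edgeIndex (τ i) (τ j))) ∧
    M (edgeIndex (τ 0) (τ 2)) ≤ M (edgeIndex (τ 0) (τ 3)) ∧
    M (edgeIndex (τ 0) (τ 2)) ≤ M (edgeIndex (τ 1) (τ 2)) ∧
    M (edgeIndex (τ 0) (τ 2)) ≤ M (edgeIndex (τ 1) (τ 3)) := by
  have hsymm : ∀ i j, edgeIndex i j = edgeIndex j i := by decide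
  -- Each inequality compares this lexicographic minimum with τ * ρ; when ρ preserves the first
  -- edge, the comparison passes to the second entries.
  obtain ⟨τ, hτ⟩ := Finite.exists_min fun τ : Equiv.Perm (Fin 4) =>
    toLex (M (edgeIndex (τ 0) (τ 1)), M (edgeIndex (τ 0) (τ 2)))
  simp only [Prod.Lex.toLex_le_toLex] at hτ
  refine ⟨τ, fun i j hij => ?_, ?_, ?_, ?_⟩
  · obtain ⟨ρ, h0, h1⟩ : ∃ ρ : Equiv.Perm (Fin 4), ρ 0 = i ∧ ρ 1 = j := by decide +revert
    have := hτ (τ * ρ)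
    simp only [Equiv.Perm.mul_apply, h0, h1] at this
    omega
  · obtain ⟨ρ, h0, h1, h2⟩ : ∃ ρ : Equiv.Perm (Fin 4), ρ 0 = 0 ∧ ρ 1 = 1 ∧ ρ 2 = 3 := by decide
    have := hτ (τ * ρ)
    simp only [Equiv.Perm.mul_apply, h0, h1, h2] at this
    omega
  · obtain ⟨ρ, h0, h1, h2⟩ : ∃ ρ : Equiv.Perm (Fin 4), ρ 0 = 1 ∧ ρ 1 = 0 ∧ ρ 2 = 2 := by decide
    have := hτ (τ * ρ)
    simp only [Equiv.Perm.mul_apply, h0, h1, h2, hsymm (τ 1) (τ 0)] at this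
    omega
  · obtain ⟨ρ, h0, h1, h2⟩ : ∃ ρ : Equiv.Perm (Fin 4), ρ 0 = 1 ∧ ρ 1 = 0 ∧ ρ 2 = 3 := by decide
    have := hτ (τ * ρ)
    simp only [Equiv.Perm.mul_apply, h0, h1, h2, hsymm (τ 1) (τ 0)] at this
    omega

/-- The two labellings of the edges of a tetrahedron differ by a permutation of the vertices. -/
def SameUpToPerm (L N : Fin 6 → ℕ) : Prop :=
  ∃ τ : Equiv.Perm (Fin 4), ∀ i j, i ≠ j → L (edgeIndex (τ i) (τ j)) = N (edgeIndex i j)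

instance (L N : Fin 6 → ℕ) : Decidable (SameUpToPerm L N) :=
  inferInstanceAs (Decidable (∃ τ : Equiv.Perm (Fin 4), ∀ i j, i ≠ j →
    L (edgeIndex (τ i) (τ j)) = N (edgeIndex i j)))

theorem solutions_sameUpToPerm : ∀ l ∈ solutions,
    ∃ N ∈ [TileName.sommerville3.row, TileName.sommerville2.row, TileName.goldbergTwoPiDivEight.row,
      TileName.goldbergTwoPiDivFive.row, TileName.sommerville1.row, NonTileName.A.row,
      NonTileName.B.row, NonTileName.C.row, NonTileName.D.row, NonTileName.E.row,
      NonTileName.F.row], SameUpToPerm (fun e => l.getD e 0) N := by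
  decide +kernel

namespace Tetrahedron

theorem exists_dihedralAngles_eq {T : Tetrahedron} (hT : T.AllAnglesTwoPiDiv) :
    ∃ M : Fin 6 → ℕ, (∀ e, 0 < M e) ∧ ∀ e, dihedralAngles T.points e = 2 * Real.pi / M e := by
  have h (e : Fin 6) : ∃ n : ℕ, 0 < n ∧ dihedralAngles T.points e = 2 * Real.pi / n := by
    obtain ⟨τ, rfl⟩ : ∃ τ : Equiv.Perm (Fin 4), edgeIndex (τ 0) (τ 1) = e := by decide +revert
    obtain ⟨n, hn, hτ⟩ := hT τ
    exact ⟨n, hn, by rw [← dihedralAngle_perm, ← hτ]; rfl⟩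
  choose M hM hM' using h
  exact ⟨M, hM, hM'⟩

theorem dihedralAngles_comp {p : Fin 4 → E3} {M : Fin 6 → ℕ}
    (hM : ∀ e, dihedralAngles p e = 2 * Real.pi / M e) (τ : Equiv.Perm (Fin 4)) {N : Fin 6 → ℕ}
    (hN : ∀ i j, i ≠ j → M (edgeIndex (τ i) (τ j)) = N (edgeIndex i j)) (e : Fin 6) :
    dihedralAngles (p ∘ τ) e = 2 * Real.pi / N e := by
  obtain ⟨ρ, rfl⟩ : ∃ ρ : Equiv.Perm (Fin 4), edgeIndex (ρ 0) (ρ 1) = e := by decide +revert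
  have := dihedralAngle_perm p (τ * ρ)
  rw [← dihedralAngle_perm (p ∘ τ), ← hN _ _ (ρ.injective.ne (by decide)), ← hM]
  exact this

theorem exists_row_of_allAnglesTwoPiDiv {T : Tetrahedron} (hT : T.AllAnglesTwoPiDiv) :
    (∃ t : TileName, T.HasAngles t.row) ∨ ∃ t : NonTileName, T.HasAngles t.row := by
  obtain ⟨M, hM0, hM⟩ := exists_dihedralAngles_eq hT
  obtain ⟨τ, h0, h2, h3, h4⟩ := exists_perm_minimal M
  obtain ⟨N, hN⟩ : ∃ N : Fin 6 → ℕ,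
      ∀ i j, i ≠ j → M (edgeIndex (τ i) (τ j)) = N (edgeIndex i j) := by
    refine ⟨![M (edgeIndex (τ 0) (τ 1)), M (edgeIndex (τ 0) (τ 2)), M (edgeIndex (τ 0) (τ 3)),
      M (edgeIndex (τ 1) (τ 2)), M (edgeIndex (τ 1) (τ 3)), M (edgeIndex (τ 2) (τ 3))], ?_⟩
    have hsymm : ∀ i j, edgeIndex i j = edgeIndex j i := by decide
    intro i j hij
    fin_cases i <;> fin_cases j <;> first | exact absurd rfl hij | rfl | (rw [hsymm]; rfl)
  have hsurj (e : Fin 6) : ∃ i j : Fin 4, i ≠ j ∧ edgeIndex i j = e := by decide +revert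
  have hNang := dihedralAngles_comp hM τ hN
  have hp := affineIndependent_comp_perm T τ
  have hcos := hasCosines_sqEdges hp
  simp only [hNang] at hcos
  rw [hN _ _ (by decide)] at h0 h2 h3 h4
  rw [hN _ _ (by decide)] at h2 h3 h4
  have hsol := row_mem_solutions (isEdgeVector_sqEdges hp) (N := N) (fun e => by
    obtain ⟨i, j, hij, rfl⟩ := hsurj e
    rw [← hN i j hij]; exact hM0 _) hcos (fun e => by
    obtain ⟨i, j, hij, rfl⟩ := hsurj e
    rw [← hN i j hij]; exact h0 i j hij) h2 h3 h4
  obtain ⟨R, hR, ρ, hρ⟩ := solutions_sameUpToPerm _ hsol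
  have hL : (fun e : Fin 6 => [N 0, N 1, N 2, N 3, N 4, N 5].getD e 0) = N := by
    funext e; fin_cases e <;> rfl
  rw [hL] at hρ
  have hrow : T.HasAngles R := (hasAngles_iff_dihedralAngles T R).2
    ⟨τ * ρ, dihedralAngles_comp hNang ρ hρ⟩
  simp only [List.mem_cons, List.not_mem_nil, or_false] at hR
  rcases hR with rfl | rfl | rfl | rfl | rfl | rfl | rfl | rfl | rfl | rfl | rfl
  · exact .inl ⟨_, hrow⟩
  · exact .inl ⟨_, hrow⟩
  · exact .inl ⟨_, hrow⟩
  · exact .inl ⟨_, hrow⟩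
  · exact .inl ⟨_, hrow⟩
  all_goals exact .inr ⟨_, hrow⟩

theorem allAnglesTwoPiDiv_of_hasAngles {T : Tetrahedron} {n : Fin 6 → ℕ} (hn : ∀ e, 2 ≤ n e)
    (hT : T.HasAngles n) : T.AllAnglesTwoPiDiv := by
  obtain ⟨σ, hσ⟩ := (hasAngles_iff_dihedralAngles T n).1 hT
  intro τ
  refine ⟨n (edgeIndex (σ⁻¹ (τ 0)) (σ⁻¹ (τ 1))), two_pos.trans_le (hn _), ?_⟩
  have h := dihedralAngle_perm (T.points ∘ σ) (σ⁻¹ * τ)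
  rw [hσ] at h
  simpa [Tetrahedron.angle] using h

theorem allAnglesTwoPiDiv_iff (T : Tetrahedron) : T.AllAnglesTwoPiDiv ↔
    (∃ t : TileName, T.HasAngles t.row) ∨ ∃ t : NonTileName, T.HasAngles t.row := by
  refine ⟨exists_row_of_allAnglesTwoPiDiv, ?_⟩
  rintro (⟨t, ht⟩ | ⟨t, ht⟩)
  · exact allAnglesTwoPiDiv_of_hasAngles t.two_le_row ht
  · exact allAnglesTwoPiDiv_of_hasAngles t.two_le_row ht

end Tetrahedron

/-! ### A criterion for face-to-face tilings -/

namespace Tetrahedron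

variable {T : Tetrahedron} {p : Fin 4 → E3}

theorem image_convexHull_eq (g : E3 ≃ᵃⁱ[ℝ] E3) (s : Set E3) :
    g '' convexHull ℝ s = convexHull ℝ (g '' s) :=
  AffineMap.image_convexHull g.toAffineEquiv.toAffineMap s

theorem map_convexCombination (g : E3 ≃ᵃⁱ[ℝ] E3) {w : Fin 4 → ℝ} (hw : ∑ a, w a = 1)
    (p : Fin 4 → E3) : g (∑ a, w a • p a) = ∑ a, w a • g (p a) := by
  have h := Finset.map_affineCombination Finset.univ p w hw g.toAffineEquiv.toAffineMap
  rw [Finset.affineCombination_eq_linear_combination _ _ _ hw,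
    Finset.affineCombination_eq_linear_combination _ _ _ hw] at h
  exact h

theorem sum_mem_convexHull {w : Fin 4 → ℝ} (h0 : ∀ a, 0 ≤ w a) (h1 : ∑ a, w a = 1)
    {x : Fin 4 → E3} {s : Set E3} (hs : ∀ a, 0 < w a → x a ∈ s) :
    ∑ a, w a • x a ∈ convexHull ℝ s := by
  have hne (a : Fin 4) : ¬ 0 < w a → w a = 0 := fun h => le_antisymm (not_lt.1 h) (h0 a)
  rw [← Finset.sum_filter_of_ne (p := fun a => 0 < w a)
    (fun a _ h => by_contra fun h' => h (by rw [hne a h', zero_smul]))]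
  refine (convex_convexHull ℝ s).sum_mem (fun a _ => h0 a) ?_
    fun a ha => subset_convexHull ℝ s (hs a (Finset.mem_filter.1 ha).2)
  rw [Finset.sum_filter_of_ne fun a _ h => by_contra fun h' => h (hne a h'), h1]

theorem interior_convexHull_inter_eq_empty (hp : AffineIndependent ℝ p) {a : Fin 4} {s : Set E3}
    (ha : p a ∉ s) : interior (convexHull ℝ (Set.range p ∩ s)) = ∅ := by
  rw [← Set.not_nonempty_iff_eq_empty, interior_convexHull_nonempty_iff_affineSpan_eq_top]
  intro h
  refine hp.notMem_affineSpan_sdiff a Set.univ (affineSpan_mono ℝ ?_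
    (h ▸ AffineSubspace.mem_top ℝ E3 (p a)))
  rintro _ ⟨⟨b, rfl⟩, hb⟩
  exact ⟨b, ⟨trivial, by rintro rfl; exact ha hb⟩, rfl⟩

/-- If the simplices `g(T)`, for `g ∈ K`, cover the space and have well-defined open vertex stars,
they form a face-to-face tiling. -/
theorem tilesFaceToFace_of_star (hpT : Set.range p = T.verts)
    (K : Set (E3 ≃ᵃⁱ[ℝ] E3)) (star : E3 → E3 → Prop)
    (hinv : ∀ g ∈ K, ∀ u x, star (g u) (g x) ↔ star u x)
    (hstar : ∀ w : Fin 4 → ℝ, (∀ a, 0 ≤ w a) → ∑ a, w a = 1 → ∀ a, 0 < w a →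
      star (p a) (∑ a, w a • p a))
    (hvert : ∀ w : Fin 4 → ℝ, (∀ a, 0 ≤ w a) → ∑ a, w a = 1 → ∀ u,
      star u (∑ a, w a • p a) → u ∈ Set.range p)
    (hcover : ∀ x, ∃ g ∈ K, x ∈ g '' convexHull ℝ (Set.range p)) : T.TilesFaceToFace := by
  -- Symmetries of the tile yield the same simplex several times; G keeps one isometry for each
  -- vertex set.
  obtain ⟨G, hGK, hbij⟩ := Set.exists_subset_bijOn K fun g => g '' T.verts
  have hface : ∀ g ∈ G, ∀ h ∈ G,
      g '' T.body ∩ h '' T.body = convexHull ℝ (g '' T.verts ∩ h '' T.verts) := by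
    intro g hg h hh
    refine Set.Subset.antisymm ?_ (Set.subset_inter ?_ ?_)
    · rintro x ⟨⟨y, hy, rfl⟩, z, hz, hzy⟩
      rw [body, ← hpT, mem_convexHull_range_iff] at hy hz
      obtain ⟨w, w0, w1, rfl⟩ := hy
      obtain ⟨w', w0', w1', rfl⟩ := hz
      rw [map_convexCombination g w1]
      refine sum_mem_convexHull w0 w1 fun a ha => ?_
      -- The common point lies in the star of every vertex of g(T) that has positive weight; read in
      -- h(T), this makes each of them a vertex of h(T) as well.
      have h1 := (hinv g (hGK hg) _ _).2 (hstar w w0 w1 a ha)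
      rw [← hzy, ← h.apply_symm_apply (g (p a)), hinv h (hGK hh)] at h1
      have h2 := hvert w' w0' w1' _ h1
      exact ⟨⟨p a, hpT ▸ ⟨a, rfl⟩, rfl⟩, _, hpT ▸ h2, h.apply_symm_apply _⟩
    · rw [body, image_convexHull_eq]; exact convexHull_mono Set.inter_subset_left
    · rw [body, image_convexHull_eq]; exact convexHull_mono Set.inter_subset_right
  -- If some vertex of g(T) is not shared, the common vertices lie in a plane, so their hull has no
  -- interior.
  have hproper {g h : E3 ≃ᵃⁱ[ℝ] E3} (hne : ¬ g '' T.verts ⊆ h '' T.verts) :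
      interior (convexHull ℝ (g '' T.verts ∩ h '' T.verts)) = ∅ := by
    obtain ⟨_, ⟨_, ⟨a, rfl⟩, rfl⟩, ha⟩ := Set.not_subset.1 hne
    rw [image_verts T g]
    exact interior_convexHull_inter_eq_empty (T.affineIndependent_image g) ha
  refine ⟨G, ?_, fun g hg h hh hne => ?_, hface⟩
  · refine Set.eq_univ_of_forall fun x => ?_
    obtain ⟨g, hg, hx⟩ := hcover x
    obtain ⟨g', hg', heq⟩ := hbij.surjOn ⟨g, hg, rfl⟩
    rw [hpT, image_convexHull_eq] at hx
    refine Set.mem_biUnion hg' ?_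
    rw [body, image_convexHull_eq]
    have heq' : g' '' T.verts = g '' T.verts := heq
    rw [heq']
    exact hx
  · rw [Set.disjoint_iff_inter_eq_empty, ← interior_inter, hface g hg h hh]
    have hne' : g '' T.verts ≠ h '' T.verts := fun he => hne (hbij.injOn hg hh he)
    by_cases hs : g '' T.verts ⊆ h '' T.verts
    · rw [Set.inter_comm]
      exact hproper fun hs' => hne' (hs.antisymm hs')
    · exact hproper hs

/-- The criterion `tilesFaceToFace_of_star` in affine coordinates. -/
theorem tilesFaceToFace_of_coordinates (hpT : Set.range p = T.verts)
    (L : (Fin 3 → ℝ) ≃ᵃ[ℝ] E3) {b : Fin 4 → Fin 3 → ℝ} (hb : ∀ a, L (b a) = p a)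
    (Φ : Set ((Fin 3 → ℝ) → Fin 3 → ℝ))
    (hΦ : ∀ φ ∈ Φ, ∃ g : E3 ≃ᵃⁱ[ℝ] E3, ∀ z, g (L z) = L (φ z))
    (star : (Fin 3 → ℝ) → (Fin 3 → ℝ) → Prop)
    (hinv : ∀ φ ∈ Φ, ∀ u x, star (φ u) (φ x) ↔ star u x)
    (hstar : ∀ w : Fin 4 → ℝ, (∀ a, 0 ≤ w a) → ∑ a, w a = 1 → ∀ a, 0 < w a →
      star (b a) (∑ a, w a • b a))
    (hvert : ∀ w : Fin 4 → ℝ, (∀ a, 0 ≤ w a) → ∑ a, w a = 1 → ∀ u,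
      star u (∑ a, w a • b a) → u ∈ Set.range b)
    (hcover : ∀ x, ∃ φ ∈ Φ, ∃ w : Fin 4 → ℝ, (∀ a, 0 ≤ w a) ∧ ∑ a, w a = 1 ∧
      φ (∑ a, w a • b a) = x) : T.TilesFaceToFace := by
  have hL {w : Fin 4 → ℝ} (hw : ∑ a, w a = 1) : L (∑ a, w a • b a) = ∑ a, w a • p a := by
    have h := Finset.map_affineCombination Finset.univ b w hw L.toAffineMap
    rw [Finset.affineCombination_eq_linear_combination _ _ _ hw,
      Finset.affineCombination_eq_linear_combination _ _ _ hw] at h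
    exact h.trans (Finset.sum_congr rfl fun a _ => by rw [← hb]; rfl)
  have hL' {w : Fin 4 → ℝ} (hw : ∑ a, w a = 1) : L.symm (∑ a, w a • p a) = ∑ a, w a • b a := by
    rw [← hL hw, L.symm_apply_apply]
  refine tilesFaceToFace_of_star hpT {g | ∃ φ ∈ Φ, ∀ z, g (L z) = L (φ z)}
    (fun u x => star (L.symm u) (L.symm x)) ?_ ?_ ?_ ?_
  · rintro g ⟨φ, hφ, hg⟩ u x
    obtain ⟨u, rfl⟩ := L.surjective u
    obtain ⟨x, rfl⟩ := L.surjective x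
    simp only [hg, L.symm_apply_apply]
    exact hinv φ hφ u x
  · intro w w0 w1 a ha
    rw [hL' w1, ← hb, L.symm_apply_apply]
    exact hstar w w0 w1 a ha
  · intro w w0 w1 u hu
    rw [hL' w1] at hu
    obtain ⟨a, ha⟩ := hvert w w0 w1 _ hu
    exact ⟨a, by rw [← hb, ha, L.apply_symm_apply]⟩
  · intro x
    obtain ⟨φ, hφ, w, w0, w1, hx⟩ := hcover (L.symm x)
    obtain ⟨g, hg⟩ := hΦ φ hφ
    refine ⟨g, ⟨φ, hφ, hg⟩, _, mem_convexHull_range_iff.2 ⟨w, w0, w1, rfl⟩, ?_⟩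
    rw [← hL w1, hg, hx, L.apply_symm_apply]

/-- The affine isomorphism with origin `o` and basis vectors `f`. -/
theorem exists_coordinates (o : E3) {f : Fin 3 → E3}
    (hf : ∀ z : Fin 3 → ℝ, ∑ i, z i • f i = 0 → z = 0) :
    ∃ L : (Fin 3 → ℝ) ≃ᵃ[ℝ] E3, ∀ z, L z = o + ∑ i, z i • f i := by
  have hli : LinearIndependent ℝ f := Fintype.linearIndependent_iff.2 fun z hz i =>
    congrFun (hf z hz) i
  let B := basisOfLinearIndependentOfCardEqFinrank hli (by simp)
  refine ⟨B.equivFun.symm.toAffineEquiv.trans (AffineEquiv.constVAdd ℝ E3 o), fun z => ?_⟩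
  simp [B, Module.Basis.equivFun_symm_apply]

/-- A symmetry of the triangulation in coordinates becomes a Euclidean isometry as soon as its
linear part preserves the quadratic form of the basis f. -/
theorem exists_isometry_of_coordinates {o : E3} {f : Fin 3 → E3} {L : (Fin 3 → ℝ) ≃ᵃ[ℝ] E3}
    (hL : ∀ z, L z = o + ∑ i, z i • f i) (A : (Fin 3 → ℝ) →ₗ[ℝ] Fin 3 → ℝ) (v : Fin 3 → ℝ)
    (hA : ∀ z, ‖∑ i, A z i • f i‖ = ‖∑ i, z i • f i‖) :
    ∃ g : E3 ≃ᵃⁱ[ℝ] E3, ∀ z, g (L z) = L (v + A z) := by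
  have hlin (z : Fin 3 → ℝ) : L.linear z = ∑ i, z i • f i := by
    have := L.map_vadd 0 z
    simp only [vadd_eq_add, add_zero, hL, Pi.zero_apply, zero_smul, Finset.sum_const_zero] at this
    rw [add_comm] at this
    exact (add_right_cancel this).symm
  let M : E3 →ₗᵢ[ℝ] E3 :=
    { toLinearMap := L.linear.toLinearMap ∘ₗ A ∘ₗ L.linear.symm.toLinearMap
      norm_map' := fun x => by
        obtain ⟨z, rfl⟩ := L.linear.surjective x
        change ‖L.linear (A (L.linear.symm (L.linear z)))‖ = ‖L.linear z‖
        rw [LinearEquiv.symm_apply_apply, hlin, hlin, hA] }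
  let M' := M.toLinearIsometryEquiv rfl
  have hM (z : Fin 3 → ℝ) : M' (∑ i, z i • f i) = ∑ i, A z i • f i := by
    rw [← hlin, ← hlin]
    simp [M', M]
  refine ⟨((AffineIsometryEquiv.constVAdd ℝ E3 (-o)).trans M'.toAffineIsometryEquiv).trans
    (AffineIsometryEquiv.constVAdd ℝ E3 (L v)), fun z => ?_⟩
  simp [hL, hM, add_smul, Finset.sum_add_distrib, add_assoc]

end Tetrahedron

/-- The squared distance from the first vertex to the point with the barycentric coordinates
`1 - α - β - γ, α, β, γ`, in terms of the squared edge lengths. -/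
theorem norm_sq_combination (p : Fin 4 → E3) (α β γ : ℝ) :
    ‖α • (p 1 - p 0) + β • (p 2 - p 0) + γ • (p 3 - p 0)‖ ^ 2 =
      α ^ 2 * sqEdges p 0 + β ^ 2 * sqEdges p 1 + γ ^ 2 * sqEdges p 2 +
      α * β * (sqEdges p 0 + sqEdges p 1 - sqEdges p 3) +
      α * γ * (sqEdges p 0 + sqEdges p 2 - sqEdges p 4) +
      β * γ * (sqEdges p 1 + sqEdges p 2 - sqEdges p 5) := by
  have hd (i j : Fin 4) : dist (p i) (p j) ^ 2 = ‖(p i - p 0) - (p j - p 0)‖ ^ 2 := by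
    rw [dist_eq_norm, sub_sub_sub_cancel_right]
  have e0 : sqEdges p 0 = ‖p 1 - p 0‖ ^ 2 := by rw [← dist_eq_norm, dist_comm]; rfl
  have e1 : sqEdges p 1 = ‖p 2 - p 0‖ ^ 2 := by rw [← dist_eq_norm, dist_comm]; rfl
  have e2 : sqEdges p 2 = ‖p 3 - p 0‖ ^ 2 := by rw [← dist_eq_norm, dist_comm]; rfl
  have e3 : sqEdges p 3 = ‖(p 1 - p 0) - (p 2 - p 0)‖ ^ 2 := hd 1 2
  have e4 : sqEdges p 4 = ‖(p 1 - p 0) - (p 3 - p 0)‖ ^ 2 := hd 1 3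
  have e5 : sqEdges p 5 = ‖(p 2 - p 0) - (p 3 - p 0)‖ ^ 2 := hd 2 3
  rw [e0, e1, e2, e3, e4, e5]
  simp only [norm_sub_sq_real, norm_add_sq_real, inner_add_left, inner_smul_left, inner_smul_right,
    norm_smul, mul_pow, Real.norm_eq_abs, sq_abs, RCLike.conj_to_real]
  ring

/-- The linear map that permutes the coordinates and multiplies them by the numbers `ε i`. -/
def scaledPerm (ε : Fin 3 → ℝ) (s : Equiv.Perm (Fin 3)) : (Fin 3 → ℝ) →ₗ[ℝ] Fin 3 → ℝ :=
  LinearMap.pi fun i => ε i • LinearMap.proj (s i)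

theorem scaledPerm_apply (ε : Fin 3 → ℝ) (s : Equiv.Perm (Fin 3)) (z : Fin 3 → ℝ) (i : Fin 3) :
    scaledPerm ε s z i = ε i * z (s i) := rfl

theorem exists_perm_antitone (y : Fin 3 → ℝ) :
    ∃ s : Equiv.Perm (Fin 3), y (s 1) ≤ y (s 0) ∧ y (s 2) ≤ y (s 1) := by
  have h := Tuple.monotone_sort fun i => -y i
  refine ⟨Tuple.sort fun i => -y i, ?_, ?_⟩
  · exact neg_le_neg_iff.1 (h (show (0 : Fin 3) ≤ 1 by decide))
  · exact neg_le_neg_iff.1 (h (show (1 : Fin 3) ≤ 2 by decide))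

theorem eq_zero_or_one_of_abs_sub_lt {y : ℝ} {n : ℤ} (h0 : 0 ≤ y) (h1 : y ≤ 1)
    (h : |y - n| < 1) : n = 0 ∨ n = 1 := by
  rw [abs_lt] at h
  have h2 : (-1 : ℤ) < n := by exact_mod_cast (show (-1 : ℝ) < n by linarith)
  have h3 : n < 2 := by exact_mod_cast (show (n : ℝ) < 2 by linarith)
  omega

theorem eq_zero_of_abs_sub_half_lt {y : ℝ} {n : ℤ} (h0 : 0 ≤ y) (h1 : y ≤ 1)
    (h : |y - (n + 1 / 2)| < 1 / 2) : n = 0 := by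
  rw [abs_lt] at h
  have h2 : (-1 : ℤ) < n := by exact_mod_cast (show (-1 : ℝ) < n by linarith)
  have h3 : n < 1 := by exact_mod_cast (show (n : ℝ) < 1 by linarith)
  omega

theorem abs_add_abs_lt_iff {a b c : ℝ} :
    |a| + |b| < c ↔ a + b < c ∧ a - b < c ∧ -a + b < c ∧ -a - b < c := by
  constructor
  · intro h
    have := le_abs_self a
    have := neg_le_abs a
    have := le_abs_self b
    have := neg_le_abs b
    refine ⟨?_, ?_, ?_, ?_⟩ <;> linarith
  · rintro ⟨h1, h2, h3, h4⟩
    rcases abs_cases a with ⟨h, -⟩ | ⟨h, -⟩ <;> rcases abs_cases b with ⟨h', -⟩ | ⟨h', -⟩ <;>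
      rw [h, h'] <;> linarith

/-! ### Triangulations of the cubic lattice by translates of permuted simplices -/

/-- The open star of an integral point in the Freudenthal triangulation. -/
def freudenthalStar (u x : Fin 3 → ℝ) : Prop :=
  (∀ i, ∃ n : ℤ, u i = n) ∧ (∀ i, |x i - u i| < 1) ∧ ∀ i j, x i - u i - (x j - u j) < 1

/-- The vertices of the fundamental simplex of the Freudenthal triangulation. -/
def freudenthalSimplex : Fin 4 → Fin 3 → ℝ := ![![0, 0, 0], ![1, 0, 0], ![1, 1, 0], ![1, 1, 1]]

theorem freudenthalStar_map (v : Fin 3 → ℤ) (s : Equiv.Perm (Fin 3)) (u x : Fin 3 → ℝ) :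
    freudenthalStar ((fun i => (v i : ℝ)) + scaledPerm 1 s u)
      ((fun i => (v i : ℝ)) + scaledPerm 1 s x) ↔ freudenthalStar u x := by
  simp only [freudenthalStar, Pi.add_apply, scaledPerm_apply, Pi.one_apply, one_mul,
    add_sub_add_left_eq_sub]
  refine and_congr ?_ (and_congr ?_ ?_)
  · refine (forall_congr' fun i => (?_ : _ ↔ ∃ n : ℤ, u (s i) = n)).trans
      (s.forall_congr_right (q := fun i => ∃ n : ℤ, u i = n))
    constructor
    · rintro ⟨n, hn⟩
      exact ⟨n - v i, by push_cast; linarith⟩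
    · rintro ⟨n, hn⟩
      exact ⟨v i + n, by push_cast; linarith⟩
  · exact s.forall_congr_right (q := fun i => |x i - u i| < 1)
  · refine ⟨fun h i j => ?_, fun h i j => h _ _⟩
    simpa using h (s.symm i) (s.symm j)

theorem freudenthalStar_vertex {w : Fin 4 → ℝ} (h0 : ∀ a, 0 ≤ w a) (h1 : ∑ a, w a = 1) (a : Fin 4)
    (ha : 0 < w a) :
    freudenthalStar (freudenthalSimplex a) (∑ a, w a • freudenthalSimplex a) := by
  have g0 := h0 0
  have g1 := h0 1
  have g2 := h0 2
  have g3 := h0 3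
  rw [Fin.sum_univ_four] at h1
  refine ⟨fun i => ?_, fun i => ?_, fun i j => ?_⟩
  · fin_cases a <;> fin_cases i <;>
      first | exact ⟨0, Int.cast_zero.symm⟩ | exact ⟨1, Int.cast_one.symm⟩
  · rw [abs_lt]
    fin_cases a <;> fin_cases i <;> simp [freudenthalSimplex, Fin.sum_univ_four] at ha ⊢ <;>
      constructor <;> linarith
  · fin_cases a <;> fin_cases i <;> fin_cases j <;>
      simp [freudenthalSimplex, Fin.sum_univ_four] at ha ⊢ <;> linarith

/-- A point of the simplex has coordinates 1 ≥ y₀ ≥ y₁ ≥ y₂ ≥ 0, so u is a corner of the unit cube,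
and the condition on differences forbids an entry 0 before an entry 1. -/
theorem mem_range_freudenthalSimplex {w : Fin 4 → ℝ} (h0 : ∀ a, 0 ≤ w a) (h1 : ∑ a, w a = 1)
    (u : Fin 3 → ℝ) (h : freudenthalStar u (∑ a, w a • freudenthalSimplex a)) :
    u ∈ Set.range freudenthalSimplex := by
  have g0 := h0 0
  have g1 := h0 1
  have g2 := h0 2
  have g3 := h0 3
  rw [Fin.sum_univ_four] at h1
  obtain ⟨hn, ha, hd⟩ := h
  choose n hn using hn
  have y0 : (∑ a, w a • freudenthalSimplex a) 0 = w 1 + w 2 + w 3 := by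
    simp [freudenthalSimplex, Fin.sum_univ_four]
  have y1 : (∑ a, w a • freudenthalSimplex a) 1 = w 2 + w 3 := by
    simp [freudenthalSimplex, Fin.sum_univ_four]
  have y2 : (∑ a, w a • freudenthalSimplex a) 2 = w 3 := by
    simp [freudenthalSimplex, Fin.sum_univ_four]
  have a0 := ha 0
  have a1 := ha 1
  have a2 := ha 2
  have d01 := hd 0 1
  have d02 := hd 0 2
  have d12 := hd 1 2
  rw [y0, y1, hn, hn] at d01
  rw [y0, y2, hn, hn] at d02
  rw [y1, y2, hn, hn] at d12
  rw [y0, hn] at a0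
  rw [y1, hn] at a1
  rw [y2, hn] at a2
  have hu : u = ![(n 0 : ℝ), n 1, n 2] := by funext i; fin_cases i <;> simp [hn]
  rw [hu]
  rcases eq_zero_or_one_of_abs_sub_lt (by linarith) (by linarith) a0 with k0 | k0 <;>
  rcases eq_zero_or_one_of_abs_sub_lt (by linarith) (by linarith) a1 with k1 | k1 <;>
  rcases eq_zero_or_one_of_abs_sub_lt (by linarith) (by linarith) a2 with k2 | k2 <;>
  rw [k0, k1, k2] <;> simp only [k0, k1, k2, Int.cast_zero, Int.cast_one] at d01 d02 d12 ⊢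
  · exact ⟨0, rfl⟩
  · linarith
  · linarith
  · linarith
  · exact ⟨1, rfl⟩
  · linarith
  · exact ⟨2, rfl⟩
  · exact ⟨3, rfl⟩

/-- With the fractional parts in decreasing order, their successive differences are barycentric
coordinates. -/
theorem freudenthalSimplex_cover (x : Fin 3 → ℝ) : ∃ (v : Fin 3 → ℤ) (s : Equiv.Perm (Fin 3))
    (w : Fin 4 → ℝ), (∀ a, 0 ≤ w a) ∧ ∑ a, w a = 1 ∧
      (fun i => (v i : ℝ)) + scaledPerm 1 s (∑ a, w a • freudenthalSimplex a) = x := by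
  obtain ⟨s, h1, h2⟩ := exists_perm_antitone fun i => Int.fract (x i)
  refine ⟨fun i => ⌊x i⌋, s.symm,
    ![1 - Int.fract (x (s 0)), Int.fract (x (s 0)) - Int.fract (x (s 1)),
    Int.fract (x (s 1)) - Int.fract (x (s 2)), Int.fract (x (s 2))], ?_, ?_, ?_⟩
  · have := (Int.fract_lt_one (x (s 0))).le
    have := Int.fract_nonneg (x (s 2))
    intro a
    fin_cases a <;> simp <;> linarith
  · simp [Fin.sum_univ_four]
  · have hy : (∑ a, (![1 - Int.fract (x (s 0)), Int.fract (x (s 0)) - Int.fract (x (s 1)),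
        Int.fract (x (s 1)) - Int.fract (x (s 2)), Int.fract (x (s 2))] : Fin 4 → ℝ) a •
        freudenthalSimplex a) = fun k => Int.fract (x (s k)) := by
      funext k
      fin_cases k <;> simp [freudenthalSimplex, Fin.sum_univ_four]
    rw [hy]
    funext i
    simp [scaledPerm_apply]

namespace Tetrahedron

theorem range_points_comp (T : Tetrahedron) (σ : Equiv.Perm (Fin 4)) :
    Set.range (T.points ∘ σ) = T.verts := by
  rw [EquivLike.range_comp]; rfl

/-- The tetrahedra of the first Goldberg family are face-to-face tiles. -/
theorem tilesFaceToFace_of_goldberg {T : Tetrahedron} {B C : ℝ} {σ : Equiv.Perm (Fin 4)}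
    (h : sqEdges (T.points ∘ σ) = ![B, C, 3 * (C - B), B, C, B]) : T.TilesFaceToFace := by
  set p := T.points ∘ σ with hp
  have hpos := (isEdgeVector_sqEdges (affineIndependent_comp_perm T σ)).pos 2
  have hface := (isEdgeVector_sqEdges (affineIndependent_comp_perm T σ)).faceSq_pos 0
  have hC := (isEdgeVector_sqEdges (affineIndependent_comp_perm T σ)).pos 1
  rw [← hp, h] at hpos hface hC
  simp only [faceSq, heron, Matrix.cons_val] at hpos hface hC
  -- The face with squared sides B, C, B has `heron` equal to C (4B − C).
  have hB : 0 < 4 * B - C := by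
    refine pos_of_mul_pos_right (?_ : 0 < C * (4 * B - C)) hC.le
    linarith
  -- The edges of the path through the four vertices have equal lengths and equal mutual inner
  -- products C/2 − B, so the quadratic form is invariant under coordinate permutations.
  let f : Fin 3 → E3 := ![p 1 - p 0, p 2 - p 1, p 3 - p 2]
  have hf (z : Fin 3 → ℝ) : ‖∑ i, z i • f i‖ ^ 2 =
      (2 * B - C / 2) * ∑ i, z i ^ 2 + (C / 2 - B) * (∑ i, z i) ^ 2 := by
    have hz : ∑ i, z i • f i = (z 0 - z 1) • (p 1 - p 0) + (z 1 - z 2) • (p 2 - p 0) +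
        z 2 • (p 3 - p 0) := by
      simp only [f, Fin.sum_univ_three, Matrix.cons_val]
      module
    rw [hz, norm_sq_combination, h]
    simp only [Fin.sum_univ_three, Matrix.cons_val]
    ring
  have hf0 (z : Fin 3 → ℝ) (hz : ∑ i, z i • f i = 0) : z = 0 := by
    have h1 := hf z
    rw [hz, norm_zero, zero_pow two_ne_zero] at h1
    -- The form is definite: its coefficient is at least (4B − C)/2 if C/2 ≥ B, and at least C − B
    -- otherwise, because (Σ z)² ≤ 3 Σ z².
    have h2 : ∑ i, z i ^ 2 = 0 := by
      have h3 : (∑ i, z i) ^ 2 ≤ 3 * ∑ i, z i ^ 2 := by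
        simp only [Fin.sum_univ_three]
        nlinarith [sq_nonneg (z 0 - z 1), sq_nonneg (z 0 - z 2), sq_nonneg (z 1 - z 2)]
      have h4 : 0 ≤ ∑ i, z i ^ 2 := Finset.sum_nonneg fun i _ => sq_nonneg _
      rcases le_total (C / 2) B with h5 | h5
      · nlinarith
      · nlinarith [mul_nonneg (sub_nonneg.2 h5) (sq_nonneg (∑ i, z i))]
    funext i
    have := (Finset.sum_eq_zero_iff_of_nonneg fun i _ => sq_nonneg (z i)).1 h2 i (Finset.mem_univ i)
    exact pow_eq_zero_iff two_ne_zero |>.1 this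
  obtain ⟨L, hL⟩ := exists_coordinates (p 0) hf0
  refine tilesFaceToFace_of_coordinates (T.range_points_comp σ) L (b := freudenthalSimplex) ?_
    {φ | ∃ (v : Fin 3 → ℤ) (s : Equiv.Perm (Fin 3)),
      φ = fun z => (fun i => (v i : ℝ)) + scaledPerm 1 s z}
    ?_ freudenthalStar ?_ (fun w h0 h1 a => freudenthalStar_vertex h0 h1 a)
    (fun w h0 h1 => mem_range_freudenthalSimplex h0 h1) ?_
  · intro a
    rw [hL]
    fin_cases a <;> simp [freudenthalSimplex, Fin.sum_univ_three, f, p]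
  · rintro _ ⟨v, s, rfl⟩
    refine exists_isometry_of_coordinates hL (scaledPerm 1 s) _ fun z => ?_
    rw [← sq_eq_sq₀ (norm_nonneg _) (norm_nonneg _), hf, hf]
    simp only [scaledPerm_apply, Pi.one_apply, one_mul]
    rw [Equiv.sum_comp s z, Equiv.sum_comp s fun i => z i ^ 2]
  · rintro _ ⟨v, s, rfl⟩ u x
    exact freudenthalStar_map v s u x
  · intro x
    obtain ⟨v, s, w, h0, h1, hx⟩ := freudenthalSimplex_cover x
    exact ⟨_, ⟨v, s, rfl⟩, w, h0, h1, hx⟩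

end Tetrahedron

/-! ### Symmetries of the cubic lattice -/

/-- The vector `ε` consists of signs. -/
def IsSignVector (ε : Fin 3 → ℤ) : Prop := ∀ i, ε i = 1 ∨ ε i = -1

/-- The symmetry of the cubic lattice that permutes the coordinates, changes signs and translates
by `v`. -/
def cubicMap (v ε : Fin 3 → ℤ) (s : Equiv.Perm (Fin 3)) (z : Fin 3 → ℝ) : Fin 3 → ℝ :=
  (fun i => (v i : ℝ)) + scaledPerm (fun i => (ε i : ℝ)) s z

theorem cubicMap_apply (v ε : Fin 3 → ℤ) (s : Equiv.Perm (Fin 3)) (z : Fin 3 → ℝ) (i : Fin 3) :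
    cubicMap v ε s z i = v i + ε i * z (s i) := rfl

theorem abs_cubicMap_sub (v : Fin 3 → ℤ) {ε : Fin 3 → ℤ} (hε : IsSignVector ε)
    (s : Equiv.Perm (Fin 3)) (u x : Fin 3 → ℝ) (i : Fin 3) :
    |cubicMap v ε s x i - cubicMap v ε s u i| = |x (s i) - u (s i)| := by
  rw [cubicMap_apply, cubicMap_apply, add_sub_add_left_eq_sub, ← mul_sub, abs_mul]
  rcases hε i with h | h <;> simp [h]

theorem cubicMap_int_iff (v : Fin 3 → ℤ) {ε : Fin 3 → ℤ} (hε : IsSignVector ε)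
    (s : Equiv.Perm (Fin 3)) (u : Fin 3 → ℝ) (i : Fin 3) :
    (∃ n : ℤ, cubicMap v ε s u i = n) ↔ ∃ n : ℤ, u (s i) = n := by
  simp only [cubicMap_apply]
  constructor
  · rintro ⟨n, hn⟩
    refine ⟨ε i * (n - v i), ?_⟩
    rcases hε i with h | h <;> rw [h] at hn ⊢ <;> push_cast at hn ⊢ <;> linarith
  · rintro ⟨n, hn⟩
    exact ⟨v i + ε i * n, by rw [hn]; push_cast; rfl⟩

theorem cubicMap_half_iff (v : Fin 3 → ℤ) {ε : Fin 3 → ℤ} (hε : IsSignVector ε)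
    (s : Equiv.Perm (Fin 3)) (u : Fin 3 → ℝ) (i : Fin 3) :
    (∃ n : ℤ, cubicMap v ε s u i = n + 1 / 2) ↔ ∃ n : ℤ, u (s i) = n + 1 / 2 := by
  simp only [cubicMap_apply]
  rcases hε i with h | h <;> rw [h] <;> push_cast
  · constructor
    · rintro ⟨n, hn⟩; exact ⟨n - v i, by push_cast; linarith⟩
    · rintro ⟨n, hn⟩; exact ⟨v i + n, by push_cast; linarith⟩
  · constructor
    · rintro ⟨n, hn⟩; exact ⟨v i - n - 1, by push_cast; linarith⟩
    · rintro ⟨n, hn⟩; exact ⟨v i - n - 1, by push_cast; linarith⟩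

/-- Sign changes preserve parity, permutations preserve the sum, and the translation is even. -/
theorem even_sum_cubicMap_iff {v ε : Fin 3 → ℤ} (hv : Even (∑ i, v i)) (hε : IsSignVector ε)
    (s : Equiv.Perm (Fin 3)) (n : Fin 3 → ℤ) (r : ℤ) :
    Even (∑ i, (v i + ε i * n (s i)) + r) ↔ Even (∑ i, n i + r) := by
  have h1 : Even (∑ i, (ε i * n (s i) - n (s i))) := by
    refine Finset.even_sum _ fun i _ => ?_
    rcases hε i with h | h <;> rw [h]
    · simp
    · exact ⟨-n (s i), by ring⟩
  rw [Finset.sum_sub_distrib, Equiv.sum_comp s n] at h1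
  rw [Finset.sum_add_distrib]
  have h2 := hv.add h1
  rw [show ∑ i, v i + ∑ i, ε i * n (s i) + r =
    (∑ i, v i + (∑ i, ε i * n (s i) - ∑ i, n i)) + (∑ i, n i + r) by ring, Int.even_add]
  simp [h2]

/-- The point `u` is integral with a coordinate sum congruent to `r` modulo 2. -/
def HasParity (r : ℤ) (u : Fin 3 → ℝ) : Prop :=
  ∃ n : Fin 3 → ℤ, (∀ i, u i = n i) ∧ Even (∑ i, n i + r)

theorem hasParity_cubicMap_iff {v ε : Fin 3 → ℤ} (hv : Even (∑ i, v i)) (hε : IsSignVector ε)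
    (s : Equiv.Perm (Fin 3)) (u : Fin 3 → ℝ) (r : ℤ) :
    HasParity r (cubicMap v ε s u) ↔ HasParity r u := by
  constructor
  · rintro ⟨n, hn, hr⟩
    have hm (i : Fin 3) : n i = v i + ε i *
        (fun j => ε (s.symm j) * (n (s.symm j) - v (s.symm j))) (s i) := by
      simp only [Equiv.symm_apply_apply]
      rcases hε i with h | h <;> rw [h] <;> ring
    refine ⟨fun j => ε (s.symm j) * (n (s.symm j) - v (s.symm j)), fun j => ?_, ?_⟩
    · obtain ⟨i, rfl⟩ := s.surjective j
      have := hn i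
      rw [cubicMap_apply] at this
      simp only [Equiv.symm_apply_apply]
      rcases hε i with h | h <;> rw [h] at this ⊢ <;> push_cast at this ⊢ <;> linarith
    · rwa [← even_sum_cubicMap_iff hv hε s, ← Finset.sum_congr rfl fun i _ => hm i]
  · rintro ⟨n, hn, hr⟩
    refine ⟨fun i => v i + ε i * n (s i), fun i => ?_, (even_sum_cubicMap_iff hv hε s n r).2 hr⟩
    rw [cubicMap_apply, hn]
    push_cast; rfl

/-- Sign changes and a permutation about v bring x into the chamber y₀ ≥ y₁ ≥ y₂ ≥ 0. -/
theorem exists_cubicMap_eq (v : Fin 3 → ℤ) (x : Fin 3 → ℝ) :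
    ∃ (ε : Fin 3 → ℤ) (s : Equiv.Perm (Fin 3)), IsSignVector ε ∧
      |x (s 1) - v (s 1)| ≤ |x (s 0) - v (s 0)| ∧ |x (s 2) - v (s 2)| ≤ |x (s 1) - v (s 1)| ∧
      cubicMap v ε s.symm (fun k => |x (s k) - v (s k)|) = x := by
  obtain ⟨s, h1, h2⟩ := exists_perm_antitone fun i => |x i - v i|
  refine ⟨fun i => if (v i : ℝ) ≤ x i then 1 else -1, s, fun i => ?_, h1, h2, ?_⟩
  · by_cases h : (v i : ℝ) ≤ x i <;> simp [h]
  · funext i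
    rw [cubicMap_apply, Equiv.apply_symm_apply]
    by_cases h : (v i : ℝ) ≤ x i
    · simp [h, abs_of_nonneg (sub_nonneg.2 h)]
    · simp [h, abs_of_neg (sub_neg.2 (not_le.1 h))]

theorem forall_ne_perm_iff (s : Equiv.Perm (Fin 3)) (P : Fin 3 → Fin 3 → Prop) :
    (∀ i j, i ≠ j → P (s i) (s j)) ↔ ∀ i j, i ≠ j → P i j := by
  refine ⟨fun h i j hij => ?_, fun h i j hij => h _ _ (s.injective.ne hij)⟩
  simpa using h (s.symm i) (s.symm j) (s.symm.injective.ne hij)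

/-! ### Cones from cube centres over quarter squares -/

/-- The open stars of the corners, the cube centres and the square centres in the triangulation
of the cubic lattice into tetrahedra spanned by a cube centre, the centre of a square of this cube
and an edge of this square. -/
def quarterStar (u x : Fin 3 → ℝ) : Prop :=
  ((∀ i, ∃ n : ℤ, u i = n) ∧ ∀ i j, i ≠ j → |x i - u i| + |x j - u j| < 1) ∨
  ((∀ i, ∃ n : ℤ, u i = n + 1 / 2) ∧ ∀ i, |x i - u i| < 1 / 2) ∨
  ∃ i, (∃ n : ℤ, u i = n) ∧
    ∀ j, j ≠ i → (∃ n : ℤ, u j = n + 1 / 2) ∧ |x i - u i| + |x j - u j| < 1 / 2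

/-- A tetrahedron spanned by the centre of a square, the centre of a cube and two corners. -/
noncomputable def quarterSimplex : Fin 4 → Fin 3 → ℝ :=
  ![![1 / 2, 1 / 2, 0], ![1 / 2, 1 / 2, 1 / 2], ![0, 0, 0], ![1, 0, 0]]

theorem quarterStar_map (v : Fin 3 → ℤ) {ε : Fin 3 → ℤ} (hε : IsSignVector ε)
    (s : Equiv.Perm (Fin 3)) (u x : Fin 3 → ℝ) :
    quarterStar (cubicMap v ε s u) (cubicMap v ε s x) ↔ quarterStar u x := by
  simp only [quarterStar, abs_cubicMap_sub v hε, cubicMap_int_iff v hε, cubicMap_half_iff v hε]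
  refine or_congr (and_congr ?_ ?_) (or_congr (and_congr ?_ ?_) ?_)
  · exact s.forall_congr_right (q := fun i => ∃ n : ℤ, u i = n)
  · exact forall_ne_perm_iff s fun i j => |x i - u i| + |x j - u j| < 1
  · exact s.forall_congr_right (q := fun i => ∃ n : ℤ, u i = n + 1 / 2)
  · exact s.forall_congr_right (q := fun i => |x i - u i| < 1 / 2)
  · constructor
    · rintro ⟨i, hn, h⟩
      refine ⟨s i, hn, fun j hj => ?_⟩
      simpa using h (s.symm j) fun e => hj (by rw [← e, s.apply_symm_apply])
    · rintro ⟨i, hn, h⟩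
      refine ⟨s.symm i, by simpa using hn, fun j hj => ?_⟩
      simpa using h (s j) fun e => hj (by rw [← e, s.symm_apply_apply])

theorem quarterSimplex_combination (w : Fin 4 → ℝ) :
    ∑ a, w a • quarterSimplex a = ![(w 0 + w 1) / 2 + w 3, (w 0 + w 1) / 2, w 1 / 2] := by
  funext i
  fin_cases i <;> simp [quarterSimplex, Fin.sum_univ_four] <;> ring

theorem quarterStar_vertex {w : Fin 4 → ℝ} (h0 : ∀ a, 0 ≤ w a) (h1 : ∑ a, w a = 1) (a : Fin 4)
    (ha : 0 < w a) : quarterStar (quarterSimplex a) (∑ a, w a • quarterSimplex a) := by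
  have g0 := h0 0
  have g1 := h0 1
  have g2 := h0 2
  have g3 := h0 3
  rw [Fin.sum_univ_four] at h1
  rw [quarterSimplex_combination]
  fin_cases a
  · refine .inr (.inr ⟨2, ⟨0, by simp [quarterSimplex]⟩, fun j hj => ?_⟩)
    fin_cases j
    · refine ⟨⟨0, by simp [quarterSimplex]⟩, abs_add_abs_lt_iff.2 ?_⟩
      simp [quarterSimplex] at ha ⊢
      refine ⟨?_, ?_, ?_, ?_⟩ <;> linarith
    · refine ⟨⟨0, by simp [quarterSimplex]⟩, abs_add_abs_lt_iff.2 ?_⟩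
      simp [quarterSimplex] at ha ⊢
      refine ⟨?_, ?_, ?_, ?_⟩ <;> linarith
    · exact absurd rfl hj
  · refine .inr (.inl ⟨fun i => ⟨0, ?_⟩, fun i => ?_⟩)
    · fin_cases i <;> simp [quarterSimplex]
    · rw [abs_lt]
      fin_cases i <;> simp [quarterSimplex] at ha ⊢ <;> constructor <;> linarith
  · refine .inl ⟨fun i => ⟨0, ?_⟩, fun i j hij => abs_add_abs_lt_iff.2 ?_⟩
    · fin_cases i <;> simp [quarterSimplex]
    · fin_cases i <;> fin_cases j <;> first
        | exact absurd rfl hij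
        | (simp [quarterSimplex] at ha ⊢; refine ⟨?_, ?_, ?_, ?_⟩ <;> linarith)
  · refine .inl ⟨fun i => ?_, fun i j hij => abs_add_abs_lt_iff.2 ?_⟩
    · fin_cases i
      · exact ⟨1, by simp [quarterSimplex]⟩
      · exact ⟨0, by simp [quarterSimplex]⟩
      · exact ⟨0, by simp [quarterSimplex]⟩
    · fin_cases i <;> fin_cases j <;> first
        | exact absurd rfl hij
        | (simp [quarterSimplex] at ha ⊢; refine ⟨?_, ?_, ?_, ?_⟩ <;> linarith)

/-- Only 0 ≤ y₂ ≤ y₁ ≤ y₀ and y₀ + y₁ ≤ 1 matter: every other corner or square centre compatible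
with these bounds violates an inequality of its star. -/
theorem mem_range_quarterSimplex {w : Fin 4 → ℝ} (h0 : ∀ a, 0 ≤ w a) (h1 : ∑ a, w a = 1)
    (u : Fin 3 → ℝ) (h : quarterStar u (∑ a, w a • quarterSimplex a)) :
    u ∈ Set.range quarterSimplex := by
  have g0 := h0 0
  have g1 := h0 1
  have g2 := h0 2
  have g3 := h0 3
  rw [Fin.sum_univ_four] at h1
  rw [quarterSimplex_combination] at h
  obtain ⟨y, hy⟩ : ∃ y : Fin 3 → ℝ,
    y = ![(w 0 + w 1) / 2 + w 3, (w 0 + w 1) / 2, w 1 / 2] := ⟨_, rfl⟩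
  have y0 : y 0 = (w 0 + w 1) / 2 + w 3 := by rw [hy]; rfl
  have y1 : y 1 = (w 0 + w 1) / 2 := by rw [hy]; rfl
  have y2 : y 2 = w 1 / 2 := by rw [hy]; rfl
  rw [← hy] at h
  have c1 : y 1 ≤ y 0 := by linarith
  have c2 : y 2 ≤ y 1 := by linarith
  have c3 : 0 ≤ y 2 := by linarith
  have c4 : y 0 + y 1 ≤ 1 := by linarith
  clear hy y0 y1 y2
  have hb (i : Fin 3) : 0 ≤ y i ∧ y i ≤ 1 := by fin_cases i <;> constructor <;> simp <;> linarith
  have hu : u = ![u 0, u 1, u 2] := by funext i; fin_cases i <;> rfl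
  rcases h with ⟨hn, hd⟩ | ⟨hn, hd⟩ | ⟨i, ⟨n, hn⟩, hd⟩
  · choose n hn using hn
    have d01 := hd 0 1 (by decide)
    have d02 := hd 0 2 (by decide)
    have d12 := hd 1 2 (by decide)
    rw [hn, hn] at d01 d02 d12
    have a0 : n 0 = 0 ∨ n 0 = 1 := eq_zero_or_one_of_abs_sub_lt (hb 0).1 (hb 0).2
      (by linarith [abs_nonneg (y 1 - n 1)])
    have a1 : n 1 = 0 ∨ n 1 = 1 := eq_zero_or_one_of_abs_sub_lt (hb 1).1 (hb 1).2
      (by linarith [abs_nonneg (y 0 - n 0)])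
    have a2 : n 2 = 0 ∨ n 2 = 1 := eq_zero_or_one_of_abs_sub_lt (hb 2).1 (hb 2).2
      (by linarith [abs_nonneg (y 0 - n 0)])
    rw [abs_add_abs_lt_iff] at d01 d02 d12
    rw [hu, hn, hn, hn]
    rcases a0 with k0 | k0 <;> rcases a1 with k1 | k1 <;> rcases a2 with k2 | k2 <;>
    simp only [k0, k1, k2, Int.cast_zero, Int.cast_one] at d01 d02 d12 ⊢
    · exact ⟨2, rfl⟩
    · linarith
    · linarith
    · linarith
    · exact ⟨3, rfl⟩
    · linarith
    · linarith
    · linarith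
  · have hh (i : Fin 3) : u i = 1 / 2 := by
      obtain ⟨n, hn⟩ := hn i
      have := hd i
      rw [hn] at this
      rw [hn, eq_zero_of_abs_sub_half_lt (hb i).1 (hb i).2 this]
      simp
    rw [hu, hh, hh, hh]
    exact ⟨1, rfl⟩
  · have hh (j : Fin 3) (hj : j ≠ i) : u j = 1 / 2 := by
      obtain ⟨⟨m, hm⟩, hlt⟩ := hd j hj
      have hlt' : |y j - u j| < 1 / 2 := by linarith [abs_nonneg (y i - u i)]
      rw [hm] at hlt'
      rw [hm, eq_zero_of_abs_sub_half_lt (hb j).1 (hb j).2 hlt']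
      simp
    have hlt (j : Fin 3) (hj : j ≠ i) : |y i - n| + |y j - 1 / 2| < 1 / 2 := by
      have := (hd j hj).2
      rwa [hn, hh j hj] at this
    obtain ⟨j, hj⟩ : ∃ j, j ≠ i := exists_ne i
    have hn01 : n = 0 ∨ n = 1 := eq_zero_or_one_of_abs_sub_lt (hb i).1 (hb i).2
      (by linarith [hlt j hj, abs_nonneg (y j - 1 / 2)])
    fin_cases i
    · have l1 := abs_add_abs_lt_iff.1 (hlt 1 (by decide))
      simp only [Fin.zero_eta] at l1
      rcases hn01 with rfl | rfl <;> norm_num at l1 <;> linarith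
    · have l1 := abs_add_abs_lt_iff.1 (hlt 0 (by decide))
      have l2 := abs_add_abs_lt_iff.1 (hlt 2 (by decide))
      simp only [Fin.mk_one] at l1 l2
      rcases hn01 with rfl | rfl <;> norm_num at l1 l2 <;> linarith
    · have l1 := abs_add_abs_lt_iff.1 (hlt 0 (by decide))
      have e0 : u 0 = 1 / 2 := hh 0 (by decide)
      have e1 : u 1 = 1 / 2 := hh 1 (by decide)
      simp only [Fin.reduceFinMk] at l1 hn
      rcases hn01 with rfl | rfl
      · rw [hu, e0, e1, hn, Int.cast_zero]
        exact ⟨0, rfl⟩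
      · norm_num at l1
        linarith

theorem quarterSimplex_cover (x : Fin 3 → ℝ) : ∃ (v ε : Fin 3 → ℤ) (s : Equiv.Perm (Fin 3))
    (w : Fin 4 → ℝ), IsSignVector ε ∧ (∀ a, 0 ≤ w a) ∧ ∑ a, w a = 1 ∧
      cubicMap v ε s (∑ a, w a • quarterSimplex a) = x := by
  obtain ⟨ε, s, hε, h1, h2, hx⟩ := exists_cubicMap_eq (fun i => round (x i)) x
  have hr (i : Fin 3) : |x i - round (x i)| ≤ 1 / 2 := abs_sub_round (x i)
  generalize hy : (fun k => |x (s k) - round (x (s k))|) = y at hx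
  have hy' (k : Fin 3) : |x (s k) - round (x (s k))| = y k := congrFun hy k
  have c3 : 0 ≤ y 2 := by rw [← hy']; exact abs_nonneg _
  have c4 : y 0 ≤ 1 / 2 := by rw [← hy']; exact hr _
  simp only [hy'] at h1 h2
  refine ⟨fun i => round (x i), ε, s.symm,
    ![2 * y 1 - 2 * y 2, 2 * y 2, 1 - y 0 - y 1, y 0 - y 1], hε, fun a => ?_, ?_, ?_⟩
  · fin_cases a <;> simp <;> linarith
  · simp [Fin.sum_univ_four]; ring
  · rw [quarterSimplex_combination]
    refine Eq.trans (congrArg _ ?_) hx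
    funext k
    fin_cases k <;> simp

/-! ### Cones from cube centres over half squares -/

/-- The open stars of the even corners, the odd corners and the cube centres in the triangulation
of the cubic lattice into cones from the cube centres over half squares, where the squares are cut
along the diagonals that join odd corners. -/
def halfStar (u x : Fin 3 → ℝ) : Prop :=
  (HasParity 0 u ∧ ∀ i j, i ≠ j → |x i - u i| + |x j - u j| < 1) ∨
  (HasParity 1 u ∧ ∃ m, ∀ i, |x i - u i| + |x m - u m| < 1) ∨
  ((∀ i, ∃ n : ℤ, u i = n + 1 / 2) ∧ ∀ i, |x i - u i| < 1 / 2)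

/-- A tetrahedron spanned by the centre of a cube and three vertices of a square of the cube. -/
noncomputable def halfSimplex : Fin 4 → Fin 3 → ℝ :=
  ![![1 / 2, 1 / 2, 1 / 2], ![0, 0, 0], ![1, 0, 0], ![0, 1, 0]]

theorem halfStar_map {v ε : Fin 3 → ℤ} (hv : Even (∑ i, v i)) (hε : IsSignVector ε)
    (s : Equiv.Perm (Fin 3)) (u x : Fin 3 → ℝ) :
    halfStar (cubicMap v ε s u) (cubicMap v ε s x) ↔ halfStar u x := by
  simp only [halfStar, abs_cubicMap_sub v hε, hasParity_cubicMap_iff hv hε, cubicMap_half_iff v hε]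
  refine or_congr (and_congr Iff.rfl ?_) (or_congr (and_congr Iff.rfl ?_) (and_congr ?_ ?_))
  · exact forall_ne_perm_iff s fun i j => |x i - u i| + |x j - u j| < 1
  · refine (exists_congr fun m => ?_).trans
      (s.exists_congr_right (q := fun m => ∀ i, |x i - u i| + |x m - u m| < 1))
    exact s.forall_congr_right (q := fun i => |x i - u i| + |x (s m) - u (s m)| < 1)
  · exact s.forall_congr_right (q := fun i => ∃ n : ℤ, u i = n + 1 / 2)
  · exact s.forall_congr_right (q := fun i => |x i - u i| < 1 / 2)

theorem halfSimplex_combination (w : Fin 4 → ℝ) :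
    ∑ a, w a • halfSimplex a = ![w 0 / 2 + w 2, w 0 / 2 + w 3, w 0 / 2] := by
  funext i
  fin_cases i <;> simp [halfSimplex, Fin.sum_univ_four] <;> ring

theorem halfStar_vertex {w : Fin 4 → ℝ} (h0 : ∀ a, 0 ≤ w a) (h1 : ∑ a, w a = 1) (a : Fin 4)
    (ha : 0 < w a) : halfStar (halfSimplex a) (∑ a, w a • halfSimplex a) := by
  have g0 := h0 0
  have g1 := h0 1
  have g2 := h0 2
  have g3 := h0 3
  rw [Fin.sum_univ_four] at h1
  rw [halfSimplex_combination]
  fin_cases a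
  · refine .inr (.inr ⟨fun i => ⟨0, ?_⟩, fun i => ?_⟩)
    · fin_cases i <;> simp [halfSimplex]
    · rw [abs_lt]
      fin_cases i <;> simp [halfSimplex] at ha ⊢ <;> constructor <;> linarith
  · refine .inl ⟨⟨0, fun i => ?_, by simp⟩, fun i j hij => abs_add_abs_lt_iff.2 ?_⟩
    · fin_cases i <;> simp [halfSimplex]
    · fin_cases i <;> fin_cases j <;> first
        | exact absurd rfl hij
        | (simp [halfSimplex] at ha ⊢; refine ⟨?_, ?_, ?_, ?_⟩ <;> linarith)
  · refine .inr (.inl ⟨⟨![1, 0, 0], fun i => ?_, by decide⟩, 2, fun i => abs_add_abs_lt_iff.2 ?_⟩)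
    · fin_cases i <;> simp [halfSimplex]
    · fin_cases i <;> simp [halfSimplex] at ha ⊢ <;> constructorm* _ ∧ _ <;> linarith
  · refine .inr (.inl ⟨⟨![0, 1, 0], fun i => ?_, by decide⟩, 2, fun i => abs_add_abs_lt_iff.2 ?_⟩)
    · fin_cases i <;> simp [halfSimplex]
    · fin_cases i <;> simp [halfSimplex] at ha ⊢ <;> constructorm* _ ∧ _ <;> linarith

theorem mem_range_halfSimplex {w : Fin 4 → ℝ} (h0 : ∀ a, 0 ≤ w a) (h1 : ∑ a, w a = 1)
    (u : Fin 3 → ℝ) (h : halfStar u (∑ a, w a • halfSimplex a)) : u ∈ Set.range halfSimplex := by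
  have g0 := h0 0
  have g1 := h0 1
  have g2 := h0 2
  have g3 := h0 3
  rw [Fin.sum_univ_four] at h1
  rw [halfSimplex_combination] at h
  obtain ⟨y, hy⟩ : ∃ y : Fin 3 → ℝ, y = ![w 0 / 2 + w 2, w 0 / 2 + w 3, w 0 / 2] := ⟨_, rfl⟩
  have y0 : y 0 = w 0 / 2 + w 2 := by rw [hy]; rfl
  have y1 : y 1 = w 0 / 2 + w 3 := by rw [hy]; rfl
  have y2 : y 2 = w 0 / 2 := by rw [hy]; rfl
  rw [← hy] at h
  have c1 : y 2 ≤ y 0 := by linarith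
  have c2 : y 2 ≤ y 1 := by linarith
  have c3 : 0 ≤ y 2 := by linarith
  have c4 : y 0 + y 1 ≤ 1 := by linarith
  clear hy y0 y1 y2
  have hb (i : Fin 3) : 0 ≤ y i ∧ y i ≤ 1 := by fin_cases i <;> constructor <;> simp <;> linarith
  have hu : u = ![u 0, u 1, u 2] := by funext i; fin_cases i <;> rfl
  rcases h with ⟨⟨n, hn, hp⟩, hd⟩ | ⟨⟨n, hn, hp⟩, m, hd⟩ | ⟨hn, hd⟩
  · have d01 := hd 0 1 (by decide)
    have d02 := hd 0 2 (by decide)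
    have d12 := hd 1 2 (by decide)
    rw [hn, hn] at d01 d02 d12
    have a0 : n 0 = 0 ∨ n 0 = 1 := eq_zero_or_one_of_abs_sub_lt (hb 0).1 (hb 0).2
      (by linarith [abs_nonneg (y 1 - n 1)])
    have a1 : n 1 = 0 ∨ n 1 = 1 := eq_zero_or_one_of_abs_sub_lt (hb 1).1 (hb 1).2
      (by linarith [abs_nonneg (y 0 - n 0)])
    have a2 : n 2 = 0 ∨ n 2 = 1 := eq_zero_or_one_of_abs_sub_lt (hb 2).1 (hb 2).2
      (by linarith [abs_nonneg (y 0 - n 0)])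
    rw [abs_add_abs_lt_iff] at d01 d02 d12
    rw [Fin.sum_univ_three] at hp
    rw [hu, hn, hn, hn]
    rcases a0 with k0 | k0 <;> rcases a1 with k1 | k1 <;> rcases a2 with k2 | k2 <;>
    simp only [k0, k1, k2, Int.cast_zero, Int.cast_one] at d01 d02 d12 hp ⊢
    · exact ⟨1, rfl⟩
    · exact absurd hp (by decide)
    · exact absurd hp (by decide)
    · linarith
    · exact absurd hp (by decide)
    · linarith
    · linarith
    · exact absurd hp (by decide)
  · have hlt (i : Fin 3) : |y i - n i| + |y m - n m| < 1 := by
      have := hd i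
      rwa [hn, hn] at this
    have ha (i : Fin 3) : n i = 0 ∨ n i = 1 := eq_zero_or_one_of_abs_sub_lt (hb i).1 (hb i).2
      (by linarith [hlt i, abs_nonneg (y m - n m)])
    have d0 := abs_add_abs_lt_iff.1 (hlt 0)
    have d1 := abs_add_abs_lt_iff.1 (hlt 1)
    have d2 := abs_add_abs_lt_iff.1 (hlt 2)
    rw [Fin.sum_univ_three] at hp
    rw [hu, hn, hn, hn]
    rcases ha 0 with k0 | k0 <;> rcases ha 1 with k1 | k1 <;> rcases ha 2 with k2 | k2 <;>
    simp only [k0, k1, k2, Int.cast_zero, Int.cast_one] at d0 d1 d2 hp ⊢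
    · exact absurd hp (by decide)
    · fin_cases m <;> simp [k0, k1, k2] at d0 d1 d2 <;> linarith
    · exact ⟨3, rfl⟩
    · exact absurd hp (by decide)
    · exact ⟨2, rfl⟩
    · exact absurd hp (by decide)
    · exact absurd hp (by decide)
    · fin_cases m <;> simp [k0, k1, k2] at d0 d1 d2 <;> linarith
  · have hh (i : Fin 3) : u i = 1 / 2 := by
      obtain ⟨n, hn⟩ := hn i
      have := hd i
      rw [hn] at this
      rw [hn, eq_zero_of_abs_sub_half_lt (hb i).1 (hb i).2 this]
      simp
    rw [hu, hh, hh, hh]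
    exact ⟨0, rfl⟩

/-- The nearest point with an even coordinate sum. -/
theorem exists_even_near (x : Fin 3 → ℝ) : ∃ v : Fin 3 → ℤ, Even (∑ i, v i) ∧
    ∀ i j, i ≠ j → |x i - v i| + |x j - v j| ≤ 1 := by
  have hr (i : Fin 3) : |x i - round (x i)| ≤ 1 / 2 := abs_sub_round (x i)
  by_cases he : Even (∑ i, round (x i))
  · exact ⟨fun i => round (x i), he, fun i j _ => by linarith [hr i, hr j]⟩
  -- If rounding gives an odd sum, the coordinate farthest from its rounding is moved to the integer
  -- on its other side. Its distance becomes one minus the largest distance, so pairwise sums stay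
  -- at most 1.
  obtain ⟨m, hm⟩ := Finite.exists_max fun i => |x i - round (x i)|
  obtain ⟨δ, hδ, hδ'⟩ : ∃ δ : ℤ, Odd δ ∧
      |x m - (round (x m) + δ : ℤ)| = 1 - |x m - round (x m)| := by
    have h := abs_le.1 (hr m)
    rcases abs_cases (x m - round (x m)) with ⟨h1, h2⟩ | ⟨h1, h2⟩
    · refine ⟨1, by decide, ?_⟩
      rw [h1]; push_cast
      rw [abs_of_nonpos (by linarith)]; ring
    · refine ⟨-1, by decide, ?_⟩
      rw [h1]; push_cast
      rw [abs_of_nonneg (by linarith)]; ring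
  have hm1 (j : Fin 3) (hj : j ≠ m) : Function.update (fun i => round (x i)) m (round (x m) + δ) j =
      round (x j) := Function.update_of_ne hj _ _
  have hm2 : Function.update (fun i => round (x i)) m (round (x m) + δ) m = round (x m) + δ :=
    Function.update_self _ _ _
  refine ⟨Function.update (fun i => round (x i)) m (round (x m) + δ), ?_, fun i j hij => ?_⟩
  · rw [Finset.sum_update_of_mem (Finset.mem_univ m), add_right_comm,
      Finset.sdiff_singleton_eq_erase,
      Finset.add_sum_erase _ (fun i => round (x i)) (Finset.mem_univ m)]
    exact (Int.not_even_iff_odd.1 he).add_odd hδ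
  · by_cases hi : i = m
    · subst hi
      rw [hm2, hm1 j hij.symm, hδ']
      linarith [hm j]
    · by_cases hj : j = m
      · subst hj
        rw [hm2, hm1 i hij, hδ']
        linarith [hm i]
      · rw [hm1 i hi, hm1 j hj]
        linarith [hr i, hr j]

/-- Relative to a nearby even corner, the sorted distances satisfy y₀ ≥ y₁ ≥ y₂ ≥ 0 and y₀ + y₁ ≤ 1,
which makes the barycentric weights nonnegative. -/
theorem halfSimplex_cover (x : Fin 3 → ℝ) : ∃ (v ε : Fin 3 → ℤ) (s : Equiv.Perm (Fin 3))
    (w : Fin 4 → ℝ), Even (∑ i, v i) ∧ IsSignVector ε ∧ (∀ a, 0 ≤ w a) ∧ ∑ a, w a = 1 ∧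
      cubicMap v ε s (∑ a, w a • halfSimplex a) = x := by
  obtain ⟨v, hv, hv'⟩ := exists_even_near x
  obtain ⟨ε, s, hε, h1, h2, hx⟩ := exists_cubicMap_eq v x
  generalize hy : (fun k => |x (s k) - v (s k)|) = y at hx
  have hy' (k : Fin 3) : |x (s k) - v (s k)| = y k := congrFun hy k
  have c3 : 0 ≤ y 2 := by rw [← hy']; exact abs_nonneg _
  have c4 : y 0 + y 1 ≤ 1 := by rw [← hy', ← hy']; exact hv' _ _ (s.injective.ne (by decide))
  simp only [hy'] at h1 h2
  refine ⟨v, ε, s.symm, ![2 * y 2, 1 - y 0 - y 1, y 0 - y 2, y 1 - y 2], hv, hε, fun a => ?_, ?_,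
    ?_⟩
  · fin_cases a <;> simp <;> linarith
  · simp [Fin.sum_univ_four]; ring
  · rw [halfSimplex_combination]
    refine Eq.trans (congrArg _ ?_) hx
    funext k
    fin_cases k <;> simp

/-! ### Sommerville's tetrahedra in the cubic lattice -/

namespace Tetrahedron

theorem eq_zero_of_norm_sq_eq {f : Fin 3 → E3} {k : ℝ} (hk : 0 < k)
    (hf : ∀ z : Fin 3 → ℝ, ‖∑ i, z i • f i‖ ^ 2 = k * ∑ i, z i ^ 2) (z : Fin 3 → ℝ)
    (hz : ∑ i, z i • f i = 0) : z = 0 := by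
  have h1 := hf z
  rw [hz, norm_zero, zero_pow two_ne_zero, zero_eq_mul, or_iff_right hk.ne'] at h1
  funext i
  have := (Finset.sum_eq_zero_iff_of_nonneg fun i _ => sq_nonneg (z i)).1 h1 i (Finset.mem_univ i)
  exact pow_eq_zero_iff two_ne_zero |>.1 this

theorem exists_isometry_cubicMap {o : E3} {f : Fin 3 → E3} {L : (Fin 3 → ℝ) ≃ᵃ[ℝ] E3}
    (hL : ∀ z, L z = o + ∑ i, z i • f i) {k : ℝ}
    (hf : ∀ z : Fin 3 → ℝ, ‖∑ i, z i • f i‖ ^ 2 = k * ∑ i, z i ^ 2) (v : Fin 3 → ℤ)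
    {ε : Fin 3 → ℤ} (hε : IsSignVector ε) (s : Equiv.Perm (Fin 3)) :
    ∃ g : E3 ≃ᵃⁱ[ℝ] E3, ∀ z, g (L z) = L (cubicMap v ε s z) := by
  refine exists_isometry_of_coordinates hL _ _ fun z => ?_
  rw [← sq_eq_sq₀ (norm_nonneg _) (norm_nonneg _), hf, hf, ← Equiv.sum_comp s fun i => z i ^ 2]
  congr 1
  refine Finset.sum_congr rfl fun i _ => ?_
  rw [scaledPerm_apply, mul_pow]
  rcases hε i with h | h <;> simp [h]

theorem tilesFaceToFace_of_sommerville2 {T : Tetrahedron} {σ : Equiv.Perm (Fin 4)} {k : ℝ}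
    (hk : 0 < k) (h : sqEdges (T.points ∘ σ) = k • ![1, 2, 2, 3, 3, 4]) : T.TilesFaceToFace := by
  set p := T.points ∘ σ with hp
  -- In a cubic lattice of side 2√k, p 2 and p 3 span an edge, p 0 is the centre of a square and p 1
  -- the centre of a cube; f is the orthogonal frame at p 2.
  let f : Fin 3 → E3 := ![p 3 - p 2, (2 : ℝ) • p 0 - p 2 - p 3, (2 : ℝ) • (p 1 - p 0)]
  have hf (z : Fin 3 → ℝ) : ‖∑ i, z i • f i‖ ^ 2 = (4 * k) * ∑ i, z i ^ 2 := by
    have hz : ∑ i, z i • f i = (2 * z 2) • (p 1 - p 0) + (-z 0 - z 1) • (p 2 - p 0) +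
        (z 0 - z 1) • (p 3 - p 0) := by
      simp only [f, Fin.sum_univ_three, Matrix.cons_val]
      module
    rw [hz, norm_sq_combination, h]
    simp only [Fin.sum_univ_three, Matrix.cons_val, Pi.smul_apply, smul_eq_mul]
    ring
  obtain ⟨L, hL⟩ := exists_coordinates (p 2) (eq_zero_of_norm_sq_eq (by positivity) hf)
  refine tilesFaceToFace_of_coordinates (T.range_points_comp σ) L (b := quarterSimplex) ?_
    {φ | ∃ (v ε : Fin 3 → ℤ) (s : Equiv.Perm (Fin 3)), IsSignVector ε ∧ φ = cubicMap v ε s}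
    ?_ quarterStar ?_ (fun w h0 h1 a => quarterStar_vertex h0 h1 a)
    (fun w h0 h1 => mem_range_quarterSimplex h0 h1) ?_
  · intro a
    rw [hL, Fin.sum_univ_three, ← hp]
    fin_cases a <;> simp only [quarterSimplex, f, Fin.zero_eta, Fin.mk_one, Fin.reduceFinMk,
      Matrix.cons_val] <;> module
  · rintro _ ⟨v, ε, s, hε, rfl⟩
    exact exists_isometry_cubicMap hL hf v hε s
  · rintro _ ⟨v, ε, s, hε, rfl⟩ u x
    exact quarterStar_map v hε s u x
  · intro x
    obtain ⟨v, ε, s, w, hε, h0, h1, hx⟩ := quarterSimplex_cover x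
    exact ⟨_, ⟨v, ε, s, hε, rfl⟩, w, h0, h1, hx⟩

theorem tilesFaceToFace_of_sommerville3 {T : Tetrahedron} {σ : Equiv.Perm (Fin 4)} {k : ℝ}
    (hk : 0 < k) (h : sqEdges (T.points ∘ σ) = k • ![3, 3, 3, 4, 4, 8]) : T.TilesFaceToFace := by
  set p := T.points ∘ σ with hp
  -- Here p 0 is the centre of a cube of side 2√k, and p 1, p 2, p 3 are corners of one of its
  -- squares with the right angle at p 1.
  let f : Fin 3 → E3 := ![p 2 - p 1, p 3 - p 1, (2 : ℝ) • p 0 - p 2 - p 3]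
  have hf (z : Fin 3 → ℝ) : ‖∑ i, z i • f i‖ ^ 2 = (4 * k) * ∑ i, z i ^ 2 := by
    have hz : ∑ i, z i • f i = (-z 0 - z 1) • (p 1 - p 0) + (z 0 - z 2) • (p 2 - p 0) +
        (z 1 - z 2) • (p 3 - p 0) := by
      simp only [f, Fin.sum_univ_three, Matrix.cons_val]
      module
    rw [hz, norm_sq_combination, h]
    simp only [Fin.sum_univ_three, Matrix.cons_val, Pi.smul_apply, smul_eq_mul]
    ring
  obtain ⟨L, hL⟩ := exists_coordinates (p 1) (eq_zero_of_norm_sq_eq (by positivity) hf)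
  refine tilesFaceToFace_of_coordinates (T.range_points_comp σ) L (b := halfSimplex) ?_
    {φ | ∃ (v ε : Fin 3 → ℤ) (s : Equiv.Perm (Fin 3)),
      Even (∑ i, v i) ∧ IsSignVector ε ∧ φ = cubicMap v ε s}
    ?_ halfStar ?_ (fun w h0 h1 a => halfStar_vertex h0 h1 a)
    (fun w h0 h1 => mem_range_halfSimplex h0 h1) ?_
  · intro a
    rw [hL, Fin.sum_univ_three, ← hp]
    fin_cases a <;> simp only [halfSimplex, f, Fin.zero_eta, Fin.mk_one, Fin.reduceFinMk,
      Matrix.cons_val] <;> module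
  · rintro _ ⟨v, ε, s, -, hε, rfl⟩
    exact exists_isometry_cubicMap hL hf v hε s
  · rintro _ ⟨v, ε, s, hv, hε, rfl⟩ u x
    exact halfStar_map hv hε s u x
  · intro x
    obtain ⟨v, ε, s, w, hv, hε, h0, h1, hx⟩ := halfSimplex_cover x
    exact ⟨_, ⟨v, ε, s, hv, hε, rfl⟩, w, h0, h1, hx⟩

end Tetrahedron

/-! ### Assembling the classification -/

theorem TileName.tilesFaceToFace (t : TileName) {T : Tetrahedron} (h : T.HasAngles t.row) :
    T.TilesFaceToFace := by
  obtain ⟨σ, k, hk, hσ⟩ := (t.shape_iff_sqEdges T).1 ((t.hasAngles_iff_shape T).1 h)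
  cases t
  case sommerville3 => exact Tetrahedron.tilesFaceToFace_of_sommerville3 hk hσ
  case sommerville2 => exact Tetrahedron.tilesFaceToFace_of_sommerville2 hk hσ
  case goldbergTwoPiDivEight =>
    refine Tetrahedron.tilesFaceToFace_of_goldberg (B := k) (C := 2 * k)
      (σ := σ * Equiv.swap 0 2) ?_
    rw [Equiv.Perm.coe_mul, ← Function.comp_assoc, sqEdges_comp_swap_zero_two, hσ]
    funext e
    fin_cases e <;> simp [TileName.sqEdges] <;> ring
  case goldbergTwoPiDivFive =>
    refine Tetrahedron.tilesFaceToFace_of_goldberg (B := k * (5 + 2 * √5)) (C := k * (6 + 2 * √5))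
      (σ := σ * Equiv.swap 1 2) ?_
    rw [Equiv.Perm.coe_mul, ← Function.comp_assoc, sqEdges_comp_swap_one_two, hσ]
    funext e
    fin_cases e <;> simp [TileName.sqEdges]
    ring
  case sommerville1 =>
    -- Sommerville No. 1 has the Goldberg shape with B : C = 3 : 4, where the long edge satisfies 3
    -- (C − B) = B.
    refine Tetrahedron.tilesFaceToFace_of_goldberg (B := 3 * k) (C := 4 * k)
      (σ := σ * Equiv.swap 1 2) ?_
    rw [Equiv.Perm.coe_mul, ← Function.comp_assoc, sqEdges_comp_swap_one_two, hσ]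
    funext e
    fin_cases e <;> simp [TileName.sqEdges] <;> ring

theorem theorem4p7 :
    -- the tetrahedral tiles with all dihedral angles of the form 2π/n are exactly the five listed
    (∀ T : Tetrahedron, (T.AllAnglesTwoPiDiv ∧ T.TilesFaceToFace) ↔
      ∃ t : TileName, T.HasAngles t.row) ∧
    -- each of the five occurs, and its dihedral angles characterize the tetrahedron of that name
    (∀ t : TileName, ∃ T : Tetrahedron, T.HasAngles t.row) ∧
    (∀ (t : TileName) (T : Tetrahedron), T.HasAngles t.row ↔ t.Shape T) ∧
    -- the others with all dihedral angles of the form 2π/n are exactly NT(A)-NT(F): each occurs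
    (∀ T : Tetrahedron, T.AllAnglesTwoPiDiv ↔
      (∃ t : TileName, T.HasAngles t.row) ∨ (∃ t : NonTileName, T.HasAngles t.row)) ∧
    (∀ t : NonTileName, ∃ T : Tetrahedron, T.HasAngles t.row) ∧
    -- and these do not tile
    (∀ (t : NonTileName) (T : Tetrahedron), T.HasAngles t.row → ¬ T.TilesFaceToFace) := by
  refine ⟨fun T => ⟨?_, ?_⟩, fun t => t.realizes.exists_hasAngles t.two_le_row,
    fun t T => t.hasAngles_iff_shape T, Tetrahedron.allAnglesTwoPiDiv_iff,
    fun t => t.realizes.exists_hasAngles t.two_le_row, fun t T => t.not_tilesFaceToFace T⟩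
  · rintro ⟨hT, htile⟩
    exact (T.allAnglesTwoPiDiv_iff.1 hT).resolve_right fun ⟨t, ht⟩ =>
      t.not_tilesFaceToFace T ht htile
  · rintro ⟨t, ht⟩
    exact ⟨T.allAnglesTwoPiDiv_iff.2 (.inl ⟨t, ht⟩), t.tilesFaceToFace ht⟩
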